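/- Manifolds are smooth, finite-dimensional, Hausdorff, second countable and without boundary. Let $\mathscr{G}\rightrightarrows M$ be a Lie groupoid with source $s$, target $t$, units $\mathrm{Id}_m$ (composition $g.h$ is defined when $s(g)=t(h)$). A bisection is a smooth map $\beta\colon M\to\mathscr{G}$ with $s\circ\beta=\mathrm{id}_M$ such that $t_*\beta:=t\circ\beta$ is a diffeomorphism of $M$; bisections form a group $\mathbb{B}$, with $\beta^{-1}(m)=\beta\bigl((t_*\beta)^{-1}(m)\bigr)^{-1}$, which acts on $\mathscr{G}$ by $\beta\vartriangleright g=\beta(t(g)).g$ on the left, by $g\vartriangleleft\beta=g.\bigl(\beta^{-1}(s(g))\bigr)^{-1}$ on the right, and by conjugation $C_\beta(g)=\beta(t(g)).g.\beta(s(g))^{-1}$. Let $\mathscr{P}$ be a principaloid $\mathscr{G}$-bundle over a manifold $\Sigma$: a fibre bundle $\pi_{\mathscr{P}}\colon\mathscr{P}\to\Sigma$ (a surjective submersion) with typical fibre $\mathscr{G}$ and local trivialisations $\tau_i\colon\pi_{\mathscr{P}}^{-1}(O_i)\cong O_i\times\mathscr{G}$ over an open cover $\{O_i\}_{i\in I}$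 of $\Sigma$, such that $\tau_i\circ\tau_j^{-1}(\sigma,g)=(\sigma,\beta_{ij}(\sigma)\vartriangleright g)$ for $\sigma\in O_i\cap O_j$, where the $\beta_{ij}(\sigma)$ are bisections depending smoothly on $\sigma$ (i.e. $(\sigma,m)\mapsto\beta_{ij}(\sigma)(m)$ is smooth on $(O_i\cap O_j)\times M$). The group $\mathbb{B}$ acts on $\mathscr{P}$ from the right by $\mathscr{R}_\beta(\tau_i^{-1}(\sigma,g))=\tau_i^{-1}(\sigma,g\vartriangleleft\beta)$. Consider the following quotients, in which points over the same $\sigma\in O_i\cap O_j$ are identified: * the shadow $\mathscr{F}=\bigsqcup_i O_i\times M/\!\sim$, with $[(\sigma,m,j)]=[(\sigma,t_*\beta_{ij}(\sigma)(m),i)]$, and $\pi_{\mathscr{F}}[(\sigma,m,i)]=\sigma$; * the Atiyah bundle $\mathrm{At}(\mathscr{P})=\bigsqcup_i\mathscr{P}\times O_i/\!\sim$, with $[(p,\sigma,j)]=[(\mathscr{R}_{\beta_{ij}(\sigma)^{-1}}(p),\sigma,i)]$, and $\pi\colon\mathrm{At}(\mathscr{P})\to\Sigma\times\Sigma$, $\pi[(p,\sigma,i)]=(\pi_{\mathscr{P}}(p),\sigma)$;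 its points are the classes $[(\sigma_1,g,\sigma_2,i,j)]:=[(\tau_i^{-1}(\sigma_1,g),\sigma_2,j)]$ with $\sigma_1\in O_i$, $\sigma_2\in O_j$, $g\in\mathscr{G}$; * $\mathrm{Ad}(\mathscr{P})=\pi^{-1}(\mathrm{Id}(\Sigma))$, the preimage of the diagonal $\mathrm{Id}(\Sigma)\subset\Sigma\times\Sigma$. Then $\mathscr{F}$ and $\mathrm{At}(\mathscr{P})$, with the quotient topologies, are smooth manifolds for which the maps $(\sigma,m)\mapsto[(\sigma,m,i)]$ and $(\sigma,p)\mapsto[(p,\sigma,i)]$ are diffeomorphisms from $O_i\times M$ and $O_i\times\mathscr{P}$ onto the parts over $O_i$, and $(\sigma_1,\sigma_2,g)\mapsto[(\sigma_1,g,\sigma_2,i,j)]$ is a diffeomorphism from $O_i\times O_j\times\mathscr{G}$ onto $\pi^{-1}(O_i\times O_j)$. Moreover: 1. $\mathrm{At}(\mathscr{P})\rightrightarrows\mathscr{F}$ is a Lie groupoid with source $\mathsf{S}$, target $\mathsf{T}$, unit map $\mathsf{I}$, inverse $\mathsf{J}$ and multiplication $\mathsf{M}$ given by the (well-defined) formulas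 $$\mathsf{S}[(\sigma_1,g,\sigma_2,i,j)]=[(\sigma_2,s(g),j)],\quad \mathsf{T}[(\sigma_1,g,\sigma_2,i,j)]=[(\sigma_1,t(g),i)],\quad \mathsf{I}[(\sigma,m,i)]=[(\sigma,\mathrm{Id}_m,\sigma,i,i)],$$ $$\mathsf{J}[(\sigma_1,g,\sigma_2,i,j)]=[(\sigma_2,g^{-1},\sigma_1,j,i)],$$ $$\mathsf{M}\bigl([(\sigma_1,g,\sigma_2,i,j)],[(\sigma_2,h,\sigma_3,k,l)]\bigr)=[(\sigma_1,g.(\beta_{jk}(\sigma_2)\vartriangleright h),\sigma_3,i,l)]\quad\text{if } s(g)=t(\beta_{jk}(\sigma_2)\vartriangleright h).$$ 2. $\mathrm{Ad}(\mathscr{P})$ has a smooth structure and the structure of a Lie groupoid over $\mathscr{F}$ such that, with $j$ the inclusion, $(j,\mathrm{id}_{\mathscr{F}})$ and $(\pi,\pi_{\mathscr{F}})$ are morphisms of Lie groupoids forming a short exact sequence $$\mathrm{Ad}(\mathscr{P})\hookrightarrow\mathrm{At}(\mathscr{P})\twoheadrightarrow\mathrm{Pair}(\Sigma),$$ that is: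 $j$ is an embedding of manifolds, $\pi$ and $\pi_{\mathscr{F}}$ are surjective submersions, and the image of $j$ is the $\pi$-preimage of the unit bisection of the pair groupoid $\mathrm{Pair}(\Sigma)$. 3. $(\pi,\pi_{\mathscr{F}})$ makes $\mathrm{At}(\mathscr{P})$ a fibre-bundle object in Lie groupoids over $\mathrm{Pair}(\Sigma)$ with fibre $\mathscr{G}$: for all $\sigma_1,\sigma_2\in\Sigma$ there is an open $V\subset\Sigma$ containing both, over which there are local trivialisations $\pi^{-1}(V\times V)\cong(V\times V)\times\mathscr{G}$ and $\pi_{\mathscr{F}}^{-1}(V)\cong V\times M$ forming an isomorphism of Lie groupoids onto $\mathrm{Pair}(V)\times\mathscr{G}$ that covers the identity of $\mathrm{Pair}(V)$. 4. The quotient $\bigsqcup_i O_i\times\mathscr{G}/\!\sim$, with $[(\sigma,g,j)]=[(\sigma,C_{\beta_{ij}(\sigma)}(g),i)]$ for $\sigma\in O_i\cap O_j$, is a smooth manifold for which the maps $(\sigma,g)\mapsto[(\sigma,g,i)]$ are diffeomorphisms onto the parts over $O_i$, and $[(\sigma,g,i)]\mapsto[(\sigma,g,\sigma,i,i)]$ is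 a (well-defined) diffeomorphism from it onto $\mathrm{Ad}(\mathscr{P})$. -/

import Mathlib

open scoped Manifold ContDiff Topology

noncomputable section

namespace Principaloid

/-! ### Smooth manifolds, submersions, embeddings, smooth local trivialisations -/

/-- A smooth manifold: finite-dimensional, without boundary, Hausdorff, second countable. -/
class SmoothMfd {E : Type*} [NormedAddCommGroup E] [NormedSpace ℝ E] {H : Type*}
    [TopologicalSpace H] (I : ModelWithCorners ℝ E H) (M : Type*) [TopologicalSpace M]
    [ChartedSpace H M] : Prop extends
    IsManifold I ∞ M, T2Space M, SecondCountableTopology M where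
  finiteDimensional : FiniteDimensional ℝ E
  boundaryless : I.Boundaryless

section Smooth

variable {E : Type*} [NormedAddCommGroup E] [NormedSpace ℝ E] {H : Type*} [TopologicalSpace H]
  {E' : Type*} [NormedAddCommGroup E'] [NormedSpace ℝ E'] {H' : Type*} [TopologicalSpace H']
  {E'' : Type*} [NormedAddCommGroup E''] [NormedSpace ℝ E''] {H'' : Type*} [TopologicalSpace H'']
  {M : Type*} [TopologicalSpace M] [ChartedSpace H M]
  {N : Type*} [TopologicalSpace N] [ChartedSpace H' N]
  {Z : Type*} [TopologicalSpace Z] [ChartedSpace H'' Z]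

instance SmoothMfd.prod (I : ModelWithCorners ℝ E H) (I' : ModelWithCorners ℝ E' H')
    [h : SmoothMfd I M] [h' : SmoothMfd I' N] : SmoothMfd (I.prod I') (M × N) where
  toIsManifold := inferInstance
  toT2Space := inferInstance
  toSecondCountableTopology := inferInstance
  finiteDimensional := by
    have := h.finiteDimensional
    have := h'.finiteDimensional
    infer_instance
  boundaryless := by
    have := h.boundaryless
    have := h'.boundaryless
    infer_instance

/-- A surjective submersion: smooth, surjective, with surjective differential everywhere. -/
structure IsSurjSubmersion (I : ModelWithCorners ℝ E H) (I' : ModelWithCorners ℝ E' H')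
    (f : M → N) : Prop where
  contMDiff : ContMDiff I I' ∞ f
  surjective : Function.Surjective f
  surjective_mfderiv : ∀ x, Function.Surjective (mfderiv I I' f x)

/-- An embedding of manifolds: smooth, a homeomorphism onto its image, with injective
differential everywhere. -/
structure IsEmbeddingMfd (I : ModelWithCorners ℝ E H) (I' : ModelWithCorners ℝ E' H')
    (f : M → N) : Prop where
  contMDiff : ContMDiff I I' ∞ f
  isEmbedding : Topology.IsEmbedding f
  injective_mfderiv : ∀ x, Function.Injective (mfderiv I I' f x)

/-- A local trivialisation `π⁻¹(U) ≅ U × N` of `π : Z → M` is smooth if it is a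
diffeomorphism. -/
structure IsSmoothTriv (I : ModelWithCorners ℝ E H) (I' : ModelWithCorners ℝ E' H')
    (I'' : ModelWithCorners ℝ E'' H'') {π : Z → M} (e : Bundle.Trivialization N π) : Prop where
  contMDiffOn_toFun : ContMDiffOn I'' (I.prod I') ∞ e e.source
  contMDiffOn_symm : ContMDiffOn (I.prod I') I'' ∞ e.toOpenPartialHomeomorph.symm e.target

end Smooth

/-! ### Lie groupoids -/

section LieGroupoid

variable {E : Type*} [NormedAddCommGroup E] [NormedSpace ℝ E] {H : Type*} [TopologicalSpace H]
  {E' : Type*} [NormedAddCommGroup E'] [NormedSpace ℝ E'] {H' : Type*} [TopologicalSpace H']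

/-- A Lie groupoid `G ⇉ M`. The multiplication is a total function `G → G → G`, of which only the
values on composable pairs (`src g = tgt h`) carry meaning; it is smooth on the submanifold of
composable pairs in `G × G`. -/
structure LieGroupoid (I : ModelWithCorners ℝ E H) (M : Type*) [TopologicalSpace M]
    [ChartedSpace H M] [SmoothMfd I M] (J : ModelWithCorners ℝ E' H') (G : Type*)
    [TopologicalSpace G] [ChartedSpace H' G] [SmoothMfd J G] where
  src : G → M
  tgt : G → M
  one : M → G
  inv : G → G
  mul : G → G → G
  src_one : ∀ m, src (one m) = m
  tgt_one : ∀ m, tgt (one m) = m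
  src_mul : ∀ g h, src g = tgt h → src (mul g h) = src h
  tgt_mul : ∀ g h, src g = tgt h → tgt (mul g h) = tgt g
  mul_assoc : ∀ g h k, src g = tgt h → src h = tgt k → mul (mul g h) k = mul g (mul h k)
  one_mul : ∀ g, mul (one (tgt g)) g = g
  mul_one : ∀ g, mul g (one (src g)) = g
  src_inv : ∀ g, src (inv g) = tgt g
  tgt_inv : ∀ g, tgt (inv g) = src g
  mul_inv : ∀ g, mul g (inv g) = one (tgt g)
  inv_mul : ∀ g, mul (inv g) g = one (src g)
  submersion_src : IsSurjSubmersion J I src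
  submersion_tgt : IsSurjSubmersion J I tgt
  contMDiff_one : ContMDiff I J ∞ one
  contMDiff_inv : ContMDiff J J ∞ inv
  contMDiffOn_mul : ContMDiffOn (J.prod J) J ∞ (fun x : G × G => mul x.1 x.2)
    {x : G × G | src x.1 = tgt x.2}

/-- The pair groupoid `M × M ⇉ M`, with `(x, y)` an arrow from `y` to `x`. -/
def LieGroupoid.pair (I : ModelWithCorners ℝ E H) (M : Type*) [TopologicalSpace M]
    [ChartedSpace H M] [SmoothMfd I M] : LieGroupoid I M (I.prod I) (M × M) where
  src x := x.2
  tgt x := x.1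
  one m := (m, m)
  inv x := (x.2, x.1)
  mul x y := (x.1, y.2)
  src_one _ := rfl
  tgt_one _ := rfl
  src_mul _ _ _ := rfl
  tgt_mul _ _ _ := rfl
  mul_assoc _ _ _ _ _ := rfl
  one_mul _ := rfl
  mul_one _ := rfl
  src_inv _ := rfl
  tgt_inv _ := rfl
  mul_inv _ := rfl
  inv_mul _ := rfl
  submersion_src :=
    { contMDiff := contMDiff_snd
      surjective := fun m => ⟨(m, m), rfl⟩
      surjective_mfderiv := fun x => by
        rw [mfderiv_snd]
        exact fun v => ⟨((0 : E), v), rfl⟩ }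
  submersion_tgt :=
    { contMDiff := contMDiff_fst
      surjective := fun m => ⟨(m, m), rfl⟩
      surjective_mfderiv := fun x => by
        rw [mfderiv_fst]
        exact fun v => ⟨(v, (0 : E)), rfl⟩ }
  contMDiff_one := contMDiff_id.prodMk contMDiff_id
  contMDiff_inv := contMDiff_snd.prodMk contMDiff_fst
  contMDiffOn_mul :=
    ((contMDiff_fst.comp contMDiff_fst).prodMk (contMDiff_snd.comp contMDiff_snd)).contMDiffOn

end LieGroupoid

section Hom

variable {E₁ : Type*} [NormedAddCommGroup E₁] [NormedSpace ℝ E₁] {H₁ : Type*} [TopologicalSpace H₁]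
  {F₁ : Type*} [NormedAddCommGroup F₁] [NormedSpace ℝ F₁] {K₁ : Type*} [TopologicalSpace K₁]
  {E₂ : Type*} [NormedAddCommGroup E₂] [NormedSpace ℝ E₂] {H₂ : Type*} [TopologicalSpace H₂]
  {F₂ : Type*} [NormedAddCommGroup F₂] [NormedSpace ℝ F₂] {K₂ : Type*} [TopologicalSpace K₂]
  {E₃ : Type*} [NormedAddCommGroup E₃] [NormedSpace ℝ E₃] {H₃ : Type*} [TopologicalSpace H₃]
  {F₃ : Type*} [NormedAddCommGroup F₃] [NormedSpace ℝ F₃] {K₃ : Type*} [TopologicalSpace K₃]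
  {I₁ : ModelWithCorners ℝ E₁ H₁} {J₁ : ModelWithCorners ℝ F₁ K₁}
  {I₂ : ModelWithCorners ℝ E₂ H₂} {J₂ : ModelWithCorners ℝ F₂ K₂}
  {I₃ : ModelWithCorners ℝ E₃ H₃} {J₃ : ModelWithCorners ℝ F₃ K₃}
  {M₁ : Type*} [TopologicalSpace M₁] [ChartedSpace H₁ M₁] [SmoothMfd I₁ M₁]
  {G₁ : Type*} [TopologicalSpace G₁] [ChartedSpace K₁ G₁] [SmoothMfd J₁ G₁]
  {M₂ : Type*} [TopologicalSpace M₂] [ChartedSpace H₂ M₂] [SmoothMfd I₂ M₂]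
  {G₂ : Type*} [TopologicalSpace G₂] [ChartedSpace K₂ G₂] [SmoothMfd J₂ G₂]
  {M₃ : Type*} [TopologicalSpace M₃] [ChartedSpace H₃ M₃] [SmoothMfd I₃ M₃]
  {G₃ : Type*} [TopologicalSpace G₃] [ChartedSpace K₃ G₃] [SmoothMfd J₃ G₃]

/-- A morphism of Lie groupoids: a functor with smooth object and arrow components. -/
structure LieGroupoid.Hom (𝒢₁ : LieGroupoid I₁ M₁ J₁ G₁) (𝒢₂ : LieGroupoid I₂ M₂ J₂ G₂) where
  obj : M₁ → M₂
  arr : G₁ → G₂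
  src_arr : ∀ g, 𝒢₂.src (arr g) = obj (𝒢₁.src g)
  tgt_arr : ∀ g, 𝒢₂.tgt (arr g) = obj (𝒢₁.tgt g)
  arr_one : ∀ m, arr (𝒢₁.one m) = 𝒢₂.one (obj m)
  arr_mul : ∀ g h, 𝒢₁.src g = 𝒢₁.tgt h → arr (𝒢₁.mul g h) = 𝒢₂.mul (arr g) (arr h)
  contMDiff_obj : ContMDiff I₁ I₂ ∞ obj
  contMDiff_arr : ContMDiff J₁ J₂ ∞ arr

/-- A short exact sequence `𝒢₁ ↪ 𝒢₂ ↠ 𝒢₃` of Lie groupoids: `j` is an embedding, `p` is a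
surjective submersion (on objects and on arrows), and the image of `j` is the `p`-preimage of the
unit bisection of `𝒢₃`. -/
structure IsShortExact {𝒢₁ : LieGroupoid I₁ M₁ J₁ G₁} {𝒢₂ : LieGroupoid I₂ M₂ J₂ G₂}
    {𝒢₃ : LieGroupoid I₃ M₃ J₃ G₃} (j : 𝒢₁.Hom 𝒢₂) (p : 𝒢₂.Hom 𝒢₃) : Prop where
  mono_obj : IsEmbeddingMfd I₁ I₂ j.obj
  mono_arr : IsEmbeddingMfd J₁ J₂ j.arr
  epi_obj : IsSurjSubmersion I₂ I₃ p.obj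
  epi_arr : IsSurjSubmersion J₂ J₃ p.arr
  range_arr : Set.range j.arr = p.arr ⁻¹' Set.range 𝒢₃.one

/-- `p : 𝒜 → ℬ` is a fibre-bundle object in the category of Lie groupoids, with fibre `𝒢`: it is
locally trivial in that category. Every arrow of `ℬ` lies in an open subgroupoid `ℬ|_V` (the arrows
with source and target in the open set `V` of objects) over which `𝒜` is isomorphic, as a Lie
groupoid over `ℬ|_V`, to the product `ℬ|_V × 𝒢`; the pair `(θ, Θ)` is the isomorphism. -/
def IsFibreBundleObject {𝒜 : LieGroupoid I₁ M₁ J₁ G₁} {ℬ : LieGroupoid I₂ M₂ J₂ G₂}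
    (p : 𝒜.Hom ℬ) (𝒢 : LieGroupoid I₃ M₃ J₃ G₃) : Prop :=
  ∀ b : G₂, ∃ V : Set M₂, IsOpen V ∧ ℬ.src b ∈ V ∧ ℬ.tgt b ∈ V ∧
    ∃ (θ : Bundle.Trivialization M₃ p.obj) (Θ : Bundle.Trivialization G₃ p.arr),
      θ.baseSet = V ∧ IsSmoothTriv I₂ I₃ I₁ θ ∧
      Θ.baseSet = {b' | ℬ.src b' ∈ V ∧ ℬ.tgt b' ∈ V} ∧ IsSmoothTriv J₂ J₃ J₁ Θ ∧
      (∀ a ∈ Θ.source, θ (𝒜.src a) = (ℬ.src (p.arr a), 𝒢.src (Θ a).2)) ∧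
      (∀ a ∈ Θ.source, θ (𝒜.tgt a) = (ℬ.tgt (p.arr a), 𝒢.tgt (Θ a).2)) ∧
      (∀ x ∈ θ.source, Θ (𝒜.one x) = (ℬ.one (p.obj x), 𝒢.one (θ x).2)) ∧
      (∀ a ∈ Θ.source, Θ (𝒜.inv a) = (ℬ.inv (p.arr a), 𝒢.inv (Θ a).2)) ∧
      (∀ a ∈ Θ.source, ∀ a' ∈ Θ.source, 𝒜.src a = 𝒜.tgt a' →
        Θ (𝒜.mul a a') = (ℬ.mul (p.arr a) (p.arr a'), 𝒢.mul (Θ a).2 (Θ a').2))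

end Hom

/-! ### Bisections -/

section Bisection

variable {E : Type*} [NormedAddCommGroup E] [NormedSpace ℝ E] {H : Type*} [TopologicalSpace H]
  {E' : Type*} [NormedAddCommGroup E'] [NormedSpace ℝ E'] {H' : Type*} [TopologicalSpace H']
  {I : ModelWithCorners ℝ E H} {J : ModelWithCorners ℝ E' H'}
  {M : Type*} [TopologicalSpace M] [ChartedSpace H M] [SmoothMfd I M]
  {G : Type*} [TopologicalSpace G] [ChartedSpace H' G] [SmoothMfd J G]

/-- A global bisection: a smooth section `β` of the source map for which `tgt ∘ β` is a
diffeomorphism `shadow` of `M` (the shadow action of `β` on `M`). -/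
structure LieGroupoid.Bisection (𝒢 : LieGroupoid I M J G) where
  toFun : M → G
  contMDiff_toFun : ContMDiff I J ∞ toFun
  src_toFun : ∀ m, 𝒢.src (toFun m) = m
  shadow : Diffeomorph I I M M ∞
  tgt_toFun : ∀ m, 𝒢.tgt (toFun m) = shadow m

variable {𝒢 : LieGroupoid I M J G}

/-- The inverse bisection `β⁻¹ = Inv ∘ β ∘ (tgt ∘ β)⁻¹`. -/
def LieGroupoid.Bisection.symm (β : 𝒢.Bisection) : 𝒢.Bisection where
  toFun m := 𝒢.inv (β.toFun (β.shadow.symm m))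
  contMDiff_toFun :=
    𝒢.contMDiff_inv.comp (β.contMDiff_toFun.comp β.shadow.symm.contMDiff)
  src_toFun m := by
    rw [𝒢.src_inv, β.tgt_toFun, Diffeomorph.apply_symm_apply]
  shadow := β.shadow.symm
  tgt_toFun m := by rw [𝒢.tgt_inv, β.src_toFun]

/-- Left multiplication `β ▷ g = β(t(g)) . g`. -/
def LieGroupoid.Bisection.left (β : 𝒢.Bisection) (g : G) : G :=
  𝒢.mul (β.toFun (𝒢.tgt g)) g

/-- Right multiplication `g ◁ β = g . (β⁻¹(s(g)))⁻¹`. -/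
def LieGroupoid.Bisection.right (g : G) (β : 𝒢.Bisection) : G :=
  𝒢.mul g (𝒢.inv (β.symm.toFun (𝒢.src g)))

/-- Conjugation `C_β(g) = β(t(g)) . g . β(s(g))⁻¹`. -/
def LieGroupoid.Bisection.conj (β : 𝒢.Bisection) (g : G) : G :=
  𝒢.mul (𝒢.mul (β.toFun (𝒢.tgt g)) g) (𝒢.inv (β.toFun (𝒢.src g)))

/-- Left and right multiplication by bisections commute. -/
theorem LieGroupoid.Bisection.left_right (β γ : 𝒢.Bisection) (g : G) :
    right (β.left g) γ = β.left (right g γ) := by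
  have h1 : 𝒢.src (β.toFun (𝒢.tgt g)) = 𝒢.tgt g := β.src_toFun _
  have h2 : 𝒢.src g = 𝒢.tgt (𝒢.inv (γ.symm.toFun (𝒢.src g))) := by
    rw [𝒢.tgt_inv, γ.symm.src_toFun]
  unfold right left
  rw [𝒢.src_mul _ _ h1, 𝒢.mul_assoc _ _ _ h1 h2, 𝒢.tgt_mul _ _ h2]

end Bisection

/-! ### Bundles given by a clutching construction -/

section Clutching

variable {B N ι : Type*}

/-- The identification `(σ, n, j) ∼ (σ, c i j σ n, i)` for `σ ∈ O i ∩ O j`, on the disjoint union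
of the `O i × N`. -/
def ClutchRel (O : ι → Set B) (c : ι → ι → B → N → N) (x y : Σ i, O i × N) : Prop :=
  (x.2.1 : B) = y.2.1 ∧ y.2.2 = c y.1 x.1 x.2.1 x.2.2

/-- The bundle over `B` with fibre `N` glued from the `O i × N` along the transition maps `c`, with
the quotient topology. -/
def Clutched (O : ι → Set B) (c : ι → ι → B → N → N) : Type _ := Quot (ClutchRel O c)

variable {O : ι → Set B} {c : ι → ι → B → N → N}

instance Clutched.instTopologicalSpace [TopologicalSpace B] [TopologicalSpace N] :
    TopologicalSpace (Clutched O c) :=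
  inferInstanceAs (TopologicalSpace (Quot (ClutchRel O c)))

/-- The class `[(σ, n, i)]`. -/
def Clutched.mk (i : ι) (σ : O i) (n : N) : Clutched O c := Quot.mk _ ⟨i, σ, n⟩

/-- The base projection `[(σ, n, i)] ↦ σ`. -/
def Clutched.proj : Clutched O c → B :=
  Quot.lift (fun x => (x.2.1 : B)) fun _ _ h => h.1

/-- A smooth structure on a clutched bundle is the one of the model if, for each `i`, the canonical
bijection between the part over `O i` and `O i × N` is a diffeomorphism. This determines the
smooth structure. -/
def Clutched.IsModelled {EB : Type*} [NormedAddCommGroup EB] [NormedSpace ℝ EB]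
    {HB : Type*} [TopologicalSpace HB] {EN : Type*} [NormedAddCommGroup EN] [NormedSpace ℝ EN]
    {HN : Type*} [TopologicalSpace HN] {EZ : Type*} [NormedAddCommGroup EZ] [NormedSpace ℝ EZ]
    {HZ : Type*} [TopologicalSpace HZ]
    (IB : ModelWithCorners ℝ EB HB) (IN : ModelWithCorners ℝ EN HN)
    (IZ : ModelWithCorners ℝ EZ HZ) [TopologicalSpace B] [ChartedSpace HB B]
    [TopologicalSpace N] [ChartedSpace HN N] (O : ι → Set B) (c : ι → ι → B → N → N)
    [ChartedSpace HZ (Clutched O c)] : Prop :=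
  ∀ i, ∃ e : Bundle.Trivialization N (Clutched.proj : Clutched O c → B),
    e.baseSet = O i ∧ IsSmoothTriv IB IN IZ e ∧
    ∀ (σ : O i) (n : N), e (Clutched.mk i σ n) = ((σ : B), n)

end Clutching

/-! ### Principaloid bundles, their shadow, Atiyah and adjoint bundles -/

section Bundle

variable {EM : Type*} [NormedAddCommGroup EM] [NormedSpace ℝ EM] {HM : Type*} [TopologicalSpace HM]
  {EG : Type*} [NormedAddCommGroup EG] [NormedSpace ℝ EG] {HG : Type*} [TopologicalSpace HG]
  {EB : Type*} [NormedAddCommGroup EB] [NormedSpace ℝ EB] {HB : Type*} [TopologicalSpace HB]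
  {EP : Type*} [NormedAddCommGroup EP] [NormedSpace ℝ EP] {HP : Type*} [TopologicalSpace HP]
  {IM : ModelWithCorners ℝ EM HM} {IG : ModelWithCorners ℝ EG HG}
  {M : Type*} [TopologicalSpace M] [ChartedSpace HM M] [SmoothMfd IM M]
  {G : Type*} [TopologicalSpace G] [ChartedSpace HG G] [SmoothMfd IG G]

/-- A principaloid bundle with structure groupoid `𝒢`: a fibre bundle `P → B` with typical fibre the
arrow manifold `G`, together with a reduction of its structure group to the group of bisections of
`𝒢` acting on `G` by left multiplication, represented by local trivialisations `triv i` over the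
members of an open cover `(triv i).baseSet` whose transition maps are left multiplications by
bisections `trans i j σ` depending smoothly on `σ`. The values `trans i j σ` for `σ` outside
the double overlap are irrelevant. -/
structure PrincipaloidBundle (𝒢 : LieGroupoid IM M IG G)
    (IB : ModelWithCorners ℝ EB HB) (B : Type*) [TopologicalSpace B] [ChartedSpace HB B]
    [SmoothMfd IB B] (IP : ModelWithCorners ℝ EP HP) (P : Type*) [TopologicalSpace P]
    [ChartedSpace HP P] [SmoothMfd IP P] (ι : Type*) where
  proj : P → B
  submersion_proj : IsSurjSubmersion IP IB proj
  triv : ι → Bundle.Trivialization G proj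
  smooth_triv : ∀ i, IsSmoothTriv IB IG IP (triv i)
  exists_mem : ∀ σ : B, ∃ i, σ ∈ (triv i).baseSet
  trans : ι → ι → B → 𝒢.Bisection
  smooth_trans : ∀ i j, ContMDiffOn (IB.prod IM) IG ∞
    (fun x : B × M => (trans i j x.1).toFun x.2)
    (((triv i).baseSet ∩ (triv j).baseSet) ×ˢ Set.univ)
  triv_triv_symm : ∀ i j σ g, σ ∈ (triv i).baseSet → σ ∈ (triv j).baseSet →
    triv i ((triv j).toOpenPartialHomeomorph.symm (σ, g)) = (σ, (trans i j σ).left g)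

namespace PrincipaloidBundle

variable {𝒢 : LieGroupoid IM M IG G}
  {IB : ModelWithCorners ℝ EB HB} {B : Type*} [TopologicalSpace B] [ChartedSpace HB B]
  [SmoothMfd IB B] {IP : ModelWithCorners ℝ EP HP} {P : Type*} [TopologicalSpace P]
  [ChartedSpace HP P] [SmoothMfd IP P] {ι : Type*}
  (𝒬 : PrincipaloidBundle 𝒢 IB B IP P ι)

/-- The trivialising cover of the base. -/
def cover (i : ι) : Set B := (𝒬.triv i).baseSet

/-- The point of `P` with coordinates `(σ, g)` in the `i`-th trivialisation. -/
def pt (i : ι) (σ : 𝒬.cover i) (g : G) : P :=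
  (𝒬.triv i).toOpenPartialHomeomorph.symm ((σ : B), g)

/-- Some index of a trivialisation over a given base point. -/
def index (σ : B) : ι := (𝒬.exists_mem σ).choose

/-- The right action of the group of bisections on `P`: in local trivialisations, it is the right
multiplication `(σ, g) ↦ (σ, g ◁ β)`. By `rightAct_pt`, the choice of the trivialisation
is immaterial. -/
def rightAct (p : P) (β : 𝒢.Bisection) : P :=
  𝒬.pt (𝒬.index (𝒬.proj p)) ⟨𝒬.proj p, (𝒬.exists_mem (𝒬.proj p)).choose_spec⟩
    (LieGroupoid.Bisection.right (𝒬.triv (𝒬.index (𝒬.proj p)) p).2 β)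

theorem proj_pt (i : ι) (σ : 𝒬.cover i) (g : G) : 𝒬.proj (𝒬.pt i σ g) = σ :=
  (𝒬.triv i).proj_symm_apply' σ.2

theorem proj_rightAct (p : P) (β : 𝒢.Bisection) : 𝒬.proj (𝒬.rightAct p β) = 𝒬.proj p :=
  𝒬.proj_pt _ _ _

theorem rightAct_pt (i : ι) (σ : 𝒬.cover i) (g : G) (β : 𝒢.Bisection) :
    𝒬.rightAct (𝒬.pt i σ g) β = 𝒬.pt i σ (LieGroupoid.Bisection.right g β) := by
  obtain ⟨σ, hσ⟩ := σ
  have hp : 𝒬.proj (𝒬.pt i ⟨σ, hσ⟩ g) = σ := 𝒬.proj_pt _ _ _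
  set k := 𝒬.index σ with hk
  have hσk : σ ∈ (𝒬.triv k).baseSet := (𝒬.exists_mem σ).choose_spec
  have e1 : 𝒬.rightAct (𝒬.pt i ⟨σ, hσ⟩ g) β = 𝒬.pt k ⟨σ, hσk⟩
      (LieGroupoid.Bisection.right (𝒬.triv k (𝒬.pt i ⟨σ, hσ⟩ g)).2 β) := by
    unfold rightAct
    change (𝒬.triv _).toOpenPartialHomeomorph.symm (_, _) = (𝒬.triv _).toOpenPartialHomeomorph.symm (_, _)
    simp only [hp, hk]
  have e2 : 𝒬.triv k (𝒬.pt i ⟨σ, hσ⟩ g) = (σ, (𝒬.trans k i σ).left g) :=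
    𝒬.triv_triv_symm k i σ g hσk hσ
  rw [e1, e2]
  have e3 := 𝒬.triv_triv_symm k i σ (LieGroupoid.Bisection.right g β) hσk hσ
  rw [← LieGroupoid.Bisection.left_right] at e3
  have hs : 𝒬.pt i ⟨σ, hσ⟩ (LieGroupoid.Bisection.right g β) ∈ (𝒬.triv k).source := by
    rw [(𝒬.triv k).mem_source, 𝒬.proj_pt]
    exact hσk
  change (𝒬.triv k).toOpenPartialHomeomorph.symm (σ, _) = _
  rw [← e3]
  exact (𝒬.triv k).toOpenPartialHomeomorph.left_inv hs

/-- The shadow bundle: glued from the `O i × M` by the shadow action of the transition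
bisections. -/
abbrev Shadow : Type _ := Clutched 𝒬.cover fun i j σ (m : M) => (𝒬.trans i j σ).shadow m

/-- The Atiyah bundle: the bundle over `B` with fibre `P`, glued from the `O i × P` by the right
action of the inverse transition bisections. -/
abbrev Atiyah : Type _ :=
  Clutched 𝒬.cover fun i j σ (p : P) => 𝒬.rightAct p (𝒬.trans i j σ).symm

/-- The bundle over `B` with fibre `G`, glued from the `O i × G` by conjugation by the transition
bisections. -/
abbrev AdjointModel : Type _ := Clutched 𝒬.cover fun i j σ (g : G) => (𝒬.trans i j σ).conj g

/-- The map `[(p, σ)] ↦ (π(p), σ)` from the Atiyah bundle to `B × B`. -/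
def anchor (a : 𝒬.Atiyah) : B × B :=
  (Quot.lift (fun x => 𝒬.proj x.2.2)
    (fun x y h => by rw [h.2, 𝒬.proj_rightAct]) a, Clutched.proj a)

/-- The adjoint bundle: the preimage of the unit bisection of the pair groupoid of `B` under
`anchor`, with the subspace topology. -/
abbrev Adjoint : Type _ := {a : 𝒬.Atiyah // 𝒬.anchor a ∈ Set.range (LieGroupoid.pair IB B).one}

/-- The element `[(σ₁, g, σ₂, i, j)]` of the Atiyah bundle, for `σ₁ ∈ O i` and `σ₂ ∈ O j`: the class
of `(p, σ₂)` in the `j`-th chart, where `p` has coordinates `(σ₁, g)` in the `i`-th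
trivialisation. -/
def arrow (i j : ι) (σ₁ : 𝒬.cover i) (g : G) (σ₂ : 𝒬.cover j) : 𝒬.Atiyah :=
  Clutched.mk j σ₂ (𝒬.pt i σ₁ g)

end PrincipaloidBundle

end Bundle

end Principaloid

end

namespace Principaloid

/-! ### Gluing a smooth structure from manifold-valued charts. -/

section Gluing

variable {E : Type*} [NormedAddCommGroup E] [NormedSpace ℝ E] {H : Type*} [TopologicalSpace H]
  {I : ModelWithCorners ℝ E H} {X : Type*} [TopologicalSpace X] [ChartedSpace H X]
  {Z ι : Type*} [TopologicalSpace Z]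

/-! Everything is read in coordinates. Over `O k × O l` an element of the Atiyah bundle is a triple
`(σ₁, g, σ₂)`, and a change of trivialisations multiplies `g` on the left by a transition bisection
at `σ₁` and on the right by the inverse of one at `σ₂` (`arrow_eq_arrow`). The two multiplications
commute. The left one fixes the source and moves the target by the shadow action, the right one
fixes the target and moves the source by the shadow action, and inversion exchanges them. In a
product `g.h` the right factor of `g` and the left factor of `h` at the common middle point cancel
(`right_symm_mul_left`). Hence the structure maps of `𝒢`, applied to the coordinate `g`, do not
depend on the trivialisations. The groupoid axioms follow from those of `𝒢` once composable elements
are written with the same trivialisation at the middle point (`exists_eq_arrow_of_composable`).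

The cocycle condition for the transition bisections is not part of the data. It follows because left
multiplication by them compares coordinates of one and the same point of `P` (`trans_left_left`);
evaluation on units then gives it for the bisections themselves. With it, one clutching construction
(`SmoothClutching.exists_isModelled`) makes the shadow, the Atiyah bundle and the conjugation bundle
into manifolds. In the charts the source, target, unit and inversion are products of a structure map
of the pair groupoid with the corresponding one of `𝒢`, so smoothness and submersivity are
immediate; multiplication has the same form on composable pairs with a common middle chart.

Over the diagonal both multiplications use the same bisection, so the coordinate changes by
conjugation: this identifies the adjoint bundle with the glued model. Forgetting one of the two base
points is a local smooth retraction onto the adjoint bundle, which makes it embedded and lets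
smoothness of its structure maps be tested in the Atiyah bundle.

For local triviality in the category of Lie groupoids, two distinct points of the base get disjoint
neighbourhoods, and their union carries a locally constant choice of index. A single choice of
trivialisation at each base point leaves no transition bisection in the product formula. -/

theorem mem_contDiffGroupoid_of_contMDiffOn {φ : OpenPartialHomeomorph H H}
    (hφ : ContMDiffOn I I ∞ φ φ.source) (hφ' : ContMDiffOn I I ∞ φ.symm φ.target) :
    φ ∈ contDiffGroupoid ∞ I := by
  -- `φ` is a chart of `H` viewed as a manifold over itself; its compatibility with the identity
  -- chart is the claim.
  have h := φ.mem_maximalAtlas_of_contMDiffOn hφ hφ'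
  have h' := StructureGroupoid.compatible_of_mem_maximalAtlas
    ((contDiffGroupoid ∞ I).subset_maximalAtlas (chart_mem_atlas H (I.symm 0))) h
  rwa [chartAt_self_eq, OpenPartialHomeomorph.refl_symm, OpenPartialHomeomorph.refl_trans] at h'

/-- A family of local homeomorphisms from `Z` to a manifold whose sources cover `Z` and whose
transition maps are smooth. -/
structure SmoothGluing (I : ModelWithCorners ℝ E H) (e : ι → OpenPartialHomeomorph Z X) :
    Prop where
  exists_mem : ∀ z, ∃ i, z ∈ (e i).source
  contMDiffOn : ∀ i j, ContMDiffOn I I ∞ (fun x => e j ((e i).symm x))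
    ((e i).target ∩ (e i).symm ⁻¹' (e j).source)

/-- The charted space structure glued from a family of local homeomorphisms. -/
@[reducible]
noncomputable def gluedChartedSpace (H : Type*) [TopologicalSpace H] {X : Type*}
    [TopologicalSpace X] [ChartedSpace H X]
    (e : ι → OpenPartialHomeomorph Z X) (he : ∀ z, ∃ i, z ∈ (e i).source) : ChartedSpace H Z where
  atlas := {f | ∃ i, ∃ φ ∈ atlas H X, f = e i ≫ₕ φ}
  chartAt z := e (he z).choose ≫ₕ chartAt H (e (he z).choose z)
  mem_chart_source z := by
    have := (he z).choose_spec
    simp [this]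
  chart_mem_atlas z := ⟨_, _, chart_mem_atlas H _, rfl⟩

variable {e : ι → OpenPartialHomeomorph Z X} [IsManifold I ∞ X]

/-- The transition factors as a chart of `X`, after a transition of the family `e`, after an inverse
chart of `X`. -/
theorem SmoothGluing.contMDiffOn_trans (h : SmoothGluing I e) {i j : ι}
    {φ ψ : OpenPartialHomeomorph X H} (hφ : φ ∈ atlas H X) (hψ : ψ ∈ atlas H X) :
    ContMDiffOn I I ∞ ((e i ≫ₕ φ).symm ≫ₕ (e j ≫ₕ ψ)) ((e i ≫ₕ φ).symm ≫ₕ (e j ≫ₕ ψ)).source := by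
  have h1 := contMDiffOn_symm_of_mem_maximalAtlas (I := I)
    ((contDiffGroupoid ∞ I).subset_maximalAtlas hφ)
  have h2 := contMDiffOn_of_mem_maximalAtlas (I := I)
    ((contDiffGroupoid ∞ I).subset_maximalAtlas hψ)
  refine (h2.comp ((h.contMDiffOn i j).comp (h1.mono ?_) ?_) ?_)
  · intro x hx; simp at hx; exact hx.1.1
  · intro x hx; simp at hx; exact ⟨hx.1.2, hx.2.1⟩
  · intro x hx; simp at hx; exact hx.2.2

theorem SmoothGluing.isManifold (h : SmoothGluing I e) :
    letI := gluedChartedSpace H e h.exists_mem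
    IsManifold I ∞ Z := by
  let := gluedChartedSpace H e h.exists_mem
  refine @IsManifold.mk' _ _ _ _ _ _ _ I ∞ Z _ _ ⟨?_⟩
  rintro f f' ⟨i, φ, hφ, rfl⟩ ⟨j, ψ, hψ, rfl⟩
  refine mem_contDiffGroupoid_of_contMDiffOn (h.contMDiffOn_trans hφ hψ) ?_
  have := h.contMDiffOn_trans (i := j) (j := i) hψ hφ
  simpa [OpenPartialHomeomorph.trans_symm_eq_symm_trans_symm] using this

/-- Near `z` one inserts an atlas chart `e j ≫ₕ φ`: then `e i` is that chart, followed by `φ.symm`,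
followed by the smooth transition from `e j` to `e i`. -/
theorem SmoothGluing.contMDiffOn_chart (h : SmoothGluing I e) (i : ι) :
    letI := gluedChartedSpace H e h.exists_mem
    ContMDiffOn I I ∞ (e i) (e i).source := by
  let := gluedChartedSpace H e h.exists_mem
  have := h.isManifold
  intro z hz
  obtain ⟨j, hj⟩ := h.exists_mem z
  set φ := chartAt H (e j z)
  have hφ := chart_mem_atlas H (e j z)
  have hf : e j ≫ₕ φ ∈ atlas H Z := ⟨j, φ, hφ, rfl⟩
  have hzf : z ∈ (e j ≫ₕ φ).source := by simp [hj, φ]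
  have h1 := contMDiffAt_of_mem_maximalAtlas (I := I) (n := ∞)
    ((contDiffGroupoid ∞ I).subset_maximalAtlas hf) hzf
  have h2 : ContMDiffAt I I ∞ φ.symm ((e j ≫ₕ φ) z) :=
    contMDiffAt_symm_of_mem_maximalAtlas (I := I) (n := ∞)
      ((contDiffGroupoid ∞ I).subset_maximalAtlas hφ) (by simp [φ])
  have h3 : ContMDiffAt I I ∞ (fun x => e i ((e j).symm x)) (φ.symm ((e j ≫ₕ φ) z)) := by
    refine (h.contMDiffOn j i).contMDiffAt
      (((e j).isOpen_inter_preimage_symm (e i).open_source).mem_nhds ?_)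
    simp [φ, hj, hz]
  refine ContMDiffAt.contMDiffWithinAt ((h3.comp z (h2.comp z h1)).congr_of_eventuallyEq ?_)
  filter_upwards [(e j ≫ₕ φ).open_source.mem_nhds hzf] with y hy
  simp at hy
  simp [hy]

theorem SmoothGluing.contMDiffOn_chart_symm (h : SmoothGluing I e) (i : ι) :
    letI := gluedChartedSpace H e h.exists_mem
    ContMDiffOn I I ∞ (e i).symm (e i).target := by
  let := gluedChartedSpace H e h.exists_mem
  have := h.isManifold
  intro x hx
  obtain ⟨j, hj⟩ := h.exists_mem ((e i).symm x)
  set y := e j ((e i).symm x) with hy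
  set φ := chartAt H y
  have hφ := chart_mem_atlas H y
  have hf : e j ≫ₕ φ ∈ atlas H Z := ⟨j, φ, hφ, rfl⟩
  have h1 : ContMDiffAt I I ∞ φ y := contMDiffAt_of_mem_maximalAtlas (I := I) (n := ∞)
    ((contDiffGroupoid ∞ I).subset_maximalAtlas hφ) (mem_chart_source _ _)
  have hyj : y ∈ (e j).target := (e j).map_source hj
  have h2 : ContMDiffAt I I ∞ (e j ≫ₕ φ).symm (φ y) :=
    contMDiffAt_symm_of_mem_maximalAtlas (I := I) (n := ∞)
      ((contDiffGroupoid ∞ I).subset_maximalAtlas hf) (by simp [φ, hyj])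
  have hm : (e i).target ∩ (e i).symm ⁻¹' (e j).source ∈ 𝓝 x :=
    ((e i).isOpen_inter_preimage_symm (e j).open_source).mem_nhds ⟨hx, hj⟩
  have h3 : ContMDiffAt I I ∞ (fun x => e j ((e i).symm x)) x :=
    (h.contMDiffOn i j).contMDiffAt hm
  refine ContMDiffAt.contMDiffWithinAt ((h2.comp x (h1.comp x h3)).congr_of_eventuallyEq ?_)
  have hc := h3.continuousAt.preimage_mem_nhds ((chartAt H y).open_source.mem_nhds
    (mem_chart_source H y))
  filter_upwards [hm, hc] with w hw hw'
  simp at hw'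
  simp [φ, hw', (e j).left_inv hw.2]

end Gluing

/-! ### Differentials of maps with local inverses and of commuting squares. -/

section Differential

variable {E₁ : Type*} [NormedAddCommGroup E₁] [NormedSpace ℝ E₁] {H₁ : Type*} [TopologicalSpace H₁]
  {E₂ : Type*} [NormedAddCommGroup E₂] [NormedSpace ℝ E₂] {H₂ : Type*} [TopologicalSpace H₂]
  {E₃ : Type*} [NormedAddCommGroup E₃] [NormedSpace ℝ E₃] {H₃ : Type*} [TopologicalSpace H₃]
  {E₄ : Type*} [NormedAddCommGroup E₄] [NormedSpace ℝ E₄] {H₄ : Type*} [TopologicalSpace H₄]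
  {I₁ : ModelWithCorners ℝ E₁ H₁} {I₂ : ModelWithCorners ℝ E₂ H₂}
  {I₃ : ModelWithCorners ℝ E₃ H₃} {I₄ : ModelWithCorners ℝ E₄ H₄}
  {X₁ : Type*} [TopologicalSpace X₁] [ChartedSpace H₁ X₁]
  {X₂ : Type*} [TopologicalSpace X₂] [ChartedSpace H₂ X₂]
  {X₃ : Type*} [TopologicalSpace X₃] [ChartedSpace H₃ X₃]
  {X₄ : Type*} [TopologicalSpace X₄] [ChartedSpace H₄ X₄]

/-- A map with a smooth local left inverse has injective differential. -/
theorem injective_mfderiv_of_leftInverse {f : X₁ → X₂} {g : X₂ → X₁} {x : X₁}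
    (hf : MDifferentiableAt I₁ I₂ f x) (hg : MDifferentiableAt I₂ I₁ g (f x))
    (h : ∀ᶠ y in 𝓝 x, g (f y) = y) : Function.Injective (mfderiv I₁ I₂ f x) := by
  have h1 : mfderiv I₁ I₁ (g ∘ f) x = mfderiv I₁ I₁ id x :=
    Filter.EventuallyEq.mfderiv_eq h
  intro v w hvw
  have h2 : ∀ v, mfderiv I₁ I₁ (g ∘ f) x v = mfderiv I₂ I₁ g (f x) (mfderiv I₁ I₂ f x v) :=
    mfderiv_comp_apply x hg hf
  have h3 : ∀ v, mfderiv I₁ I₁ (g ∘ f) x v = v := by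
    intro v; rw [h1, mfderiv_id]; rfl
  exact (h3 v).symm.trans ((h2 v).trans ((congrArg _ hvw).trans ((h2 w).symm.trans (h3 w))))

/-- A map with a smooth local right inverse through the point has surjective differential. -/
theorem surjective_mfderiv_of_rightInverse {f : X₁ → X₂} {g : X₂ → X₁} {x : X₁}
    (hf : MDifferentiableAt I₁ I₂ f x) (hg : MDifferentiableAt I₂ I₁ g (f x))
    (hx : g (f x) = x) (h : ∀ᶠ y in 𝓝 (f x), f (g y) = y) :
    Function.Surjective (mfderiv I₁ I₂ f x) := by
  have h1 : mfderiv I₂ I₂ (f ∘ g) (f x) = mfderiv I₂ I₂ id (f x) :=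
    Filter.EventuallyEq.mfderiv_eq h
  have h2 : ∀ v, mfderiv I₂ I₂ (f ∘ g) (f x) v =
      mfderiv I₁ I₂ f x (mfderiv I₂ I₁ g (f x) v) :=
    mfderiv_comp_apply_of_eq (f x) hf hg hx
  intro v
  refine ⟨mfderiv I₂ I₁ g (f x) v, (h2 v).symm.trans ?_⟩
  rw [h1, mfderiv_id]; rfl

/-- In a square `ψ ∘ f = f' ∘ φ` near `x` with `φ` and `f'` submersive and `ψ` immersive, `f` is
submersive. -/
theorem surjective_mfderiv_of_square {f : X₁ → X₂} {φ : X₁ → X₃} {ψ : X₂ → X₄} {f' : X₃ → X₄}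
    {x : X₁} (hf : MDifferentiableAt I₁ I₂ f x) (hφ : MDifferentiableAt I₁ I₃ φ x)
    (hψ : MDifferentiableAt I₂ I₄ ψ (f x)) (hf' : MDifferentiableAt I₃ I₄ f' (φ x))
    (h : ∀ᶠ y in 𝓝 x, ψ (f y) = f' (φ y)) (sφ : Function.Surjective (mfderiv I₁ I₃ φ x))
    (sf' : Function.Surjective (mfderiv I₃ I₄ f' (φ x)))
    (iψ : Function.Injective (mfderiv I₂ I₄ ψ (f x))) :
    Function.Surjective (mfderiv I₁ I₂ f x) := by
  have hx : ψ (f x) = f' (φ x) := h.self_of_nhds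
  -- The two sides live in tangent spaces at `ψ (f x)` and `f' (φ x)`, points that are equal but not
  -- definitionally so; the common model space `E₄` is where they can be compared.
  have h1 : ∀ v : TangentSpace I₁ x, (mfderiv I₂ I₄ ψ (f x) (mfderiv I₁ I₂ f x v) : E₄) =
      mfderiv I₃ I₄ f' (φ x) (mfderiv I₁ I₃ φ x v) := by
    intro v
    have e1 := mfderiv_comp_apply x hψ hf v
    have e2 := mfderiv_comp_apply x hf' hφ v
    have e3 : mfderiv I₁ I₄ (ψ ∘ f) x = mfderiv I₁ I₄ (f' ∘ φ) x :=
      Filter.EventuallyEq.mfderiv_eq h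
    exact e1.symm.trans ((DFunLike.congr_fun e3 v).trans e2)
  intro w
  obtain ⟨u, hu⟩ := sf' (mfderiv I₂ I₄ ψ (f x) w : E₄)
  obtain ⟨v, hv⟩ := sφ u
  exact ⟨v, iψ ((h1 v).trans ((congrArg (fun t => (mfderiv I₃ I₄ f' (φ x) t : E₄)) hv).trans hu))⟩

end Differential

/-! ### Points and fibre coordinates of a clutched bundle. -/

section ClutchedPoints

variable {B N ι : Type*} {O : ι → Set B} {c : ι → ι → B → N → N}

namespace Clutched

theorem mk_eq_mk_of_mem {i j : ι} {σ : B} (hi : σ ∈ O i) (hj : σ ∈ O j) (n : N) :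
    (mk j ⟨σ, hj⟩ n : Clutched O c) = mk i ⟨σ, hi⟩ (c i j σ n) :=
  Quot.sound ⟨rfl, rfl⟩

@[simp]
theorem proj_mk (i : ι) (σ : O i) (n : N) : proj (mk i σ n : Clutched O c) = σ := rfl

theorem exists_rep (z : Clutched O c) : ∃ i σ n, z = mk i σ n := by
  obtain ⟨⟨i, σ, n⟩, rfl⟩ := Quot.exists_rep z
  exact ⟨i, σ, n, rfl⟩

/-- The fibre coordinate in the `i`-th chart; meaningful over `O i`. -/
noncomputable def coord (i : ι) (z : Clutched O c) : N :=
  c i (Quot.out z).1 (Quot.out z).2.1 (Quot.out z).2.2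

/-- The inverse of the `i`-th chart; meaningful over `O i`. -/
noncomputable def ofCoord (hO : ∀ σ, ∃ i, σ ∈ O i) (i : ι) (x : B × N) : Clutched O c :=
  open Classical in
  if h : x.1 ∈ O i then mk i ⟨x.1, h⟩ x.2 else mk (hO x.1).choose ⟨x.1, (hO x.1).choose_spec⟩ x.2

theorem ofCoord_of_mem (hO : ∀ σ, ∃ i, σ ∈ O i) {i : ι} (σ : O i) (n : N) :
    (ofCoord hO i (σ, n) : Clutched O c) = mk i σ n := by
  simp [ofCoord]

end Clutched

end ClutchedPoints

/-! ### The smooth clutching construction. -/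

section ClutchingConstruction

variable {EB : Type*} [NormedAddCommGroup EB] [NormedSpace ℝ EB] {HB : Type*} [TopologicalSpace HB]
  {EN : Type*} [NormedAddCommGroup EN] [NormedSpace ℝ EN] {HN : Type*} [TopologicalSpace HN]
  {IB : ModelWithCorners ℝ EB HB} {IN : ModelWithCorners ℝ EN HN}
  {B : Type*} [TopologicalSpace B] [ChartedSpace HB B]
  {N : Type*} [TopologicalSpace N] [ChartedSpace HN N] {ι : Type*}
  {O : ι → Set B} {c : ι → ι → B → N → N}

/-- Smooth transition data over an open cover, satisfying the cocycle condition. -/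
structure SmoothClutching (IB : ModelWithCorners ℝ EB HB) (IN : ModelWithCorners ℝ EN HN)
    (O : ι → Set B) (c : ι → ι → B → N → N) : Prop where
  isOpen : ∀ i, IsOpen (O i)
  exists_mem : ∀ σ, ∃ i, σ ∈ O i
  refl : ∀ i σ n, σ ∈ O i → c i i σ n = n
  trans : ∀ i j k σ n, σ ∈ O i → σ ∈ O j → σ ∈ O k → c i j σ (c j k σ n) = c i k σ n
  contMDiffOn : ∀ i j, ContMDiffOn (IB.prod IN) IN ∞ (fun x : B × N => c i j x.1 x.2)
    ((O i ∩ O j) ×ˢ Set.univ)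

namespace Clutched

theorem continuous_mk (i : ι) :
    Continuous fun x : O i × N => (mk i x.1 x.2 : Clutched O c) :=
  continuous_quot_mk.comp (continuous_sigmaMk (σ := fun i => O i × N))

theorem continuous_proj : Continuous (proj : Clutched O c → B) :=
  continuous_quot_lift _ (continuous_sigma fun _ => continuous_subtype_val.comp continuous_fst)

end Clutched

namespace SmoothClutching

variable (h : SmoothClutching IB IN O c)

include h in
-- By the cocycle condition the gluing relation is already an equivalence, so equality in the
-- quotient is the relation itself and no generated closure intervenes.
theorem equivalence : Equivalence (ClutchRel O c) where
  refl x := ⟨rfl, (h.refl _ _ _ x.2.1.2).symm⟩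
  symm := by
    rintro ⟨i, ⟨σ, hi⟩, n⟩ ⟨j, ⟨τ, hj⟩, m⟩ ⟨h1, h2⟩
    dsimp only at h1 h2
    subst h1 h2
    exact ⟨rfl, by dsimp only; rw [h.trans _ _ _ _ _ hi hj hi, h.refl _ _ _ hi]⟩
  trans := by
    rintro ⟨i, ⟨σ, hi⟩, n⟩ ⟨j, ⟨τ, hj⟩, m⟩ ⟨k, ⟨υ, hk⟩, l⟩ ⟨h1, h2⟩ ⟨h3, h4⟩
    dsimp only at h1 h2 h3 h4
    subst h1 h2 h3 h4
    exact ⟨rfl, h.trans _ _ _ _ _ hk hj hi⟩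

include h in
-- The representative chosen by `Quot.out` may have a third index; the cocycle condition removes it.
theorem coord_mk {i j : ι} {σ : B} (hi : σ ∈ O i) (hj : σ ∈ O j) (n : N) :
    (Clutched.mk j ⟨σ, hj⟩ n : Clutched O c).coord i = c i j σ n := by
  set z : Clutched O c := Clutched.mk j ⟨σ, hj⟩ n with hz
  have h1 : ClutchRel O c ⟨j, ⟨σ, hj⟩, n⟩ (Quot.out z) :=
    h.equivalence.quot_mk_eq_iff _ _ |>.1 (hz.symm.trans (Quot.out_eq z).symm)
  unfold Clutched.coord
  have h3 := (Quot.out z).2.1.2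
  rw [h1.2, ← h1.1] at *
  exact h.trans _ _ _ _ _ hi (h1.1 ▸ h3) hj

include h in
theorem exists_eq_mk {i : ι} {z : Clutched O c} (hz : z.proj ∈ O i) :
    z = Clutched.mk i ⟨z.proj, hz⟩ (z.coord i) := by
  obtain ⟨j, ⟨σ, hj⟩, n, rfl⟩ := z.exists_rep
  rw [h.coord_mk (σ := σ) hz hj]
  exact Clutched.mk_eq_mk_of_mem hz hj n

include h in
-- On the preimage of an open set, continuity can be tested before passing to the quotient. There,
-- on the `j`-th summand, the map is `(σ, n) ↦ (σ, c i j σ n)`.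
theorem continuousOn_coord (i : ι) :
    ContinuousOn (fun z : Clutched O c => (z.proj, z.coord i)) (Clutched.proj ⁻¹' O i) := by
  have ho : IsOpen ((Clutched.proj : Clutched O c → B) ⁻¹' O i) :=
    (h.isOpen i).preimage Clutched.continuous_proj
  have hq : Topology.IsQuotientMap (Quot.mk (ClutchRel O c)) := isQuotientMap_quot_mk
  refine (hq.continuousOn_isOpen_iff ho).2 ?_
  refine continuousOn_of_forall_continuousAt ?_
  rintro ⟨j, ⟨σ, hj⟩, n⟩ hi
  change σ ∈ O i at hi
  refine (Topology.IsOpenEmbedding.sigmaMk (σ := fun i => O i × N) (i := j)).continuousAt_iff.1 ?_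
  have h1 : ContinuousAt (fun x : B × N => (x.1, c i j x.1 x.2)) (σ, n) := by
    refine continuousAt_fst.prodMk ((h.contMDiffOn i j).continuousOn.continuousAt ?_)
    exact prod_mem_nhds (((h.isOpen i).inter (h.isOpen j)).mem_nhds ⟨hi, hj⟩) Filter.univ_mem
  have h2 : ContinuousAt (fun x : O j × N => ((x.1 : B), x.2)) (⟨σ, hj⟩, n) := by fun_prop
  refine (h1.comp_of_eq h2 rfl).congr ?_
  have h3 : ∀ᶠ x : O j × N in 𝓝 (⟨σ, hj⟩, n), (x.1 : B) ∈ O i :=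
    (show ContinuousAt (fun x : O j × N => (x.1 : B)) (⟨σ, hj⟩, n) by fun_prop).eventually_mem
      ((h.isOpen i).mem_nhds hi)
  filter_upwards [h3] with x hx
  exact Prod.ext rfl (h.coord_mk hx x.1.2 x.2).symm

/-- The trivialisation of a clutched bundle over `O i`. -/
noncomputable def trivialization (i : ι) :
    Bundle.Trivialization N (Clutched.proj : Clutched O c → B) where
  toFun z := (z.proj, z.coord i)
  invFun := Clutched.ofCoord h.exists_mem i
  source := Clutched.proj ⁻¹' O i
  target := O i ×ˢ Set.univ
  map_source' z hz := ⟨hz, trivial⟩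
  map_target' x hx := by
    rw [show x = ((⟨x.1, hx.1⟩ : O i).1, x.2) from rfl, Clutched.ofCoord_of_mem]
    exact hx.1
  left_inv' z hz := by
    conv_rhs => rw [h.exists_eq_mk hz]
    exact Clutched.ofCoord_of_mem h.exists_mem ⟨z.proj, hz⟩ _
  right_inv' x hx := by
    rw [show x = ((⟨x.1, hx.1⟩ : O i).1, x.2) from rfl, Clutched.ofCoord_of_mem]
    exact Prod.ext rfl ((h.coord_mk hx.1 hx.1 _).trans (h.refl _ _ _ hx.1))
  open_source := (h.isOpen i).preimage Clutched.continuous_proj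
  open_target := (h.isOpen i).prod isOpen_univ
  continuousOn_toFun := h.continuousOn_coord i
  continuousOn_invFun := by
    rw [continuousOn_iff_continuous_domRestrict]
    have h2 : Continuous fun x : (O i ×ˢ Set.univ : Set (B × N)) => ((⟨x.1.1, x.2.1⟩ : O i), x.1.2) :=
      by fun_prop
    refine ((Clutched.continuous_mk i).comp h2).congr fun x => ?_
    exact (Clutched.ofCoord_of_mem h.exists_mem ⟨x.1.1, x.2.1⟩ x.1.2).symm
  baseSet := O i
  open_baseSet := h.isOpen i
  source_eq := rfl
  target_eq := rfl
  proj_toFun _ _ := rfl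

theorem trivialization_mk (i : ι) (σ : O i) (n : N) :
    h.trivialization i (Clutched.mk i σ n) = ((σ : B), n) :=
  Prod.ext rfl ((h.coord_mk σ.2 σ.2 n).trans (h.refl _ _ _ σ.2))

theorem trivialization_symm {i : ι} {σ : B} (hσ : σ ∈ O i) (n : N) :
    (h.trivialization i).toOpenPartialHomeomorph.symm (σ, n) = Clutched.mk i ⟨σ, hσ⟩ n :=
  Clutched.ofCoord_of_mem h.exists_mem ⟨σ, hσ⟩ n

theorem smoothGluing : SmoothGluing (IB.prod IN)
    fun i => (h.trivialization i).toOpenPartialHomeomorph where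
  exists_mem z := h.exists_mem z.proj
  contMDiffOn i j := by
    have h1 : ContMDiffOn (IB.prod IN) (IB.prod IN) ∞ (fun x : B × N => (x.1, c j i x.1 x.2))
        ((O j ∩ O i) ×ˢ Set.univ) := contMDiff_fst.contMDiffOn.prodMk (h.contMDiffOn j i)
    have key : ∀ x : B × N, x ∈ (h.trivialization i).target ∩
        (h.trivialization i).toOpenPartialHomeomorph.symm ⁻¹' (h.trivialization j).source →
        x.1 ∈ O i ∧ x.1 ∈ O j := by
      rintro ⟨σ, n⟩ ⟨⟨hi, -⟩, hj⟩
      refine ⟨hi, ?_⟩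
      rw [Set.mem_preimage, h.trivialization_symm hi] at hj
      exact hj
    refine (h1.mono ?_).congr ?_
    · exact fun x hx => ⟨⟨(key x hx).2, (key x hx).1⟩, trivial⟩
    · rintro ⟨σ, n⟩ hx
      obtain ⟨hi, hj⟩ := key _ hx
      rw [h.trivialization_symm hi]
      exact Prod.ext rfl (h.coord_mk hj hi n)

/-- The trivialisation supplied by `IsModelled` and the explicit one agree on all classes `[(σ, n,
i)]`, hence on source and target. Later arguments can therefore use the explicit one for any
modelled smooth structure. -/
theorem isSmoothTriv {EZ : Type*} [NormedAddCommGroup EZ] [NormedSpace ℝ EZ] {HZ : Type*}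
    [TopologicalSpace HZ] {IZ : ModelWithCorners ℝ EZ HZ} [ChartedSpace HZ (Clutched O c)]
    (hm : Clutched.IsModelled IB IN IZ O c) (i : ι) : IsSmoothTriv IB IN IZ (h.trivialization i) := by
  obtain ⟨e, he, hs, hmk⟩ := hm i
  have hsrc : e.source = (h.trivialization i).source := by rw [e.source_eq, he]; rfl
  have htgt : e.target = (h.trivialization i).target := by rw [e.target_eq, he]; rfl
  refine ⟨hsrc ▸ hs.contMDiffOn_toFun.congr fun z hz => ?_,
    htgt ▸ hs.contMDiffOn_symm.congr fun x hx => ?_⟩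
  · have hz' : z.proj ∈ O i := he ▸ e.mem_source.1 hz
    rw [h.exists_eq_mk hz', hmk, h.trivialization_mk]
  · have hx' : x.1 ∈ O i := he ▸ e.mem_target.1 hx
    have h1 : (Clutched.mk i ⟨x.1, hx'⟩ x.2 : Clutched O c) ∈ e.source := by
      rw [e.mem_source, he]; exact hx'
    have h2 := e.toOpenPartialHomeomorph.left_inv h1
    have h3 : (e.toOpenPartialHomeomorph (Clutched.mk i ⟨x.1, hx'⟩ x.2)) = x := hmk _ _
    rw [h3] at h2
    exact (h.trivialization_symm hx' x.2).trans h2.symm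

include h in
-- Points over the same base point lie in one chart and are separated there; the others are
-- separated in the base.
theorem t2Space [T2Space B] [T2Space N] : T2Space (Clutched O c) where
  t2 z w hzw := by
    by_cases hp : z.proj = w.proj
    · obtain ⟨i, hi⟩ := h.exists_mem z.proj
      let e := (h.trivialization i).toOpenPartialHomeomorph
      have hz : z ∈ e.source := hi
      have hw : w ∈ e.source := show w.proj ∈ O i from hp ▸ hi
      obtain ⟨u, v, hu, hv, hzu, hwv, huv⟩ := t2_separation (fun hh => hzw (e.injOn hz hw hh))
      refine ⟨_, _, e.isOpen_inter_preimage hu, e.isOpen_inter_preimage hv, ⟨hz, hzu⟩, ⟨hw, hwv⟩, ?_⟩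
      exact ((huv.preimage e).mono Set.inter_subset_right Set.inter_subset_right)
    · obtain ⟨u, v, hu, hv, hzu, hwv, huv⟩ := t2_separation hp
      exact ⟨_, _, hu.preimage Clutched.continuous_proj, hv.preimage Clutched.continuous_proj,
        hzu, hwv, huv.preimage _⟩

include h in
-- The index set is arbitrary, but by the Lindelöf property of `B` countably many of the `O i`
-- already cover.
theorem secondCountableTopology [SecondCountableTopology B] [SecondCountableTopology N] :
    SecondCountableTopology (Clutched O c) := by
  obtain ⟨T, hT, hc⟩ := TopologicalSpace.isOpen_iUnion_countable O h.isOpen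
  have := hT.to_subtype
  have hs : ∀ i : T, SecondCountableTopology (h.trivialization i).source := fun i =>
    (h.trivialization i).toOpenPartialHomeomorph.toHomeomorphSourceTarget.secondCountableTopology
  refine TopologicalSpace.secondCountableTopology_of_countable_cover (ι := T)
    (U := fun i => (h.trivialization i).source)
    (fun i => (h.trivialization i).open_source) ?_
  refine Set.eq_univ_of_forall fun z => ?_
  have hz : z.proj ∈ ⋃ i ∈ T, O i := hc ▸ Set.mem_iUnion.2 (h.exists_mem z.proj)
  simp only [Set.mem_iUnion] at hz ⊢
  obtain ⟨i, hi, hz⟩ := hz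
  exact ⟨⟨i, hi⟩, hz⟩

include h in
/-- A bundle glued along smooth transition data has a smooth structure in which the gluing charts
are diffeomorphisms. -/
theorem exists_isModelled [hB : SmoothMfd IB B] [hN : SmoothMfd IN N] :
    ∃ (_ : ChartedSpace (ModelProd HB HN) (Clutched O c))
      (_ : SmoothMfd (IB.prod IN) (Clutched O c)),
      Clutched.IsModelled IB IN (IB.prod IN) O c := by
  have hg := h.smoothGluing
  let _ := gluedChartedSpace (ModelProd HB HN) _ hg.exists_mem
  have hBN := SmoothMfd.prod (M := B) (N := N) IB IN
  refine ⟨inferInstance, ?_, fun i => ⟨h.trivialization i, rfl, ⟨?_, ?_⟩, h.trivialization_mk i⟩⟩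
  · exact
      { toIsManifold := hg.isManifold
        toT2Space := h.t2Space
        toSecondCountableTopology := h.secondCountableTopology
        finiteDimensional := hBN.finiteDimensional
        boundaryless := hBN.boundaryless }
  · exact hg.contMDiffOn_chart i
  · exact hg.contMDiffOn_chart_symm i

end SmoothClutching

end ClutchingConstruction

/-! ### Patching trivialisations along a locally constant index. -/

section LocallyConstantIndex

variable {X N Z ι : Type*} [TopologicalSpace X] [TopologicalSpace N] [TopologicalSpace Z]
  {π : Z → X} (e : ι → Bundle.Trivialization N π) (u : X → ι) (V : Set X)

/-- The trivialisation over an open set `V` given near each `x ∈ V` by the member `u x` of a family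
of trivialisations, for a locally constant index function `u`. -/
def trivializationOfIndex (hπ : Continuous π) (hVo : IsOpen V)
    (hV : ∀ x ∈ V, x ∈ (e (u x)).baseSet) (hu : ∀ x ∈ V, ∀ᶠ y in 𝓝 x, u y = u x) :
    Bundle.Trivialization N π where
  toFun z := e (u (π z)) z
  invFun x := (e (u x.1)).toOpenPartialHomeomorph.symm x
  source := π ⁻¹' V
  target := V ×ˢ Set.univ
  map_source' z hz := ⟨by
    rw [(e (u (π z))).coe_fst ((e (u (π z))).mem_source.2 (hV _ hz))]; exact hz, trivial⟩
  map_target' x hx := by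
    rw [Set.mem_preimage, (e (u x.1)).proj_symm_apply' (hV _ hx.1)]; exact hx.1
  left_inv' z hz := by
    have h := (e (u (π z))).mem_source.2 (hV _ hz)
    rw [(e (u (π z))).coe_fst h]
    exact (e (u (π z))).toOpenPartialHomeomorph.left_inv h
  right_inv' x hx := by
    rw [(e (u x.1)).proj_symm_apply' (hV _ hx.1)]
    exact (e (u x.1)).apply_symm_apply' (hV _ hx.1)
  open_source := hVo.preimage hπ
  open_target := hVo.prod isOpen_univ
  continuousOn_toFun z hz := by
    refine ContinuousAt.continuousWithinAt ?_
    have h := (e (u (π z))).mem_source.2 (hV _ hz)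
    refine ((e (u (π z))).toOpenPartialHomeomorph.continuousAt h).congr ?_
    filter_upwards [hπ.continuousAt.eventually (hu _ hz)] with w hw
    rw [hw]; rfl
  continuousOn_invFun x hx := by
    refine ContinuousAt.continuousWithinAt ?_
    have h := (e (u x.1)).mem_target.2 (hV _ hx.1)
    refine ((e (u x.1)).toOpenPartialHomeomorph.symm.continuousAt h).congr ?_
    filter_upwards [continuousAt_fst.eventually (hu _ hx.1)] with w hw
    rw [hw]
  baseSet := V
  open_baseSet := hVo
  source_eq := rfl
  target_eq := rfl
  proj_toFun z hz := (e (u (π z))).coe_fst ((e (u (π z))).mem_source.2 (hV _ hz))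

variable {e u V}

/-- Smoothness is local, and near each point the patched map coincides with one member of the
family. -/
theorem isSmoothTriv_trivializationOfIndex
    {E : Type*} [NormedAddCommGroup E] [NormedSpace ℝ E] {H : Type*} [TopologicalSpace H]
    {E' : Type*} [NormedAddCommGroup E'] [NormedSpace ℝ E'] {H' : Type*} [TopologicalSpace H']
    {E'' : Type*} [NormedAddCommGroup E''] [NormedSpace ℝ E''] {H'' : Type*} [TopologicalSpace H'']
    [ChartedSpace H X] [ChartedSpace H' N] [ChartedSpace H'' Z]
    {I : ModelWithCorners ℝ E H} {I' : ModelWithCorners ℝ E' H'} {I'' : ModelWithCorners ℝ E'' H''}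
    (he : ∀ i, IsSmoothTriv I I' I'' (e i)) (hπ : Continuous π) (hVo : IsOpen V)
    (hV : ∀ x ∈ V, x ∈ (e (u x)).baseSet) (hu : ∀ x ∈ V, ∀ᶠ y in 𝓝 x, u y = u x) :
    IsSmoothTriv I I' I'' (trivializationOfIndex e u V hπ hVo hV hu) where
  contMDiffOn_toFun z hz := by
    refine ContMDiffAt.contMDiffWithinAt ?_
    have h := (e (u (π z))).mem_source.2 (hV _ hz)
    refine ((he (u (π z))).contMDiffOn_toFun.contMDiffAt
      ((e (u (π z))).open_source.mem_nhds h)).congr_of_eventuallyEq ?_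
    filter_upwards [hπ.continuousAt.eventually (hu _ hz)] with w hw
    change e (u (π w)) w = _
    rw [hw]
  contMDiffOn_symm x hx := by
    refine ContMDiffAt.contMDiffWithinAt ?_
    have h := (e (u x.1)).mem_target.2 (hV _ hx.1)
    refine ((he (u x.1)).contMDiffOn_symm.contMDiffAt
      ((e (u x.1)).open_target.mem_nhds h)).congr_of_eventuallyEq ?_
    filter_upwards [continuousAt_fst.eventually (hu _ hx.1)] with w hw
    change (e (u w.1)).toOpenPartialHomeomorph.symm w = _
    rw [hw]

end LocallyConstantIndex

/-! ### Algebra of groupoids and of the actions of bisections. -/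

section GroupoidAlgebra

variable {E : Type*} [NormedAddCommGroup E] [NormedSpace ℝ E] {H : Type*} [TopologicalSpace H]
  {E' : Type*} [NormedAddCommGroup E'] [NormedSpace ℝ E'] {H' : Type*} [TopologicalSpace H']
  {I : ModelWithCorners ℝ E H} {J : ModelWithCorners ℝ E' H'}
  {M : Type*} [TopologicalSpace M] [ChartedSpace H M] [SmoothMfd I M]
  {G : Type*} [TopologicalSpace G] [ChartedSpace H' G] [SmoothMfd J G]

namespace LieGroupoid

variable (𝒢 : LieGroupoid I M J G)

theorem inv_mul_cancel_left {g h : G} (hgh : 𝒢.src g = 𝒢.tgt h) :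
    𝒢.mul (𝒢.inv g) (𝒢.mul g h) = h := by
  rw [← 𝒢.mul_assoc _ _ _ (𝒢.src_inv g) hgh, 𝒢.inv_mul, hgh, 𝒢.one_mul]

theorem mul_inv_cancel_right {g h : G} (hgh : 𝒢.src g = 𝒢.tgt h) :
    𝒢.mul (𝒢.mul g h) (𝒢.inv h) = g := by
  rw [𝒢.mul_assoc _ _ _ hgh (𝒢.tgt_inv h).symm, 𝒢.mul_inv, ← hgh, 𝒢.mul_one]

theorem eq_inv_of_mul_eq_one {g h : G} (hgh : 𝒢.src g = 𝒢.tgt h)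
    (h1 : 𝒢.mul g h = 𝒢.one (𝒢.tgt g)) : h = 𝒢.inv g := by
  rw [← 𝒢.inv_mul_cancel_left hgh, h1, ← 𝒢.src_inv, 𝒢.mul_one]

theorem inv_inv (g : G) : 𝒢.inv (𝒢.inv g) = g :=
  (𝒢.eq_inv_of_mul_eq_one (𝒢.src_inv g) (by rw [𝒢.inv_mul, 𝒢.tgt_inv])).symm

theorem inv_mul_rev {g h : G} (hgh : 𝒢.src g = 𝒢.tgt h) :
    𝒢.inv (𝒢.mul g h) = 𝒢.mul (𝒢.inv h) (𝒢.inv g) := by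
  have h1 : 𝒢.src (𝒢.inv h) = 𝒢.tgt (𝒢.inv g) := by rw [𝒢.src_inv, 𝒢.tgt_inv, hgh]
  have h2 : 𝒢.src (𝒢.mul g h) = 𝒢.tgt (𝒢.inv h) := by rw [𝒢.src_mul _ _ hgh, 𝒢.tgt_inv]
  refine (𝒢.eq_inv_of_mul_eq_one ?_ ?_).symm
  · rw [𝒢.tgt_mul _ _ h1, h2]
  · rw [← 𝒢.mul_assoc _ _ _ h2 h1, 𝒢.mul_inv_cancel_right hgh, 𝒢.mul_inv, 𝒢.tgt_mul _ _ hgh]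

namespace Bisection

variable {𝒢} (β γ : 𝒢.Bisection) (g h : G)

theorem symm_symm_toFun (m : M) : β.symm.symm.toFun m = β.toFun m := by
  change 𝒢.inv (𝒢.inv (β.toFun (β.shadow.symm (β.shadow m)))) = _
  rw [𝒢.inv_inv, Diffeomorph.symm_apply_apply]

/-- The transition maps use the right action only through inverse bisections; for these the double
inversion in the definition disappears. -/
theorem right_symm : right g β.symm = 𝒢.mul g (𝒢.inv (β.toFun (𝒢.src g))) := by
  rw [right, symm_symm_toFun]

theorem src_left : 𝒢.src (β.left g) = 𝒢.src g := 𝒢.src_mul _ _ (β.src_toFun _)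

theorem tgt_left : 𝒢.tgt (β.left g) = β.shadow (𝒢.tgt g) := by
  rw [left, 𝒢.tgt_mul _ _ (β.src_toFun _), β.tgt_toFun]

theorem tgt_right : 𝒢.tgt (right g β) = 𝒢.tgt g :=
  𝒢.tgt_mul _ _ (by rw [𝒢.tgt_inv, β.symm.src_toFun])

theorem src_right_symm : 𝒢.src (right g β.symm) = β.shadow (𝒢.src g) := by
  rw [right_symm, 𝒢.src_mul _ _ (by rw [𝒢.tgt_inv, β.src_toFun]), 𝒢.src_inv, β.tgt_toFun]

theorem left_one (m : M) : β.left (𝒢.one m) = β.toFun m := by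
  have h := 𝒢.mul_one (β.toFun m)
  rw [β.src_toFun] at h
  rw [left, 𝒢.tgt_one, h]

theorem left_mul {g h : G} (hgh : 𝒢.src g = 𝒢.tgt h) :
    β.left (𝒢.mul g h) = 𝒢.mul (β.left g) h := by
  rw [left, left, 𝒢.tgt_mul _ _ hgh, 𝒢.mul_assoc _ _ _ (β.src_toFun _) hgh]

theorem right_mul {g h : G} (hgh : 𝒢.src g = 𝒢.tgt h) :
    right (𝒢.mul g h) β = 𝒢.mul g (right h β) := by
  rw [right, right, 𝒢.src_mul _ _ hgh, 𝒢.mul_assoc _ _ _ hgh (by rw [𝒢.tgt_inv, β.symm.src_toFun])]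

/-- The left and right actions of a bisection cancel across a product. -/
theorem right_symm_mul_left {g h : G} (hgh : 𝒢.src g = 𝒢.tgt h) :
    𝒢.mul (right g β.symm) (β.left h) = 𝒢.mul g h := by
  have hg : 𝒢.src g = 𝒢.tgt (𝒢.inv (β.toFun (𝒢.src g))) := by rw [𝒢.tgt_inv, β.src_toFun]
  rw [right_symm, 𝒢.mul_assoc _ _ _ hg (by rw [𝒢.src_inv, tgt_left, β.tgt_toFun, hgh]), left, hgh,
    𝒢.inv_mul_cancel_left (β.src_toFun _)]

/-- Inversion turns left translations into right translations; this is what makes the inversion of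
the Atiyah groupoid well defined. -/
theorem inv_left : 𝒢.inv (β.left g) = right (𝒢.inv g) β.symm := by
  rw [left, 𝒢.inv_mul_rev (β.src_toFun _), right_symm, 𝒢.src_inv]

theorem inv_right_symm : 𝒢.inv (right g β.symm) = β.left (𝒢.inv g) := by
  rw [← 𝒢.inv_inv (β.left _), inv_left, 𝒢.inv_inv]

/-- This ties the conjugation gluing to the Atiyah gluing: on the diagonal the two-sided change of
coordinates uses a single bisection. -/
theorem conj_eq : β.conj g = right (β.left g) β.symm := by
  rw [right_symm, src_left]; rfl

theorem conj_one (m : M) : β.conj (𝒢.one m) = 𝒢.one (β.shadow m) := by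
  rw [conj_eq, left_one, right_symm, β.src_toFun, 𝒢.mul_inv, β.tgt_toFun]

variable {β γ}

/-- The hypothesis says that `δ` is the product of `β` and `γ`. Acting on the right by inverses
preserves the order of such products, so the cocycle condition passes from the bisections to the
right action. -/
theorem right_symm_right_symm {δ : 𝒢.Bisection}
    (h : ∀ m, β.left (γ.toFun m) = δ.toFun m) :
    right (right g γ.symm) β.symm = right g δ.symm := by
  have hg : 𝒢.src g = 𝒢.tgt (𝒢.inv (γ.toFun (𝒢.src g))) := by rw [𝒢.tgt_inv, γ.src_toFun]
  rw [right_symm γ, right_mul _ hg, ← inv_left, h, ← right_symm]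

end Bisection

end LieGroupoid

end GroupoidAlgebra

/-! ### Cocycle identities and smooth transition data of a principaloid bundle. -/

section Bundle

variable {EM : Type*} [NormedAddCommGroup EM] [NormedSpace ℝ EM] {HM : Type*} [TopologicalSpace HM]
  {EG : Type*} [NormedAddCommGroup EG] [NormedSpace ℝ EG] {HG : Type*} [TopologicalSpace HG]
  {EB : Type*} [NormedAddCommGroup EB] [NormedSpace ℝ EB] {HB : Type*} [TopologicalSpace HB]
  {EP : Type*} [NormedAddCommGroup EP] [NormedSpace ℝ EP] {HP : Type*} [TopologicalSpace HP]
  {EX : Type*} [NormedAddCommGroup EX] [NormedSpace ℝ EX] {HX : Type*} [TopologicalSpace HX]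
  {IM : ModelWithCorners ℝ EM HM} {IG : ModelWithCorners ℝ EG HG} {IX : ModelWithCorners ℝ EX HX}
  {M : Type*} [TopologicalSpace M] [ChartedSpace HM M] [SmoothMfd IM M]
  {G : Type*} [TopologicalSpace G] [ChartedSpace HG G] [SmoothMfd IG G]
  {X : Type*} [TopologicalSpace X] [ChartedSpace HX X]

/-- Multiplication is smooth only along composable pairs, so composability must hold on all of `s`,
not only at `x`. -/
theorem LieGroupoid.contMDiffWithinAt_mul_comp (𝒢 : LieGroupoid IM M IG G) {f g : X → G} {s : Set X}
    {x : X} (hx : x ∈ s)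
    (hf : ContMDiffWithinAt IX IG ∞ f s x) (hg : ContMDiffWithinAt IX IG ∞ g s x)
    (h : ∀ x ∈ s, 𝒢.src (f x) = 𝒢.tgt (g x)) :
    ContMDiffWithinAt IX IG ∞ (fun x => 𝒢.mul (f x) (g x)) s x :=
  (𝒢.contMDiffOn_mul (f x, g x) (h x hx)).comp (f := fun x => (f x, g x)) x (hf.prodMk hg) h

theorem LieGroupoid.contMDiffOn_mul_comp (𝒢 : LieGroupoid IM M IG G) {f g : X → G} {s : Set X}
    (hf : ContMDiffOn IX IG ∞ f s) (hg : ContMDiffOn IX IG ∞ g s)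
    (h : ∀ x ∈ s, 𝒢.src (f x) = 𝒢.tgt (g x)) :
    ContMDiffOn IX IG ∞ (fun x => 𝒢.mul (f x) (g x)) s :=
  fun x hx => 𝒢.contMDiffWithinAt_mul_comp hx (hf x hx) (hg x hx) h

namespace PrincipaloidBundle

open LieGroupoid LieGroupoid.Bisection

variable {𝒢 : LieGroupoid IM M IG G}
  {IB : ModelWithCorners ℝ EB HB} {B : Type*} [TopologicalSpace B] [ChartedSpace HB B]
  [SmoothMfd IB B] {IP : ModelWithCorners ℝ EP HP} {P : Type*} [TopologicalSpace P]
  [ChartedSpace HP P] [SmoothMfd IP P] {ι : Type*}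
  (𝒬 : PrincipaloidBundle 𝒢 IB B IP P ι)

theorem isOpen_cover (i : ι) : IsOpen (𝒬.cover i) := (𝒬.triv i).open_baseSet

theorem index_mem (σ : B) : σ ∈ 𝒬.cover (𝒬.index σ) := (𝒬.exists_mem σ).choose_spec

theorem triv_pt (i : ι) (σ : 𝒬.cover i) (g : G) : 𝒬.triv i (𝒬.pt i σ g) = ((σ : B), g) :=
  (𝒬.triv i).apply_symm_apply' σ.2

theorem eq_pt {i : ι} {p : P} (hp : 𝒬.proj p ∈ 𝒬.cover i) :
    p = 𝒬.pt i ⟨𝒬.proj p, hp⟩ (𝒬.triv i p).2 :=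
  ((𝒬.triv i).symm_apply_mk_proj ((𝒬.triv i).mem_source.2 hp)).symm

theorem pt_injective {i : ι} {σ : 𝒬.cover i} {g h : G} (hgh : 𝒬.pt i σ g = 𝒬.pt i σ h) : g = h := by
  have := congrArg (fun p => (𝒬.triv i p).2) hgh
  simpa [triv_pt] using this

theorem pt_eq_pt {i j : ι} {σ : B} (hi : σ ∈ 𝒬.cover i) (hj : σ ∈ 𝒬.cover j) (g : G) :
    𝒬.pt j ⟨σ, hj⟩ g = 𝒬.pt i ⟨σ, hi⟩ ((𝒬.trans i j σ).left g) := by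
  have h1 : 𝒬.triv i (𝒬.pt j ⟨σ, hj⟩ g) = (σ, (𝒬.trans i j σ).left g) :=
    𝒬.triv_triv_symm i j σ g hi hj
  have h2 := 𝒬.eq_pt (i := i) (p := 𝒬.pt j ⟨σ, hj⟩ g) (by rw [proj_pt]; exact hi)
  rw [h1] at h2
  simp only [proj_pt] at h2
  exact h2

/-- Both sides are the `i`-th coordinate of the point whose `k`-th coordinate is `g`. This is the
source of all cocycle identities. -/
theorem trans_left_left {i j k : ι} {σ : B} (hi : σ ∈ 𝒬.cover i) (hj : σ ∈ 𝒬.cover j)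
    (hk : σ ∈ 𝒬.cover k) (g : G) :
    (𝒬.trans i j σ).left ((𝒬.trans j k σ).left g) = (𝒬.trans i k σ).left g :=
  𝒬.pt_injective (i := i) (σ := ⟨σ, hi⟩) <| by
    rw [← 𝒬.pt_eq_pt hi hj, ← 𝒬.pt_eq_pt hj hk, ← 𝒬.pt_eq_pt hi hk]

theorem trans_left_self {i : ι} {σ : B} (hi : σ ∈ 𝒬.cover i) (g : G) :
    (𝒬.trans i i σ).left g = g :=
  𝒬.pt_injective (i := i) (σ := ⟨σ, hi⟩) (𝒬.pt_eq_pt hi hi g).symm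

/-- A bisection is recovered from its left action by evaluation on units. -/
theorem trans_left_toFun {i j k : ι} {σ : B} (hi : σ ∈ 𝒬.cover i) (hj : σ ∈ 𝒬.cover j)
    (hk : σ ∈ 𝒬.cover k) (m : M) :
    (𝒬.trans i j σ).left ((𝒬.trans j k σ).toFun m) = (𝒬.trans i k σ).toFun m := by
  rw [← left_one, 𝒬.trans_left_left hi hj hk, left_one]

theorem trans_self_toFun {i : ι} {σ : B} (hi : σ ∈ 𝒬.cover i) (m : M) :
    (𝒬.trans i i σ).toFun m = 𝒢.one m := by
  rw [← left_one, 𝒬.trans_left_self hi]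

theorem trans_right_right {i j k : ι} {σ : B} (hi : σ ∈ 𝒬.cover i) (hj : σ ∈ 𝒬.cover j)
    (hk : σ ∈ 𝒬.cover k) (g : G) :
    right (right g (𝒬.trans j k σ).symm) (𝒬.trans i j σ).symm = right g (𝒬.trans i k σ).symm :=
  right_symm_right_symm g (𝒬.trans_left_toFun hi hj hk)

theorem trans_right_self {i : ι} {σ : B} (hi : σ ∈ 𝒬.cover i) (g : G) :
    right g (𝒬.trans i i σ).symm = g := by
  -- The factor on the right is the inverse of a unit, and a unit is its own inverse; the remaining
  -- goals check the latter.
  rw [right_symm, 𝒬.trans_self_toFun hi, ← 𝒢.eq_inv_of_mul_eq_one (h := 𝒢.one (𝒢.src g)),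
    𝒢.mul_one]
  · rw [𝒢.src_one, 𝒢.tgt_one]
  · rw [𝒢.tgt_one]
    conv_lhs => arg 3; rw [← 𝒢.src_one (𝒢.src g)]
    rw [𝒢.mul_one]

theorem trans_shadow_shadow {i j k : ι} {σ : B} (hi : σ ∈ 𝒬.cover i) (hj : σ ∈ 𝒬.cover j)
    (hk : σ ∈ 𝒬.cover k) (m : M) :
    (𝒬.trans i j σ).shadow ((𝒬.trans j k σ).shadow m) = (𝒬.trans i k σ).shadow m := by
  rw [← (𝒬.trans j k σ).tgt_toFun, ← tgt_left, 𝒬.trans_left_toFun hi hj hk, tgt_toFun]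

theorem trans_shadow_self {i : ι} {σ : B} (hi : σ ∈ 𝒬.cover i) (m : M) :
    (𝒬.trans i i σ).shadow m = m := by
  rw [← tgt_toFun, 𝒬.trans_self_toFun hi, 𝒢.tgt_one]

theorem smoothClutching_shadow : SmoothClutching IB IM 𝒬.cover
    fun i j σ (m : M) => (𝒬.trans i j σ).shadow m where
  isOpen := 𝒬.isOpen_cover
  exists_mem := 𝒬.exists_mem
  refl _ _ m hi := 𝒬.trans_shadow_self hi m
  trans _ _ _ _ m hi hj hk := 𝒬.trans_shadow_shadow hi hj hk m
  contMDiffOn i j := (𝒢.submersion_tgt.contMDiff.comp_contMDiffOn (𝒬.smooth_trans i j)).congr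
    fun x _ => ((𝒬.trans i j x.1).tgt_toFun x.2).symm

theorem contMDiffOn_trans_comp (i j : ι) {f : X → B} {g : X → M} {s : Set X}
    (hf : ContMDiffOn IX IB ∞ f s) (hg : ContMDiffOn IX IM ∞ g s)
    (hs : ∀ x ∈ s, f x ∈ 𝒬.cover i ∩ 𝒬.cover j) :
    ContMDiffOn IX IG ∞ (fun x => (𝒬.trans i j (f x)).toFun (g x)) s :=
  (𝒬.smooth_trans i j).comp (hf.prodMk hg) fun x hx => ⟨hs x hx, trivial⟩

theorem contMDiffOn_trans_right_comp (i j : ι) {f : X → B} {g : X → G} {s : Set X}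
    (hf : ContMDiffOn IX IB ∞ f s) (hg : ContMDiffOn IX IG ∞ g s)
    (hs : ∀ x ∈ s, f x ∈ 𝒬.cover i ∩ 𝒬.cover j) :
    ContMDiffOn IX IG ∞ (fun x => right (g x) (𝒬.trans i j (f x)).symm) s := by
  simp only [right_symm]
  refine 𝒢.contMDiffOn_mul_comp hg (𝒢.contMDiff_inv.comp_contMDiffOn (𝒬.contMDiffOn_trans_comp i j
    hf (𝒢.submersion_src.contMDiff.comp_contMDiffOn hg) hs)) fun x _ => ?_
  rw [𝒢.tgt_inv, src_toFun]

theorem contMDiffOn_trans_left_comp (i j : ι) {f : X → B} {g : X → G} {s : Set X}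
    (hf : ContMDiffOn IX IB ∞ f s) (hg : ContMDiffOn IX IG ∞ g s)
    (hs : ∀ x ∈ s, f x ∈ 𝒬.cover i ∩ 𝒬.cover j) :
    ContMDiffOn IX IG ∞ (fun x => (𝒬.trans i j (f x)).left (g x)) s :=
  𝒢.contMDiffOn_mul_comp (𝒬.contMDiffOn_trans_comp i j
    hf (𝒢.submersion_tgt.contMDiff.comp_contMDiffOn hg) hs) hg fun _ _ => src_toFun _ _

theorem trans_conj_conj {i j k : ι} {σ : B} (hi : σ ∈ 𝒬.cover i) (hj : σ ∈ 𝒬.cover j)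
    (hk : σ ∈ 𝒬.cover k) (g : G) :
    (𝒬.trans i j σ).conj ((𝒬.trans j k σ).conj g) = (𝒬.trans i k σ).conj g := by
  rw [conj_eq, conj_eq, conj_eq, ← left_right, 𝒬.trans_right_right hi hj hk,
    𝒬.trans_left_left hi hj hk]

theorem smoothClutching_adjointModel : SmoothClutching IB IG 𝒬.cover
    fun i j σ (g : G) => (𝒬.trans i j σ).conj g where
  isOpen := 𝒬.isOpen_cover
  exists_mem := 𝒬.exists_mem
  refl _ _ g hi := by rw [conj_eq, 𝒬.trans_left_self hi, 𝒬.trans_right_self hi]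
  trans _ _ _ _ g hi hj hk := 𝒬.trans_conj_conj hi hj hk g
  contMDiffOn i j := by
    simp only [conj_eq]
    exact 𝒬.contMDiffOn_trans_right_comp i j contMDiffOn_fst
      (𝒬.contMDiffOn_trans_left_comp i j contMDiffOn_fst contMDiffOn_snd fun x hx => hx.1)
      fun x hx => hx.1

theorem rightAct_eq {i : ι} {p : P} (hp : 𝒬.proj p ∈ 𝒬.cover i) (β : 𝒢.Bisection) :
    𝒬.rightAct p β = (𝒬.triv i).toOpenPartialHomeomorph.symm
      (𝒬.proj p, right (𝒬.triv i p).2 β) := by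
  conv_lhs => rw [𝒬.eq_pt hp, rightAct_pt]
  rfl

/-- The definition of `rightAct` uses an index depending on the point with no continuity. Since the
index is immaterial, a fixed trivialisation `k` near `p` computes the action, and there it is right
multiplication in `G`. -/
theorem contMDiffOn_rightAct (i j : ι) : ContMDiffOn (IB.prod IP) IP ∞
    (fun x : B × P => 𝒬.rightAct x.2 (𝒬.trans i j x.1).symm)
    ((𝒬.cover i ∩ 𝒬.cover j) ×ˢ Set.univ) := by
  rintro ⟨σ, p⟩ ⟨hσ, -⟩
  set k := 𝒬.index (𝒬.proj p)
  have hk : IsOpen (𝒬.proj ⁻¹' 𝒬.cover k) :=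
    (𝒬.isOpen_cover k).preimage 𝒬.submersion_proj.contMDiff.continuous
  set s : Set (B × P) := (𝒬.cover i ∩ 𝒬.cover j) ×ˢ (𝒬.proj ⁻¹' 𝒬.cover k) with hs
  have hso : IsOpen s := ((𝒬.isOpen_cover i).inter (𝒬.isOpen_cover j)).prod hk
  have hp : (σ, p) ∈ s := ⟨hσ, 𝒬.index_mem _⟩
  have h1 : ContMDiffOn (IB.prod IP) IB ∞ (fun x : B × P => 𝒬.proj x.2) s :=
    𝒬.submersion_proj.contMDiff.comp_contMDiffOn contMDiffOn_snd
  have h2 : ContMDiffOn (IB.prod IP) IG ∞ (fun x : B × P => (𝒬.triv k x.2).2) s :=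
    contMDiff_snd.comp_contMDiffOn ((𝒬.smooth_triv k).contMDiffOn_toFun.comp contMDiffOn_snd
      fun x hx => (𝒬.triv k).mem_source.2 hx.2)
  have h3 := 𝒬.contMDiffOn_trans_right_comp i j contMDiffOn_fst h2 fun x hx => hx.1
  have h4 := (𝒬.smooth_triv k).contMDiffOn_symm.comp (h1.prodMk h3)
    fun x hx => (𝒬.triv k).mem_target.2 hx.2
  exact ((h4.congr fun x hx => 𝒬.rightAct_eq hx.2 _).contMDiffAt
    (hso.mem_nhds hp)).contMDiffWithinAt

theorem smoothClutching_atiyah : SmoothClutching IB IP 𝒬.cover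
    fun i j σ (p : P) => 𝒬.rightAct p (𝒬.trans i j σ).symm where
  isOpen := 𝒬.isOpen_cover
  exists_mem := 𝒬.exists_mem
  refl _ _ p hi := by
    rw [𝒬.eq_pt (𝒬.index_mem (𝒬.proj p)), rightAct_pt, 𝒬.trans_right_self hi]
  trans _ _ _ _ p hi hj hk := by
    rw [𝒬.eq_pt (𝒬.index_mem (𝒬.proj p)), rightAct_pt, rightAct_pt, rightAct_pt,
      𝒬.trans_right_right hi hj hk]
  contMDiffOn := 𝒬.contMDiffOn_rightAct

end PrincipaloidBundle

end Bundle

/-! ### Coordinates on the Atiyah bundle and its structure maps. -/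

section Bundle

variable {EM : Type*} [NormedAddCommGroup EM] [NormedSpace ℝ EM] {HM : Type*} [TopologicalSpace HM]
  {EG : Type*} [NormedAddCommGroup EG] [NormedSpace ℝ EG] {HG : Type*} [TopologicalSpace HG]
  {EB : Type*} [NormedAddCommGroup EB] [NormedSpace ℝ EB] {HB : Type*} [TopologicalSpace HB]
  {EP : Type*} [NormedAddCommGroup EP] [NormedSpace ℝ EP] {HP : Type*} [TopologicalSpace HP]
  {IM : ModelWithCorners ℝ EM HM} {IG : ModelWithCorners ℝ EG HG}
  {M : Type*} [TopologicalSpace M] [ChartedSpace HM M] [SmoothMfd IM M]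
  {G : Type*} [TopologicalSpace G] [ChartedSpace HG G] [SmoothMfd IG G]

namespace PrincipaloidBundle

open LieGroupoid LieGroupoid.Bisection

variable {𝒢 : LieGroupoid IM M IG G}
  {IB : ModelWithCorners ℝ EB HB} {B : Type*} [TopologicalSpace B] [ChartedSpace HB B]
  [SmoothMfd IB B] {IP : ModelWithCorners ℝ EP HP} {P : Type*} [TopologicalSpace P]
  [ChartedSpace HP P] [SmoothMfd IP P] {ι : Type*}
  (𝒬 : PrincipaloidBundle 𝒢 IB B IP P ι)

@[simp]
theorem anchor_arrow (k l : ι) (σ₁ : 𝒬.cover k) (g : G) (σ₂ : 𝒬.cover l) :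
    𝒬.anchor (𝒬.arrow k l σ₁ g σ₂) = ((σ₁ : B), (σ₂ : B)) :=
  Prod.ext (𝒬.proj_pt k σ₁ g) rfl

/-- The right factor comes from the gluing of the Atiyah bundle over `σ₂`, the left one from the
change of trivialisation of `P` over `σ₁`. -/
theorem arrow_eq_arrow {k l k' l' : ι} {σ₁ σ₂ : B} (hk : σ₁ ∈ 𝒬.cover k) (hk' : σ₁ ∈ 𝒬.cover k')
    (hl : σ₂ ∈ 𝒬.cover l) (hl' : σ₂ ∈ 𝒬.cover l') (g : G) :
    𝒬.arrow k l ⟨σ₁, hk⟩ g ⟨σ₂, hl⟩ = 𝒬.arrow k' l' ⟨σ₁, hk'⟩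
      ((𝒬.trans k' k σ₁).left (right g (𝒬.trans l' l σ₂).symm)) ⟨σ₂, hl'⟩ := by
  rw [arrow, Clutched.mk_eq_mk_of_mem hl' hl, rightAct_pt, 𝒬.pt_eq_pt hk' hk]
  rfl

/-- The `G`-coordinate of an element of the Atiyah bundle over `O k × O l`. -/
noncomputable def atiyahCoord (k l : ι) (a : 𝒬.Atiyah) : G := (𝒬.triv k (a.coord l)).2

/-- The element of the Atiyah bundle with given coordinates over `O k × O l`. -/
noncomputable def atiyahOfCoord (k l : ι) (x : (B × B) × G) : 𝒬.Atiyah :=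
  Clutched.ofCoord 𝒬.exists_mem l
    (x.1.2, (𝒬.triv k).toOpenPartialHomeomorph.symm (x.1.1, x.2))

theorem atiyahOfCoord_of_mem {k l : ι} (σ₁ : 𝒬.cover k) (g : G) (σ₂ : 𝒬.cover l) :
    𝒬.atiyahOfCoord k l (((σ₁ : B), (σ₂ : B)), g) = 𝒬.arrow k l σ₁ g σ₂ :=
  Clutched.ofCoord_of_mem 𝒬.exists_mem σ₂ _

theorem atiyahCoord_arrow {k l : ι} (σ₁ : 𝒬.cover k) (g : G) (σ₂ : 𝒬.cover l) :
    𝒬.atiyahCoord k l (𝒬.arrow k l σ₁ g σ₂) = g := by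
  have h : (𝒬.arrow k l σ₁ g σ₂).coord l = 𝒬.pt k σ₁ g :=
    (𝒬.smoothClutching_atiyah.coord_mk σ₂.2 σ₂.2 _).trans
      (𝒬.smoothClutching_atiyah.refl _ _ _ σ₂.2)
  rw [atiyahCoord, h, triv_pt]

theorem atiyahCoord_arrow_of_mem {k l k' l' : ι} {σ₁ σ₂ : B} (hk : σ₁ ∈ 𝒬.cover k)
    (hk' : σ₁ ∈ 𝒬.cover k') (hl : σ₂ ∈ 𝒬.cover l) (hl' : σ₂ ∈ 𝒬.cover l') (g : G) :
    𝒬.atiyahCoord k' l' (𝒬.arrow k l ⟨σ₁, hk⟩ g ⟨σ₂, hl⟩) =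
      (𝒬.trans k' k σ₁).left (right g (𝒬.trans l' l σ₂).symm) := by
  rw [𝒬.arrow_eq_arrow hk hk' hl hl', atiyahCoord_arrow]

theorem eq_arrow {k l : ι} {a : 𝒬.Atiyah} (hk : (𝒬.anchor a).1 ∈ 𝒬.cover k)
    (hl : (𝒬.anchor a).2 ∈ 𝒬.cover l) :
    a = 𝒬.arrow k l ⟨(𝒬.anchor a).1, hk⟩ (𝒬.atiyahCoord k l a) ⟨(𝒬.anchor a).2, hl⟩ := by
  have h1 : a = Clutched.mk l ⟨a.proj, hl⟩ (a.coord l) := 𝒬.smoothClutching_atiyah.exists_eq_mk hl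
  have h2 : (𝒬.anchor a).1 = 𝒬.proj (a.coord l) := congrArg (fun a => (𝒬.anchor a).1) h1
  have h3 : a.coord l = 𝒬.pt k ⟨𝒬.proj (a.coord l), h2 ▸ hk⟩ (𝒬.atiyahCoord k l a) :=
    𝒬.eq_pt (h2 ▸ hk)
  have h4 : (⟨(𝒬.anchor a).1, hk⟩ : 𝒬.cover k) = ⟨𝒬.proj (a.coord l), h2 ▸ hk⟩ := Subtype.ext h2
  rw [h4, arrow, ← h3]
  exact h1

theorem exists_eq_arrow (a : 𝒬.Atiyah) : ∃ k l σ₁ g σ₂, a = 𝒬.arrow k l σ₁ g σ₂ :=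
  ⟨_, _, _, _, _, 𝒬.eq_arrow (𝒬.index_mem _) (𝒬.index_mem _)⟩

theorem shadow_coord_mk {i j : ι} {σ : B} (hi : σ ∈ 𝒬.cover i) (hj : σ ∈ 𝒬.cover j) (m : M) :
    (Clutched.mk j ⟨σ, hj⟩ m : 𝒬.Shadow).coord i = (𝒬.trans i j σ).shadow m :=
  𝒬.smoothClutching_shadow.coord_mk hi hj m

theorem shadow_ofCoord {i j : ι} {σ : B} (hi : σ ∈ 𝒬.cover i) (hj : σ ∈ 𝒬.cover j) (m : M) :
    (Clutched.ofCoord 𝒬.exists_mem i (σ, (𝒬.trans i j σ).shadow m) : 𝒬.Shadow) =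
      Clutched.mk j ⟨σ, hj⟩ m :=
  (Clutched.ofCoord_of_mem 𝒬.exists_mem ⟨σ, hi⟩ _).trans (Clutched.mk_eq_mk_of_mem hi hj m).symm

theorem shadow_mk_injective {i : ι} {σ τ : 𝒬.cover i} {m n : M}
    (h : (Clutched.mk i σ m : 𝒬.Shadow) = Clutched.mk i τ n) : σ = τ ∧ m = n := by
  have := congrArg (𝒬.smoothClutching_shadow.trivialization i) h
  rw [SmoothClutching.trivialization_mk, SmoothClutching.trivialization_mk, Prod.mk.injEq] at this
  exact ⟨Subtype.ext this.1, this.2⟩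

/-- The source map of the Atiyah groupoid. -/
noncomputable def atiyahSrc (a : 𝒬.Atiyah) : 𝒬.Shadow :=
  Clutched.ofCoord 𝒬.exists_mem (𝒬.index (𝒬.anchor a).2) ((𝒬.anchor a).2,
    𝒢.src (𝒬.atiyahCoord (𝒬.index (𝒬.anchor a).1) (𝒬.index (𝒬.anchor a).2) a))

/-- The target map of the Atiyah groupoid. -/
noncomputable def atiyahTgt (a : 𝒬.Atiyah) : 𝒬.Shadow :=
  Clutched.ofCoord 𝒬.exists_mem (𝒬.index (𝒬.anchor a).1) ((𝒬.anchor a).1,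
    𝒢.tgt (𝒬.atiyahCoord (𝒬.index (𝒬.anchor a).1) (𝒬.index (𝒬.anchor a).2) a))

/-- The unit map of the Atiyah groupoid. -/
noncomputable def atiyahOne (z : 𝒬.Shadow) : 𝒬.Atiyah :=
  𝒬.atiyahOfCoord (𝒬.index z.proj) (𝒬.index z.proj)
    ((z.proj, z.proj), 𝒢.one (z.coord (𝒬.index z.proj)))

/-- The inversion of the Atiyah groupoid. -/
noncomputable def atiyahInv (a : 𝒬.Atiyah) : 𝒬.Atiyah :=
  𝒬.atiyahOfCoord (𝒬.index (𝒬.anchor a).2) (𝒬.index (𝒬.anchor a).1)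
    (((𝒬.anchor a).2, (𝒬.anchor a).1),
      𝒢.inv (𝒬.atiyahCoord (𝒬.index (𝒬.anchor a).1) (𝒬.index (𝒬.anchor a).2) a))

/-- The multiplication of the Atiyah groupoid. -/
noncomputable def atiyahMul (a b : 𝒬.Atiyah) : 𝒬.Atiyah :=
  𝒬.atiyahOfCoord (𝒬.index (𝒬.anchor a).1) (𝒬.index (𝒬.anchor b).2)
    (((𝒬.anchor a).1, (𝒬.anchor b).2),
      𝒢.mul (𝒬.atiyahCoord (𝒬.index (𝒬.anchor a).1) (𝒬.index (𝒬.anchor a).2) a)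
        (𝒬.atiyahCoord (𝒬.index (𝒬.anchor a).2) (𝒬.index (𝒬.anchor b).2) b))

section Formulas

variable (k l n : ι) (σ₁ : 𝒬.cover k) (σ₂ : 𝒬.cover l) (σ₃ : 𝒬.cover n) (g h : G)

/-- Passing to the chosen indices changes `g` on both sides. The left change does not affect the
source, and the right one moves it by the shadow action, which is the gluing of the shadow bundle.
-/
theorem atiyahSrc_arrow :
    𝒬.atiyahSrc (𝒬.arrow k l σ₁ g σ₂) = Clutched.mk l σ₂ (𝒢.src g) := by
  rw [atiyahSrc, anchor_arrow]
  dsimp only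
  rw [𝒬.atiyahCoord_arrow_of_mem σ₁.2 (𝒬.index_mem _) σ₂.2 (𝒬.index_mem _), src_left,
    src_right_symm]
  exact 𝒬.shadow_ofCoord (𝒬.index_mem _) _ _

theorem atiyahTgt_arrow :
    𝒬.atiyahTgt (𝒬.arrow k l σ₁ g σ₂) = Clutched.mk k σ₁ (𝒢.tgt g) := by
  rw [atiyahTgt, anchor_arrow]
  dsimp only
  rw [𝒬.atiyahCoord_arrow_of_mem σ₁.2 (𝒬.index_mem _) σ₂.2 (𝒬.index_mem _), tgt_left,
    tgt_right]
  exact 𝒬.shadow_ofCoord (𝒬.index_mem _) _ _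

theorem atiyahInv_arrow :
    𝒬.atiyahInv (𝒬.arrow k l σ₁ g σ₂) = 𝒬.arrow l k σ₂ (𝒢.inv g) σ₁ := by
  rw [atiyahInv, anchor_arrow]
  dsimp only
  rw [𝒬.atiyahCoord_arrow_of_mem σ₁.2 (𝒬.index_mem _) σ₂.2 (𝒬.index_mem _), inv_left,
    inv_right_symm, left_right]
  exact (𝒬.atiyahOfCoord_of_mem ⟨_, 𝒬.index_mem _⟩ _ ⟨_, 𝒬.index_mem _⟩).trans
    (𝒬.arrow_eq_arrow _ _ _ _ _).symm

theorem atiyahOne_mk (m : M) :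
    𝒬.atiyahOne (Clutched.mk k σ₁ m) = 𝒬.arrow k k σ₁ (𝒢.one m) σ₁ := by
  rw [atiyahOne, Clutched.proj_mk, 𝒬.shadow_coord_mk (𝒬.index_mem _) σ₁.2, ← conj_one, conj_eq,
    left_right]
  exact (𝒬.atiyahOfCoord_of_mem ⟨_, 𝒬.index_mem _⟩ _ ⟨_, 𝒬.index_mem _⟩).trans
    (𝒬.arrow_eq_arrow _ _ _ _ _).symm

variable {g h}

/-- The bisection relating `l` to the chosen index at `σ₂` enters `g` on the right and `h` on the
left, and cancels; the outer factors then come out of the product. -/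
theorem atiyahMul_arrow (hgh : 𝒢.src g = 𝒢.tgt h) :
    𝒬.atiyahMul (𝒬.arrow k l σ₁ g σ₂) (𝒬.arrow l n σ₂ h σ₃) =
      𝒬.arrow k n σ₁ (𝒢.mul g h) σ₃ := by
  rw [atiyahMul, anchor_arrow, anchor_arrow]
  dsimp only
  rw [𝒬.atiyahCoord_arrow_of_mem σ₁.2 (𝒬.index_mem _) σ₂.2 (𝒬.index_mem _),
    𝒬.atiyahCoord_arrow_of_mem σ₂.2 (𝒬.index_mem _) σ₃.2 (𝒬.index_mem _),
    ← left_mul _ (by rw [src_right_symm, tgt_left, tgt_right, hgh]),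
    right_symm_mul_left _ (by rw [tgt_right, hgh]), ← right_mul _ hgh]
  exact (𝒬.atiyahOfCoord_of_mem ⟨_, 𝒬.index_mem _⟩ _ ⟨_, 𝒬.index_mem _⟩).trans
    (𝒬.arrow_eq_arrow _ _ _ _ _).symm

end Formulas

theorem arrow_change_left {k l k' : ι} {σ₁ : B} (hk : σ₁ ∈ 𝒬.cover k) (hk' : σ₁ ∈ 𝒬.cover k')
    (σ₂ : 𝒬.cover l) (g : G) :
    𝒬.arrow k l ⟨σ₁, hk⟩ g σ₂ = 𝒬.arrow k' l ⟨σ₁, hk'⟩ ((𝒬.trans k' k σ₁).left g) σ₂ := by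
  rw [𝒬.arrow_eq_arrow hk hk' σ₂.2 σ₂.2, 𝒬.trans_right_self σ₂.2]

/-- Only the left trivialisation is adjusted, so that an element can be matched with one already
written in coordinates on its left. -/
theorem exists_eq_arrow_left {k : ι} {a : 𝒬.Atiyah} {σ₁ : 𝒬.cover k} {m : M}
    (ha : 𝒬.atiyahTgt a = Clutched.mk k σ₁ m) :
    ∃ l σ₂ g, a = 𝒬.arrow k l σ₁ g σ₂ ∧ 𝒢.tgt g = m := by
  obtain ⟨k', l, τ₁, g, σ₂, rfl⟩ := 𝒬.exists_eq_arrow a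
  rw [atiyahTgt_arrow] at ha
  obtain ⟨τ₁, h1⟩ := τ₁
  obtain ⟨σ₁, h2⟩ := σ₁
  obtain rfl : τ₁ = σ₁ := congrArg Clutched.proj ha
  rw [𝒬.arrow_change_left h1 h2]
  rw [Clutched.mk_eq_mk_of_mem h2 h1] at ha
  exact ⟨l, σ₂, _, rfl, by rw [tgt_left]; exact (𝒬.shadow_mk_injective ha).2⟩

/-- Composable elements of the Atiyah bundle have composable coordinates. -/
theorem exists_eq_arrow_of_composable {a b : 𝒬.Atiyah} (hab : 𝒬.atiyahSrc a = 𝒬.atiyahTgt b) :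
    ∃ k l n σ₁ σ₂ σ₃ g h, a = 𝒬.arrow k l σ₁ g σ₂ ∧ b = 𝒬.arrow l n σ₂ h σ₃ ∧
      𝒢.src g = 𝒢.tgt h := by
  obtain ⟨k, l, σ₁, g, σ₂, rfl⟩ := 𝒬.exists_eq_arrow a
  rw [atiyahSrc_arrow] at hab
  obtain ⟨n, σ₃, h, rfl, hh⟩ := 𝒬.exists_eq_arrow_left hab.symm
  exact ⟨k, l, n, σ₁, σ₂, σ₃, g, h, rfl, rfl, hh.symm⟩

theorem continuous_anchor : Continuous 𝒬.anchor := by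
  refine Continuous.prodMk (continuous_quot_lift _ (continuous_sigma fun _ => ?_))
    Clutched.continuous_proj
  exact 𝒬.submersion_proj.contMDiff.continuous.comp continuous_snd

theorem anchor_eq_of_proj_coord (l : ι) {a : 𝒬.Atiyah} (hl : (𝒬.anchor a).2 ∈ 𝒬.cover l) :
    𝒬.proj (a.coord l) = (𝒬.anchor a).1 := by
  have h1 : a = Clutched.mk l ⟨a.proj, hl⟩ (a.coord l) := 𝒬.smoothClutching_atiyah.exists_eq_mk hl
  exact (congrArg (fun a => (𝒬.anchor a).1) h1).symm

/-- The trivialisation of the Atiyah bundle over `O k × O l` by the coordinates `(σ₁, σ₂, g)`. -/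
noncomputable def atiyahTriv (k l : ι) : Bundle.Trivialization G 𝒬.anchor where
  toFun a := (𝒬.anchor a, 𝒬.atiyahCoord k l a)
  invFun := 𝒬.atiyahOfCoord k l
  source := 𝒬.anchor ⁻¹' (𝒬.cover k ×ˢ 𝒬.cover l)
  target := (𝒬.cover k ×ˢ 𝒬.cover l) ×ˢ Set.univ
  map_source' _ ha := ⟨ha, trivial⟩
  map_target' := by
    rintro ⟨⟨σ₁, σ₂⟩, g⟩ ⟨⟨h1, h2⟩, -⟩
    rw [𝒬.atiyahOfCoord_of_mem ⟨σ₁, h1⟩ g ⟨σ₂, h2⟩, Set.mem_preimage, anchor_arrow]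
    exact ⟨h1, h2⟩
  left_inv' a ha := by
    conv_rhs => rw [𝒬.eq_arrow ha.1 ha.2]
    exact 𝒬.atiyahOfCoord_of_mem ⟨_, ha.1⟩ _ ⟨_, ha.2⟩
  right_inv' := by
    rintro ⟨⟨σ₁, σ₂⟩, g⟩ ⟨⟨h1, h2⟩, -⟩
    rw [𝒬.atiyahOfCoord_of_mem ⟨σ₁, h1⟩ g ⟨σ₂, h2⟩, anchor_arrow, atiyahCoord_arrow]
  open_source := ((𝒬.isOpen_cover k).prod (𝒬.isOpen_cover l)).preimage 𝒬.continuous_anchor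
  open_target := ((𝒬.isOpen_cover k).prod (𝒬.isOpen_cover l)).prod isOpen_univ
  continuousOn_toFun := by
    refine 𝒬.continuous_anchor.continuousOn.prodMk (continuous_snd.comp_continuousOn ?_)
    refine (𝒬.triv k).continuousOn_toFun.comp (continuous_snd.comp_continuousOn
      ((𝒬.smoothClutching_atiyah.continuousOn_coord l).mono fun a ha => ha.2)) fun a ha => ?_
    refine (𝒬.triv k).mem_source.2 ?_
    rw [𝒬.anchor_eq_of_proj_coord l ha.2]
    exact ha.1
  continuousOn_invFun := by
    -- The inverse first builds a point of `P` from `(σ₁, g)` in the `k`-th trivialisation, then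
    -- places it over `σ₂` in the `l`-th clutching chart.
    refine (𝒬.smoothClutching_atiyah.trivialization l).continuousOn_invFun.comp
      ((continuous_snd.comp continuous_fst).continuousOn.prodMk
        ((𝒬.triv k).toOpenPartialHomeomorph.continuousOn_symm.comp
          (f := fun x : (B × B) × G => (x.1.1, x.2)) (by fun_prop) fun x hx => ?_)) fun x hx => ?_
    · exact (𝒬.triv k).mem_target.2 hx.1.1
    · exact ⟨hx.1.2, trivial⟩
  baseSet := 𝒬.cover k ×ˢ 𝒬.cover l
  open_baseSet := (𝒬.isOpen_cover k).prod (𝒬.isOpen_cover l)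
  source_eq := rfl
  target_eq := rfl
  proj_toFun _ _ := rfl

/-- The coordinates compose the `l`-th clutching chart, with values in `B × P`, with the `k`-th
trivialisation of `P`; both are diffeomorphisms. -/
theorem isSmoothTriv_atiyahTriv {EA : Type*} [NormedAddCommGroup EA] [NormedSpace ℝ EA]
    {HA : Type*} [TopologicalSpace HA] {IA : ModelWithCorners ℝ EA HA} [ChartedSpace HA 𝒬.Atiyah]
    (hA : Clutched.IsModelled IB IP IA 𝒬.cover
        (fun k l σ (q : P) => 𝒬.rightAct q (𝒬.trans k l σ).symm)) (k l : ι) :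
    IsSmoothTriv (IB.prod IB) IG IA (𝒬.atiyahTriv k l) where
  contMDiffOn_toFun := by
    have h1 : ContMDiffOn IA (IB.prod IP) ∞ (fun a : 𝒬.Atiyah => (a.proj, a.coord l))
        (𝒬.atiyahTriv k l).source :=
      (𝒬.smoothClutching_atiyah.isSmoothTriv hA l).contMDiffOn_toFun.mono fun a ha => ha.2
    have h2 : ∀ a ∈ (𝒬.atiyahTriv k l).source, a.coord l ∈ (𝒬.triv k).source := fun a ha =>
      (𝒬.triv k).mem_source.2 (by rw [𝒬.anchor_eq_of_proj_coord l ha.2]; exact ha.1)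
    have h3 : ContMDiffOn IA IP ∞ (fun a : 𝒬.Atiyah => a.coord l) (𝒬.atiyahTriv k l).source :=
      contMDiff_snd.comp_contMDiffOn h1
    -- On this set the first component of `anchor` is the projection of the `P`-coordinate, which is
    -- known to be smooth.
    have h4 : ContMDiffOn IA (IB.prod IB) ∞ 𝒬.anchor (𝒬.atiyahTriv k l).source :=
      ((𝒬.submersion_proj.contMDiff.comp_contMDiffOn h3).prodMk
        (contMDiff_fst.comp_contMDiffOn h1)).congr fun a ha =>
          Prod.ext (𝒬.anchor_eq_of_proj_coord l ha.2).symm rfl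
    exact h4.prodMk (contMDiff_snd.comp_contMDiffOn
      ((𝒬.smooth_triv k).contMDiffOn_toFun.comp h3 h2))
  contMDiffOn_symm := by
    have h1 : ContMDiffOn ((IB.prod IB).prod IG) (IB.prod IG) ∞
        (fun x : (B × B) × G => (x.1.1, x.2)) (𝒬.atiyahTriv k l).target :=
      (contMDiff_fst.comp contMDiff_fst).contMDiffOn.prodMk contMDiffOn_snd
    have h2 := (𝒬.smooth_triv k).contMDiffOn_symm.comp h1
      fun x hx => (𝒬.triv k).mem_target.2 hx.1.1
    have h3 : ContMDiffOn ((IB.prod IB).prod IG) IB ∞ (fun x : (B × B) × G => x.1.2)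
        (𝒬.atiyahTriv k l).target := (contMDiff_snd.comp contMDiff_fst).contMDiffOn
    exact (𝒬.smoothClutching_atiyah.isSmoothTriv hA l).contMDiffOn_symm.comp (h3.prodMk h2)
      fun x hx => ⟨hx.1.2, trivial⟩

end PrincipaloidBundle

end Bundle

/-! ### Testing smoothness and submersivity in manifold-valued charts. -/

section SmoothCharts

variable {E₁ : Type*} [NormedAddCommGroup E₁] [NormedSpace ℝ E₁] {H₁ : Type*} [TopologicalSpace H₁]
  {E₂ : Type*} [NormedAddCommGroup E₂] [NormedSpace ℝ E₂] {H₂ : Type*} [TopologicalSpace H₂]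
  {E₃ : Type*} [NormedAddCommGroup E₃] [NormedSpace ℝ E₃] {H₃ : Type*} [TopologicalSpace H₃]
  {E₄ : Type*} [NormedAddCommGroup E₄] [NormedSpace ℝ E₄] {H₄ : Type*} [TopologicalSpace H₄]
  {I₁ : ModelWithCorners ℝ E₁ H₁} {I₂ : ModelWithCorners ℝ E₂ H₂}
  {I₃ : ModelWithCorners ℝ E₃ H₃} {I₄ : ModelWithCorners ℝ E₄ H₄}
  {Z : Type*} [TopologicalSpace Z] [ChartedSpace H₁ Z]
  {Z' : Type*} [TopologicalSpace Z'] [ChartedSpace H₂ Z']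
  {X : Type*} [TopologicalSpace X] [ChartedSpace H₃ X]
  {X' : Type*} [TopologicalSpace X'] [ChartedSpace H₄ X']

/-- A local homeomorphism between manifolds that is smooth in both directions. -/
structure IsSmoothChart (I₁ : ModelWithCorners ℝ E₁ H₁) (I₃ : ModelWithCorners ℝ E₃ H₃)
    (e : OpenPartialHomeomorph Z X) : Prop where
  contMDiffOn_toFun : ContMDiffOn I₁ I₃ ∞ e e.source
  contMDiffOn_symm : ContMDiffOn I₃ I₁ ∞ e.symm e.target

/-- Serves as the target chart for the projections to the base, where no coordinates are needed. -/
theorem isSmoothChart_refl : IsSmoothChart I₁ I₁ (OpenPartialHomeomorph.refl Z) :=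
  ⟨contMDiffOn_id, contMDiffOn_id⟩

theorem IsSmoothTriv.isSmoothChart {π : Z → Z'} {e : Bundle.Trivialization X π}
    (he : IsSmoothTriv I₂ I₃ I₁ e) : IsSmoothChart I₁ (I₂.prod I₃) e.toOpenPartialHomeomorph :=
  ⟨he.contMDiffOn_toFun, he.contMDiffOn_symm⟩

namespace IsSmoothChart

variable {e : OpenPartialHomeomorph Z X} {e' : OpenPartialHomeomorph Z' X'}

theorem contMDiffAt (he : IsSmoothChart I₁ I₃ e) {z : Z} (hz : z ∈ e.source) :
    ContMDiffAt I₁ I₃ ∞ e z :=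
  he.contMDiffOn_toFun.contMDiffAt (e.open_source.mem_nhds hz)

theorem contMDiffAt_symm (he : IsSmoothChart I₁ I₃ e) {x : X} (hx : x ∈ e.target) :
    ContMDiffAt I₃ I₁ ∞ e.symm x :=
  he.contMDiffOn_symm.contMDiffAt (e.open_target.mem_nhds hx)

theorem mdifferentiableAt_symm (he : IsSmoothChart I₁ I₃ e) {z : Z} (hz : z ∈ e.source) :
    MDifferentiableAt I₃ I₁ e.symm (e z) :=
  (he.contMDiffAt_symm (e.map_source hz)).mdifferentiableAt (by simp)

theorem injective_mfderiv (he : IsSmoothChart I₁ I₃ e) {z : Z} (hz : z ∈ e.source) :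
    Function.Injective (mfderiv I₁ I₃ e z) :=
  injective_mfderiv_of_leftInverse ((he.contMDiffAt hz).mdifferentiableAt (by simp))
    (he.mdifferentiableAt_symm hz) (e.eventually_left_inverse hz)

theorem surjective_mfderiv (he : IsSmoothChart I₁ I₃ e) {z : Z} (hz : z ∈ e.source) :
    Function.Surjective (mfderiv I₁ I₃ e z) :=
  surjective_mfderiv_of_rightInverse ((he.contMDiffAt hz).mdifferentiableAt (by simp))
    (he.mdifferentiableAt_symm hz) (e.left_inv hz) (e.eventually_right_inverse (e.map_source hz))

/-- A map that is smooth in local coordinates is smooth. -/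
theorem contMDiffAt_of_comp (he : IsSmoothChart I₁ I₃ e) (he' : IsSmoothChart I₂ I₄ e')
    {f : Z → Z'} {f' : X → X'} {z : Z} (hz : z ∈ e.source) (hf' : ContMDiffAt I₃ I₄ ∞ f' (e z))
    (hs : ∀ w ∈ e.source, f w ∈ e'.source) (h : ∀ w ∈ e.source, e' (f w) = f' (e w)) :
    ContMDiffAt I₁ I₂ ∞ f z := by
  have h1 : ContMDiffAt I₄ I₂ ∞ e'.symm (f' (e z)) :=
    he'.contMDiffAt_symm (h z hz ▸ e'.map_source (hs z hz))
  refine (h1.comp z (hf'.comp z (he.contMDiffAt hz))).congr_of_eventuallyEq ?_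
  filter_upwards [e.open_source.mem_nhds hz] with w hw
  simp only [Function.comp_apply]
  rw [← h w hw, e'.left_inv (hs w hw)]

/-- A map that is submersive in local coordinates is submersive. -/
theorem surjective_mfderiv_of_comp (he : IsSmoothChart I₁ I₃ e) (he' : IsSmoothChart I₂ I₄ e')
    {f : Z → Z'} {f' : X → X'} {z : Z} (hz : z ∈ e.source) (hf' : ContMDiffAt I₃ I₄ ∞ f' (e z))
    (hsurj : Function.Surjective (mfderiv I₃ I₄ f' (e z)))
    (hs : ∀ w ∈ e.source, f w ∈ e'.source) (h : ∀ w ∈ e.source, e' (f w) = f' (e w)) :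
    Function.Surjective (mfderiv I₁ I₂ f z) := by
  refine surjective_mfderiv_of_square
    ((he.contMDiffAt_of_comp he' hz hf' hs h).mdifferentiableAt (by simp))
    ((he.contMDiffAt hz).mdifferentiableAt (by simp))
    ((he'.contMDiffAt (hs z hz)).mdifferentiableAt (by simp)) (hf'.mdifferentiableAt (by simp)) ?_
    (he.surjective_mfderiv hz) hsurj (he'.injective_mfderiv (hs z hz))
  filter_upwards [e.open_source.mem_nhds hz] with w hw using h w hw

end IsSmoothChart

theorem surjective_mfderiv_prodMap {f : Z → Z'} {g : X → X'} {x : Z × X}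
    (hf : MDifferentiableAt I₁ I₂ f x.1) (hg : MDifferentiableAt I₃ I₄ g x.2)
    (sf : Function.Surjective (mfderiv I₁ I₂ f x.1))
    (sg : Function.Surjective (mfderiv I₃ I₄ g x.2)) :
    Function.Surjective (mfderiv (I₁.prod I₃) (I₂.prod I₄) (Prod.map f g) x) := by
  rw [mfderiv_prodMap hf hg]
  exact sf.prodMap sg

theorem surjective_mfderiv_fst (x : Z × X) :
    Function.Surjective (mfderiv (I₁.prod I₃) I₁ Prod.fst x) := by
  rw [mfderiv_fst]
  exact fun v => ⟨(v, (0 : E₃)), rfl⟩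

theorem surjective_mfderiv_snd (x : Z × X) :
    Function.Surjective (mfderiv (I₁.prod I₃) I₃ Prod.snd x) := by
  rw [mfderiv_snd]
  exact fun v => ⟨((0 : E₁), v), rfl⟩

end SmoothCharts

/-! ### The Atiyah Lie groupoid. -/

section Bundle

variable {EM : Type*} [NormedAddCommGroup EM] [NormedSpace ℝ EM] {HM : Type*} [TopologicalSpace HM]
  {EG : Type*} [NormedAddCommGroup EG] [NormedSpace ℝ EG] {HG : Type*} [TopologicalSpace HG]
  {EB : Type*} [NormedAddCommGroup EB] [NormedSpace ℝ EB] {HB : Type*} [TopologicalSpace HB]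
  {EP : Type*} [NormedAddCommGroup EP] [NormedSpace ℝ EP] {HP : Type*} [TopologicalSpace HP]
  {ES : Type*} [NormedAddCommGroup ES] [NormedSpace ℝ ES] {HS : Type*} [TopologicalSpace HS]
  {EA : Type*} [NormedAddCommGroup EA] [NormedSpace ℝ EA] {HA : Type*} [TopologicalSpace HA]
  {IM : ModelWithCorners ℝ EM HM} {IG : ModelWithCorners ℝ EG HG}
  {IS : ModelWithCorners ℝ ES HS} {IA : ModelWithCorners ℝ EA HA}
  {M : Type*} [TopologicalSpace M] [ChartedSpace HM M] [SmoothMfd IM M]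
  {G : Type*} [TopologicalSpace G] [ChartedSpace HG G] [SmoothMfd IG G]

namespace PrincipaloidBundle

open LieGroupoid LieGroupoid.Bisection

variable {𝒢 : LieGroupoid IM M IG G}
  {IB : ModelWithCorners ℝ EB HB} {B : Type*} [TopologicalSpace B] [ChartedSpace HB B]
  [SmoothMfd IB B] {IP : ModelWithCorners ℝ EP HP} {P : Type*} [TopologicalSpace P]
  [ChartedSpace HP P] [SmoothMfd IP P] {ι : Type*}
  (𝒬 : PrincipaloidBundle 𝒢 IB B IP P ι)

/-- The trivialisation of the shadow bundle over `O i`. -/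
noncomputable def shadowTriv (i : ι) :
    Bundle.Trivialization M (Clutched.proj : 𝒬.Shadow → B) :=
  𝒬.smoothClutching_shadow.trivialization i

theorem shadowTriv_mk (i : ι) (σ : 𝒬.cover i) (m : M) :
    𝒬.shadowTriv i (Clutched.mk i σ m) = ((σ : B), m) :=
  𝒬.smoothClutching_shadow.trivialization_mk i σ m

theorem atiyahTriv_arrow (k l : ι) (σ₁ : 𝒬.cover k) (g : G) (σ₂ : 𝒬.cover l) :
    𝒬.atiyahTriv k l (𝒬.arrow k l σ₁ g σ₂) = (((σ₁ : B), (σ₂ : B)), g) :=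
  Prod.ext (𝒬.anchor_arrow k l σ₁ g σ₂) (𝒬.atiyahCoord_arrow σ₁ g σ₂)

theorem exists_arrow_of_mem_source {k l : ι} {a : 𝒬.Atiyah} (ha : a ∈ (𝒬.atiyahTriv k l).source) :
    ∃ σ₁ g σ₂, a = 𝒬.arrow k l σ₁ g σ₂ :=
  ⟨_, _, _, 𝒬.eq_arrow ha.1 ha.2⟩

theorem exists_mk_of_mem_source {k : ι} {z : 𝒬.Shadow} (hz : z ∈ (𝒬.shadowTriv k).source) :
    ∃ σ m, z = Clutched.mk k σ m :=
  ⟨_, _, 𝒬.smoothClutching_shadow.exists_eq_mk hz⟩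

theorem mem_atiyahTriv_source_index (a : 𝒬.Atiyah) :
    a ∈ (𝒬.atiyahTriv (𝒬.index (𝒬.anchor a).1) (𝒬.index (𝒬.anchor a).2)).source :=
  ⟨𝒬.index_mem _, 𝒬.index_mem _⟩

variable [ChartedSpace HS 𝒬.Shadow] [ChartedSpace HA 𝒬.Atiyah]

/-- Smooth structures on the shadow and on the Atiyah bundle modelled on the clutching charts. -/
structure IsModelled (IS : ModelWithCorners ℝ ES HS) (IA : ModelWithCorners ℝ EA HA) : Prop where
  shadow : Clutched.IsModelled IB IM IS 𝒬.cover
    (fun k l σ (m : M) => (𝒬.trans k l σ).shadow m)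
  atiyah : Clutched.IsModelled IB IP IA 𝒬.cover
    (fun k l σ (q : P) => 𝒬.rightAct q (𝒬.trans k l σ).symm)

variable {𝒬} (hm : 𝒬.IsModelled IS IA)

namespace IsModelled

include hm

theorem isSmoothTriv_shadowTriv (i : ι) : IsSmoothTriv IB IM IS (𝒬.shadowTriv i) :=
  𝒬.smoothClutching_shadow.isSmoothTriv hm.shadow i

theorem isSmoothTriv_atiyahTriv (k l : ι) :
    IsSmoothTriv (IB.prod IB) IG IA (𝒬.atiyahTriv k l) :=
  𝒬.isSmoothTriv_atiyahTriv hm.atiyah k l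

/-- In coordinates the map is `((σ₁, σ₂), g) ↦ (σ₂, s(g))`, a product of submersions. Surjectivity
is witnessed by units. -/
theorem isSurjSubmersion_atiyahSrc : IsSurjSubmersion IA IS 𝒬.atiyahSrc := by
  have key (k l : ι) : ∀ a ∈ (𝒬.atiyahTriv k l).source,
      𝒬.atiyahSrc a ∈ (𝒬.shadowTriv l).source ∧ 𝒬.shadowTriv l (𝒬.atiyahSrc a) =
        Prod.map Prod.snd 𝒢.src (𝒬.atiyahTriv k l a) := by
    intro a ha
    obtain ⟨σ₁, g, σ₂, rfl⟩ := 𝒬.exists_arrow_of_mem_source ha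
    rw [atiyahSrc_arrow, shadowTriv_mk, atiyahTriv_arrow]
    exact ⟨σ₂.2, rfl⟩
  have hf : ContMDiff ((IB.prod IB).prod IG) (IB.prod IM) ∞
      (Prod.map (Prod.snd : B × B → B) 𝒢.src) :=
    contMDiff_snd.prodMap 𝒢.submersion_src.contMDiff
  refine ⟨fun a => ?_, fun z => ?_, fun a => ?_⟩
  · exact (hm.isSmoothTriv_atiyahTriv _ _).isSmoothChart.contMDiffAt_of_comp
      (hm.isSmoothTriv_shadowTriv _).isSmoothChart (𝒬.mem_atiyahTriv_source_index a) (hf _)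
      (fun w hw => (key _ _ w hw).1) (fun w hw => (key _ _ w hw).2)
  · obtain ⟨i, σ, m, rfl⟩ := z.exists_rep
    exact ⟨𝒬.arrow i i σ (𝒢.one m) σ, by rw [atiyahSrc_arrow, 𝒢.src_one]⟩
  · exact (hm.isSmoothTriv_atiyahTriv _ _).isSmoothChart.surjective_mfderiv_of_comp
      (hm.isSmoothTriv_shadowTriv _).isSmoothChart (𝒬.mem_atiyahTriv_source_index a) (hf _)
      (surjective_mfderiv_prodMap mdifferentiableAt_snd
        (𝒢.submersion_src.contMDiff.mdifferentiableAt (by simp)) (surjective_mfderiv_snd _)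
        (𝒢.submersion_src.surjective_mfderiv _))
      (fun w hw => (key _ _ w hw).1) (fun w hw => (key _ _ w hw).2)

theorem isSurjSubmersion_atiyahTgt : IsSurjSubmersion IA IS 𝒬.atiyahTgt := by
  have key (k l : ι) : ∀ a ∈ (𝒬.atiyahTriv k l).source,
      𝒬.atiyahTgt a ∈ (𝒬.shadowTriv k).source ∧ 𝒬.shadowTriv k (𝒬.atiyahTgt a) =
        Prod.map Prod.fst 𝒢.tgt (𝒬.atiyahTriv k l a) := by
    intro a ha
    obtain ⟨σ₁, g, σ₂, rfl⟩ := 𝒬.exists_arrow_of_mem_source ha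
    rw [atiyahTgt_arrow, shadowTriv_mk, atiyahTriv_arrow]
    exact ⟨σ₁.2, rfl⟩
  have hf : ContMDiff ((IB.prod IB).prod IG) (IB.prod IM) ∞
      (Prod.map (Prod.fst : B × B → B) 𝒢.tgt) :=
    contMDiff_fst.prodMap 𝒢.submersion_tgt.contMDiff
  refine ⟨fun a => ?_, fun z => ?_, fun a => ?_⟩
  · exact (hm.isSmoothTriv_atiyahTriv _ _).isSmoothChart.contMDiffAt_of_comp
      (hm.isSmoothTriv_shadowTriv _).isSmoothChart (𝒬.mem_atiyahTriv_source_index a) (hf _)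
      (fun w hw => (key _ _ w hw).1) (fun w hw => (key _ _ w hw).2)
  · obtain ⟨i, σ, m, rfl⟩ := z.exists_rep
    exact ⟨𝒬.arrow i i σ (𝒢.one m) σ, by rw [atiyahTgt_arrow, 𝒢.tgt_one]⟩
  · exact (hm.isSmoothTriv_atiyahTriv _ _).isSmoothChart.surjective_mfderiv_of_comp
      (hm.isSmoothTriv_shadowTriv _).isSmoothChart (𝒬.mem_atiyahTriv_source_index a) (hf _)
      (surjective_mfderiv_prodMap mdifferentiableAt_fst
        (𝒢.submersion_tgt.contMDiff.mdifferentiableAt (by simp)) (surjective_mfderiv_fst _)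
        (𝒢.submersion_tgt.surjective_mfderiv _))
      (fun w hw => (key _ _ w hw).1) (fun w hw => (key _ _ w hw).2)

theorem contMDiff_atiyahOne : ContMDiff IS IA ∞ 𝒬.atiyahOne := by
  intro z
  have key (k : ι) : ∀ z ∈ (𝒬.shadowTriv k).source,
      𝒬.atiyahOne z ∈ (𝒬.atiyahTriv k k).source ∧ 𝒬.atiyahTriv k k (𝒬.atiyahOne z) =
        Prod.map (fun σ => (σ, σ)) 𝒢.one (𝒬.shadowTriv k z) := by
    intro z hz
    obtain ⟨σ, m, rfl⟩ := 𝒬.exists_mk_of_mem_source hz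
    rw [atiyahOne_mk, shadowTriv_mk, atiyahTriv_arrow, Bundle.Trivialization.mem_source,
      anchor_arrow]
    exact ⟨⟨σ.2, σ.2⟩, rfl⟩
  have hf : ContMDiff (IB.prod IM) ((IB.prod IB).prod IG) ∞
      (Prod.map (fun σ : B => (σ, σ)) 𝒢.one) :=
    (contMDiff_id.prodMk contMDiff_id).prodMap 𝒢.contMDiff_one
  exact (hm.isSmoothTriv_shadowTriv (𝒬.index z.proj)).isSmoothChart.contMDiffAt_of_comp
      (hm.isSmoothTriv_atiyahTriv _ _).isSmoothChart (𝒬.index_mem z.proj) (hf _)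
      (fun w hw => (key _ w hw).1) (fun w hw => (key _ w hw).2)

theorem contMDiff_atiyahInv : ContMDiff IA IA ∞ 𝒬.atiyahInv := by
  intro a
  have key (k l : ι) : ∀ a ∈ (𝒬.atiyahTriv k l).source,
      𝒬.atiyahInv a ∈ (𝒬.atiyahTriv l k).source ∧ 𝒬.atiyahTriv l k (𝒬.atiyahInv a) =
        Prod.map Prod.swap 𝒢.inv (𝒬.atiyahTriv k l a) := by
    intro a ha
    obtain ⟨σ₁, g, σ₂, rfl⟩ := 𝒬.exists_arrow_of_mem_source ha
    rw [atiyahInv_arrow, atiyahTriv_arrow, atiyahTriv_arrow, Bundle.Trivialization.mem_source,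
      anchor_arrow]
    exact ⟨⟨σ₂.2, σ₁.2⟩, rfl⟩
  have hf : ContMDiff ((IB.prod IB).prod IG) ((IB.prod IB).prod IG) ∞
      (Prod.map (Prod.swap : B × B → B × B) 𝒢.inv) :=
    (contMDiff_snd.prodMk contMDiff_fst).prodMap 𝒢.contMDiff_inv
  exact (hm.isSmoothTriv_atiyahTriv _ _).isSmoothChart.contMDiffAt_of_comp
      (hm.isSmoothTriv_atiyahTriv _ _).isSmoothChart (𝒬.mem_atiyahTriv_source_index a) (hf _)
      (fun w hw => (key _ _ w hw).1) (fun w hw => (key _ _ w hw).2)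

/-- Near a composable pair both factors can be read with the same index `l` at the middle point.
There the product is `(σ₁, σ₃, g.h)`, smooth because multiplication in `𝒢` is smooth on composable
pairs. -/
theorem contMDiffOn_atiyahMul : ContMDiffOn (IA.prod IA) IA ∞
    (fun x : 𝒬.Atiyah × 𝒬.Atiyah => 𝒬.atiyahMul x.1 x.2)
    {x | 𝒬.atiyahSrc x.1 = 𝒬.atiyahTgt x.2} := by
  rintro ⟨a₀, b₀⟩ h₀
  obtain ⟨k, l, n, τ₁, τ₂, τ₃, g₀, f₀, rfl, rfl, -⟩ := 𝒬.exists_eq_arrow_of_composable h₀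
  set U : Set (𝒬.Atiyah × 𝒬.Atiyah) := (𝒬.atiyahTriv k l).source ×ˢ (𝒬.atiyahTriv l n).source
    with hU
  have hUo : IsOpen U := (𝒬.atiyahTriv k l).open_source.prod (𝒬.atiyahTriv l n).open_source
  have hmem : (𝒬.arrow k l τ₁ g₀ τ₂, 𝒬.arrow l n τ₂ f₀ τ₃) ∈ U := by
    simp only [hU, Set.mem_prod, Bundle.Trivialization.mem_source, anchor_arrow]
    exact ⟨⟨τ₁.2, τ₂.2⟩, ⟨τ₂.2, τ₃.2⟩⟩
  refine (contMDiffWithinAt_inter (hUo.mem_nhds hmem)).1 ?_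
  set C : Set (𝒬.Atiyah × 𝒬.Atiyah) := {x | 𝒬.atiyahSrc x.1 = 𝒬.atiyahTgt x.2} ∩ U with hC
  -- Source and target are compared in one shadow chart `l`, so their equality forces the same
  -- middle base point and composable coordinates, with no transition map.
  have hrep : ∀ x ∈ C, ∃ σ₁ σ₂ σ₃ g h, x = (𝒬.arrow k l σ₁ g σ₂, 𝒬.arrow l n σ₂ h σ₃) ∧
      𝒢.src g = 𝒢.tgt h := by
    rintro ⟨a, b⟩ ⟨hx, ha, hb⟩
    dsimp only at ha hb
    obtain ⟨σ₁, g, σ₂, rfl⟩ := 𝒬.exists_arrow_of_mem_source ha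
    obtain ⟨σ₂', h, σ₃, rfl⟩ := 𝒬.exists_arrow_of_mem_source hb
    rw [Set.mem_ofPred_eq, atiyahSrc_arrow, atiyahTgt_arrow] at hx
    obtain ⟨rfl, hgh⟩ := 𝒬.shadow_mk_injective hx
    exact ⟨σ₁, σ₂, σ₃, g, h, rfl, hgh⟩
  have h1 : ContMDiffOn (IA.prod IA) ((IB.prod IB).prod IG) ∞
      (fun x : 𝒬.Atiyah × 𝒬.Atiyah => 𝒬.atiyahTriv k l x.1) C :=
    (hm.isSmoothTriv_atiyahTriv k l).contMDiffOn_toFun.comp contMDiffOn_fst fun x hx => hx.2.1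
  have h2 : ContMDiffOn (IA.prod IA) ((IB.prod IB).prod IG) ∞
      (fun x : 𝒬.Atiyah × 𝒬.Atiyah => 𝒬.atiyahTriv l n x.2) C :=
    (hm.isSmoothTriv_atiyahTriv l n).contMDiffOn_toFun.comp contMDiffOn_snd fun x hx => hx.2.2
  have h3 := 𝒢.contMDiffOn_mul_comp (contMDiff_snd.comp_contMDiffOn h1)
    (contMDiff_snd.comp_contMDiffOn h2) (by
      intro x hx
      obtain ⟨σ₁, σ₂, σ₃, g, h, rfl, hgh⟩ := hrep x hx
      simp only [Function.comp_apply, atiyahTriv_arrow, hgh])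
  have h4 := (((contMDiff_fst.comp contMDiff_fst).comp_contMDiffOn h1).prodMk
    ((contMDiff_snd.comp contMDiff_fst).comp_contMDiffOn h2)).prodMk h3
  refine (((hm.isSmoothTriv_atiyahTriv k n).contMDiffOn_symm.comp h4 ?_).congr ?_) _ ⟨h₀, hmem⟩
  · exact fun x hx => (𝒬.atiyahTriv k n).mem_target.2 ⟨hx.2.1.1, hx.2.2.2⟩
  · intro x hx
    obtain ⟨σ₁, σ₂, σ₃, g, h, rfl, hgh⟩ := hrep x hx
    simp only [Function.comp_apply, atiyahTriv_arrow, 𝒬.atiyahMul_arrow _ _ _ _ _ _ hgh]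
    exact (𝒬.atiyahOfCoord_of_mem σ₁ _ σ₃).symm

variable [SmoothMfd IS 𝒬.Shadow] [SmoothMfd IA 𝒬.Atiyah]

/-- The Atiyah groupoid of a principaloid bundle, over its shadow. -/
noncomputable def atiyahGroupoid : LieGroupoid IS 𝒬.Shadow IA 𝒬.Atiyah where
  src := 𝒬.atiyahSrc
  tgt := 𝒬.atiyahTgt
  one := 𝒬.atiyahOne
  inv := 𝒬.atiyahInv
  mul := 𝒬.atiyahMul
  src_one z := by
    obtain ⟨i, σ, m, rfl⟩ := z.exists_rep
    rw [atiyahOne_mk, atiyahSrc_arrow, 𝒢.src_one]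
  tgt_one z := by
    obtain ⟨i, σ, m, rfl⟩ := z.exists_rep
    rw [atiyahOne_mk, atiyahTgt_arrow, 𝒢.tgt_one]
  src_mul a b hab := by
    obtain ⟨k, l, n, σ₁, σ₂, σ₃, g, h, rfl, rfl, hgh⟩ := 𝒬.exists_eq_arrow_of_composable hab
    rw [𝒬.atiyahMul_arrow _ _ _ _ _ _ hgh, atiyahSrc_arrow, atiyahSrc_arrow, 𝒢.src_mul _ _ hgh]
  tgt_mul a b hab := by
    obtain ⟨k, l, n, σ₁, σ₂, σ₃, g, h, rfl, rfl, hgh⟩ := 𝒬.exists_eq_arrow_of_composable hab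
    rw [𝒬.atiyahMul_arrow _ _ _ _ _ _ hgh, atiyahTgt_arrow, atiyahTgt_arrow, 𝒢.tgt_mul _ _ hgh]
  mul_assoc a b c hab hbc := by
    obtain ⟨k, l, n, σ₁, σ₂, σ₃, g, h, rfl, rfl, hgh⟩ := 𝒬.exists_eq_arrow_of_composable hab
    rw [atiyahSrc_arrow] at hbc
    obtain ⟨o, σ₄, f, rfl, hf⟩ := 𝒬.exists_eq_arrow_left hbc.symm
    rw [𝒬.atiyahMul_arrow _ _ _ _ _ _ hgh, 𝒬.atiyahMul_arrow _ _ _ _ _ _ hf.symm,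
      𝒬.atiyahMul_arrow _ _ _ _ _ _ (by rw [𝒢.src_mul _ _ hgh, hf]),
      𝒬.atiyahMul_arrow _ _ _ _ _ _ (by rw [𝒢.tgt_mul _ _ hf.symm, hgh]),
      𝒢.mul_assoc _ _ _ hgh hf.symm]
  one_mul a := by
    obtain ⟨k, l, σ₁, g, σ₂, rfl⟩ := 𝒬.exists_eq_arrow a
    rw [atiyahTgt_arrow, atiyahOne_mk, 𝒬.atiyahMul_arrow _ _ _ _ _ _ (𝒢.src_one _), 𝒢.one_mul]
  mul_one a := by
    obtain ⟨k, l, σ₁, g, σ₂, rfl⟩ := 𝒬.exists_eq_arrow a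
    rw [atiyahSrc_arrow, atiyahOne_mk, 𝒬.atiyahMul_arrow _ _ _ _ _ _ (𝒢.tgt_one _).symm,
      𝒢.mul_one]
  src_inv a := by
    obtain ⟨k, l, σ₁, g, σ₂, rfl⟩ := 𝒬.exists_eq_arrow a
    rw [atiyahInv_arrow, atiyahSrc_arrow, atiyahTgt_arrow, 𝒢.src_inv]
  tgt_inv a := by
    obtain ⟨k, l, σ₁, g, σ₂, rfl⟩ := 𝒬.exists_eq_arrow a
    rw [atiyahInv_arrow, atiyahSrc_arrow, atiyahTgt_arrow, 𝒢.tgt_inv]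
  mul_inv a := by
    obtain ⟨k, l, σ₁, g, σ₂, rfl⟩ := 𝒬.exists_eq_arrow a
    rw [atiyahInv_arrow, atiyahTgt_arrow, 𝒬.atiyahMul_arrow _ _ _ _ _ _ (𝒢.tgt_inv _).symm,
      𝒢.mul_inv, atiyahOne_mk]
  inv_mul a := by
    obtain ⟨k, l, σ₁, g, σ₂, rfl⟩ := 𝒬.exists_eq_arrow a
    rw [atiyahInv_arrow, atiyahSrc_arrow, 𝒬.atiyahMul_arrow _ _ _ _ _ _ (𝒢.src_inv _),
      𝒢.inv_mul, atiyahOne_mk]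
  submersion_src := hm.isSurjSubmersion_atiyahSrc
  submersion_tgt := hm.isSurjSubmersion_atiyahTgt
  contMDiff_one := hm.contMDiff_atiyahOne
  contMDiff_inv := hm.contMDiff_atiyahInv
  contMDiffOn_mul := hm.contMDiffOn_atiyahMul

end IsModelled

end PrincipaloidBundle

end Bundle

/-! ### The adjoint groupoid, the exact sequence, local triviality and the conjugation model. -/

section Bundle

variable {EM : Type*} [NormedAddCommGroup EM] [NormedSpace ℝ EM] {HM : Type*} [TopologicalSpace HM]
  {EG : Type*} [NormedAddCommGroup EG] [NormedSpace ℝ EG] {HG : Type*} [TopologicalSpace HG]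
  {EB : Type*} [NormedAddCommGroup EB] [NormedSpace ℝ EB] {HB : Type*} [TopologicalSpace HB]
  {EP : Type*} [NormedAddCommGroup EP] [NormedSpace ℝ EP] {HP : Type*} [TopologicalSpace HP]
  {ES : Type*} [NormedAddCommGroup ES] [NormedSpace ℝ ES] {HS : Type*} [TopologicalSpace HS]
  {EA : Type*} [NormedAddCommGroup EA] [NormedSpace ℝ EA] {HA : Type*} [TopologicalSpace HA]
  {ED : Type*} [NormedAddCommGroup ED] [NormedSpace ℝ ED] {HD : Type*} [TopologicalSpace HD]
  {EX : Type*} [NormedAddCommGroup EX] [NormedSpace ℝ EX] {HX : Type*} [TopologicalSpace HX]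
  {IM : ModelWithCorners ℝ EM HM} {IG : ModelWithCorners ℝ EG HG}
  {IS : ModelWithCorners ℝ ES HS} {IA : ModelWithCorners ℝ EA HA}
  {ID : ModelWithCorners ℝ ED HD} {IX : ModelWithCorners ℝ EX HX}
  {M : Type*} [TopologicalSpace M] [ChartedSpace HM M] [SmoothMfd IM M]
  {G : Type*} [TopologicalSpace G] [ChartedSpace HG G] [SmoothMfd IG G]
  {X : Type*} [TopologicalSpace X] [ChartedSpace HX X]

namespace PrincipaloidBundle

open LieGroupoid LieGroupoid.Bisection

variable {𝒢 : LieGroupoid IM M IG G}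
  {IB : ModelWithCorners ℝ EB HB} {B : Type*} [TopologicalSpace B] [ChartedSpace HB B]
  [hB : SmoothMfd IB B] {IP : ModelWithCorners ℝ EP HP} {P : Type*} [TopologicalSpace P]
  [ChartedSpace HP P] [SmoothMfd IP P] {ι : Type*}
  (𝒬 : PrincipaloidBundle 𝒢 IB B IP P ι)

/-- Needed for surjectivity of the projections to `B` and `B × B`; it comes from the surjectivity of
`P → B`. -/
theorem nonempty_arrows (𝒬 : PrincipaloidBundle 𝒢 IB B IP P ι) (σ : B) : Nonempty G := by
  obtain ⟨p, -⟩ := 𝒬.submersion_proj.surjective σ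
  exact ⟨(𝒬.triv (𝒬.index (𝒬.proj p)) p).2⟩

theorem proj_atiyahSrc (a : 𝒬.Atiyah) : (𝒬.atiyahSrc a).proj = (𝒬.anchor a).2 := by
  obtain ⟨k, l, σ₁, g, σ₂, rfl⟩ := 𝒬.exists_eq_arrow a
  rw [atiyahSrc_arrow, anchor_arrow, Clutched.proj_mk]

theorem proj_atiyahTgt (a : 𝒬.Atiyah) : (𝒬.atiyahTgt a).proj = (𝒬.anchor a).1 := by
  obtain ⟨k, l, σ₁, g, σ₂, rfl⟩ := 𝒬.exists_eq_arrow a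
  rw [atiyahTgt_arrow, anchor_arrow, Clutched.proj_mk]

theorem anchor_atiyahOne (z : 𝒬.Shadow) : 𝒬.anchor (𝒬.atiyahOne z) = (z.proj, z.proj) := by
  obtain ⟨i, σ, m, rfl⟩ := z.exists_rep
  rw [atiyahOne_mk, anchor_arrow, Clutched.proj_mk]

theorem anchor_atiyahInv (a : 𝒬.Atiyah) :
    𝒬.anchor (𝒬.atiyahInv a) = ((𝒬.anchor a).2, (𝒬.anchor a).1) := by
  obtain ⟨k, l, σ₁, g, σ₂, rfl⟩ := 𝒬.exists_eq_arrow a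
  rw [atiyahInv_arrow, anchor_arrow, anchor_arrow]

theorem anchor_atiyahMul {a b : 𝒬.Atiyah} (hab : 𝒬.atiyahSrc a = 𝒬.atiyahTgt b) :
    𝒬.anchor (𝒬.atiyahMul a b) = ((𝒬.anchor a).1, (𝒬.anchor b).2) := by
  obtain ⟨k, l, n, σ₁, σ₂, σ₃, g, h, rfl, rfl, hgh⟩ := 𝒬.exists_eq_arrow_of_composable hab
  rw [𝒬.atiyahMul_arrow _ _ _ _ _ _ hgh, anchor_arrow, anchor_arrow, anchor_arrow]

theorem mem_adjoint_iff {a : 𝒬.Atiyah} :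
    𝒬.anchor a ∈ Set.range (LieGroupoid.pair IB B).one ↔ (𝒬.anchor a).1 = (𝒬.anchor a).2 := by
  constructor
  · rintro ⟨σ, h⟩
    rw [← h]; rfl
  · exact fun h => ⟨(𝒬.anchor a).1, Prod.ext rfl h⟩

/-- The element of the adjoint bundle over `σ ∈ O k` with coordinate `g`. -/
noncomputable def adjointArrow (k : ι) (σ : 𝒬.cover k) (g : G) : 𝒬.Adjoint :=
  ⟨𝒬.arrow k k σ g σ, 𝒬.mem_adjoint_iff.2 (by rw [anchor_arrow])⟩

theorem eq_adjointArrow {k : ι} {x : 𝒬.Adjoint} (hx : (𝒬.anchor x.1).2 ∈ 𝒬.cover k) :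
    x = 𝒬.adjointArrow k ⟨(𝒬.anchor x.1).2, hx⟩ (𝒬.atiyahCoord k k x.1) := by
  have h := 𝒬.mem_adjoint_iff.1 x.2
  refine Subtype.ext ((𝒬.eq_arrow (k := k) (l := k) (h ▸ hx) hx).trans ?_)
  have h' : (⟨(𝒬.anchor x.1).1, h ▸ hx⟩ : 𝒬.cover k) = ⟨(𝒬.anchor x.1).2, hx⟩ := Subtype.ext h
  rw [h']; rfl

open Classical in
/-- The inverse of the `k`-th chart of the adjoint bundle; meaningful over `O k`. -/
noncomputable def adjointOfCoord (k : ι) (x : B × G) : 𝒬.Adjoint :=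
  if h : x.1 ∈ 𝒬.cover k then 𝒬.adjointArrow k ⟨x.1, h⟩ x.2
  else 𝒬.adjointArrow (𝒬.index x.1) ⟨x.1, 𝒬.index_mem x.1⟩ x.2

theorem adjointOfCoord_of_mem {k : ι} {σ : B} (hσ : σ ∈ 𝒬.cover k) (g : G) :
    𝒬.adjointOfCoord k (σ, g) = 𝒬.adjointArrow k ⟨σ, hσ⟩ g := by
  simp [adjointOfCoord, hσ]

/-- The chart of the adjoint bundle over `O k`, with values in `B × G`. -/
noncomputable def adjointChart (k : ι) : OpenPartialHomeomorph 𝒬.Adjoint (B × G) where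
  toFun x := ((𝒬.anchor x.1).2, 𝒬.atiyahCoord k k x.1)
  invFun := 𝒬.adjointOfCoord k
  source := {x | (𝒬.anchor x.1).2 ∈ 𝒬.cover k}
  target := 𝒬.cover k ×ˢ Set.univ
  map_source' _ hx := ⟨hx, trivial⟩
  map_target' := by
    rintro ⟨σ, g⟩ ⟨hσ, -⟩
    rw [𝒬.adjointOfCoord_of_mem hσ, Set.mem_ofPred_eq, adjointArrow, anchor_arrow]
    exact hσ
  left_inv' x hx := by
    conv_rhs => rw [𝒬.eq_adjointArrow hx]
    exact 𝒬.adjointOfCoord_of_mem hx _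
  right_inv' := by
    rintro ⟨σ, g⟩ ⟨hσ, -⟩
    rw [𝒬.adjointOfCoord_of_mem hσ, adjointArrow, anchor_arrow, atiyahCoord_arrow]
  open_source := (𝒬.isOpen_cover k).preimage
    ((continuous_snd.comp 𝒬.continuous_anchor).comp continuous_subtype_val)
  open_target := (𝒬.isOpen_cover k).prod isOpen_univ
  continuousOn_toFun := by
    have h : ContinuousOn (fun x : 𝒬.Adjoint => 𝒬.atiyahTriv k k x.1)
        {x | (𝒬.anchor x.1).2 ∈ 𝒬.cover k} :=
      (𝒬.atiyahTriv k k).continuousOn_toFun.comp continuous_subtype_val.continuousOn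
        fun x hx => ⟨by rw [𝒬.mem_adjoint_iff.1 x.2]; exact hx, hx⟩
    have h1 : Continuous fun y : (B × B) × G => (y.1.2, y.2) := by fun_prop
    exact h1.comp_continuousOn h
  continuousOn_invFun := by
    -- In the subspace topology it suffices to be continuous into the Atiyah bundle, where the map
    -- is the inverse of `atiyahTriv k k` after the diagonal.
    refine Topology.IsInducing.subtypeVal.continuousOn_iff.2 ?_
    refine ((𝒬.atiyahTriv k k).continuousOn_invFun.comp
      (f := fun x : B × G => ((x.1, x.1), x.2)) (by fun_prop)
      fun x hx => ⟨⟨hx.1, hx.1⟩, trivial⟩).congr ?_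
    rintro ⟨σ, g⟩ ⟨hσ, -⟩
    rw [Function.comp_apply, 𝒬.adjointOfCoord_of_mem hσ]
    exact (𝒬.atiyahOfCoord_of_mem ⟨σ, hσ⟩ g ⟨σ, hσ⟩).symm

theorem adjointChart_adjointArrow (k : ι) (σ : 𝒬.cover k) (g : G) :
    𝒬.adjointChart k (𝒬.adjointArrow k σ g) = ((σ : B), g) :=
  Prod.ext (congrArg Prod.snd (𝒬.anchor_arrow k k σ g σ)) (𝒬.atiyahCoord_arrow σ g σ)

theorem adjointChart_symm {k : ι} {σ : B} (hσ : σ ∈ 𝒬.cover k) (g : G) :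
    (𝒬.adjointChart k).symm (σ, g) = 𝒬.adjointArrow k ⟨σ, hσ⟩ g :=
  𝒬.adjointOfCoord_of_mem hσ g

theorem adjointArrow_mem_source (k : ι) (σ : 𝒬.cover k) (g : G) :
    𝒬.adjointArrow k σ g ∈ (𝒬.adjointChart k).source := by
  change (𝒬.anchor (𝒬.arrow k k σ g σ)).2 ∈ 𝒬.cover k
  rw [anchor_arrow]
  exact σ.2

theorem exists_adjointArrow_of_mem_source {k : ι} {x : 𝒬.Adjoint}
    (hx : x ∈ (𝒬.adjointChart k).source) : ∃ σ g, x = 𝒬.adjointArrow k σ g :=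
  ⟨_, _, 𝒬.eq_adjointArrow hx⟩

theorem mem_adjointChart_source_index (x : 𝒬.Adjoint) :
    x ∈ (𝒬.adjointChart (𝒬.index (𝒬.anchor x.1).2)).source := 𝒬.index_mem _

/-- The transition is that of the Atiyah bundle with both base points equal, hence smooth in the
common base point. -/
theorem smoothGluing_adjointChart : SmoothGluing (IB.prod IG) 𝒬.adjointChart where
  exists_mem x := ⟨_, 𝒬.mem_adjointChart_source_index x⟩
  contMDiffOn i j := by
    have key : ∀ x : B × G, x ∈ (𝒬.adjointChart i).target ∩
        (𝒬.adjointChart i).symm ⁻¹' (𝒬.adjointChart j).source →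
        x.1 ∈ 𝒬.cover i ∧ x.1 ∈ 𝒬.cover j := by
      rintro ⟨σ, g⟩ ⟨⟨hi, -⟩, hj⟩
      refine ⟨hi, ?_⟩
      rw [Set.mem_preimage, 𝒬.adjointChart_symm hi] at hj
      have hj' : (𝒬.anchor (𝒬.arrow i i ⟨σ, hi⟩ g ⟨σ, hi⟩)).2 ∈ 𝒬.cover j := hj
      rwa [anchor_arrow] at hj'
    have h1 : ContMDiffOn (IB.prod IG) (IB.prod IG) ∞ (fun x : B × G => (x.1,
        (𝒬.trans j i x.1).left (right x.2 (𝒬.trans j i x.1).symm)))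
        ((𝒬.cover j ∩ 𝒬.cover i) ×ˢ Set.univ) :=
      contMDiffOn_fst.prodMk (𝒬.contMDiffOn_trans_left_comp j i contMDiffOn_fst
        (𝒬.contMDiffOn_trans_right_comp j i contMDiffOn_fst contMDiffOn_snd fun x hx => hx.1)
        fun x hx => hx.1)
    refine (h1.mono fun x hx => ⟨(key x hx).symm, trivial⟩).congr ?_
    rintro ⟨σ, g⟩ hx
    obtain ⟨hi, hj⟩ := key _ hx
    rw [𝒬.adjointChart_symm hi]
    exact Prod.ext (congrArg Prod.snd (𝒬.anchor_arrow i i ⟨σ, hi⟩ g ⟨σ, hi⟩))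
      (𝒬.atiyahCoord_arrow_of_mem hi hj hi hj g)

/-- The adjoint bundle has a smooth structure in which the charts `adjointChart` are
diffeomorphisms. -/
theorem exists_adjoint_smoothMfd [T2Space 𝒬.Atiyah] [SecondCountableTopology 𝒬.Atiyah] :
    ∃ (_ : ChartedSpace (ModelProd HB HG) 𝒬.Adjoint) (_ : SmoothMfd (IB.prod IG) 𝒬.Adjoint),
      ∀ k, IsSmoothChart (IB.prod IG) (IB.prod IG) (𝒬.adjointChart k) := by
  have hg := 𝒬.smoothGluing_adjointChart
  let _ := gluedChartedSpace (ModelProd HB HG) _ hg.exists_mem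
  have hBG := SmoothMfd.prod (M := B) (N := G) IB IG
  exact ⟨inferInstance,
    { toIsManifold := hg.isManifold
      toT2Space := inferInstance
      toSecondCountableTopology := TopologicalSpace.Subtype.secondCountableTopology _
      finiteDimensional := hBG.finiteDimensional
      boundaryless := hBG.boundaryless },
    fun k => ⟨hg.contMDiffOn_chart k, hg.contMDiffOn_chart_symm k⟩⟩

variable [ChartedSpace HS 𝒬.Shadow] [ChartedSpace HA 𝒬.Atiyah] [ChartedSpace HD 𝒬.Adjoint]

namespace IsModelled

variable {𝒬} (hm : 𝒬.IsModelled IS IA)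
  (hd : ∀ k, IsSmoothChart ID (IB.prod IG) (𝒬.adjointChart k))

include hm

theorem isSurjSubmersion_proj :
    IsSurjSubmersion IS IB (Clutched.proj : 𝒬.Shadow → B) := by
  refine ⟨fun z => ?_, fun σ => ?_, fun z => ?_⟩
  · exact (hm.isSmoothTriv_shadowTriv (𝒬.index z.proj)).isSmoothChart.contMDiffAt_of_comp
      isSmoothChart_refl (𝒬.index_mem z.proj) contMDiff_fst.contMDiffAt
      (fun _ _ => trivial) (fun _ _ => rfl)
  · obtain ⟨g⟩ := 𝒬.nonempty_arrows σ
    exact ⟨Clutched.mk (𝒬.index σ) ⟨σ, 𝒬.index_mem σ⟩ (𝒢.src g), rfl⟩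
  · exact (hm.isSmoothTriv_shadowTriv (𝒬.index z.proj)).isSmoothChart.surjective_mfderiv_of_comp
      isSmoothChart_refl (𝒬.index_mem z.proj) contMDiff_fst.contMDiffAt
      (surjective_mfderiv_fst _) (fun _ _ => trivial) (fun _ _ => rfl)

theorem isSurjSubmersion_anchor : IsSurjSubmersion IA (IB.prod IB) 𝒬.anchor := by
  refine ⟨fun a => ?_, fun σ => ?_, fun a => ?_⟩
  · exact (hm.isSmoothTriv_atiyahTriv _ _).isSmoothChart.contMDiffAt_of_comp
      isSmoothChart_refl (𝒬.mem_atiyahTriv_source_index a) contMDiff_fst.contMDiffAt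
      (fun _ _ => trivial) (fun _ _ => rfl)
  · obtain ⟨g⟩ := 𝒬.nonempty_arrows σ.1
    exact ⟨𝒬.arrow _ _ ⟨σ.1, 𝒬.index_mem _⟩ g ⟨σ.2, 𝒬.index_mem _⟩, 𝒬.anchor_arrow _ _ _ _ _⟩
  · exact (hm.isSmoothTriv_atiyahTriv _ _).isSmoothChart.surjective_mfderiv_of_comp
      isSmoothChart_refl (𝒬.mem_atiyahTriv_source_index a) contMDiff_fst.contMDiffAt
      (surjective_mfderiv_fst _) (fun _ _ => trivial) (fun _ _ => rfl)

include hd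

theorem contMDiff_adjoint_val : ContMDiff ID IA ∞ (Subtype.val : 𝒬.Adjoint → 𝒬.Atiyah) := by
  have key (k : ι) : ∀ x ∈ (𝒬.adjointChart k).source, x.1 ∈ (𝒬.atiyahTriv k k).source ∧
      𝒬.atiyahTriv k k x.1 = Prod.map (fun σ => (σ, σ)) id (𝒬.adjointChart k x) := by
    intro x hx
    obtain ⟨σ, g, rfl⟩ := 𝒬.exists_adjointArrow_of_mem_source hx
    rw [adjointChart_adjointArrow, adjointArrow, atiyahTriv_arrow, Bundle.Trivialization.mem_source,
      anchor_arrow]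
    exact ⟨⟨σ.2, σ.2⟩, rfl⟩
  have hf : ContMDiff (IB.prod IG) ((IB.prod IB).prod IG) ∞
      (Prod.map (fun σ : B => (σ, σ)) (id : G → G)) :=
    (contMDiff_id.prodMk contMDiff_id).prodMap contMDiff_id
  exact fun x => (hd _).contMDiffAt_of_comp (hm.isSmoothTriv_atiyahTriv _ _).isSmoothChart
    (𝒬.mem_adjointChart_source_index x) (hf _) (fun w hw => (key _ w hw).1)
    (fun w hw => (key _ w hw).2)

/-- The adjoint bundle is locally a smooth retract of the Atiyah bundle. -/
theorem exists_adjoint_retraction (x : 𝒬.Adjoint) :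
    ∃ r : 𝒬.Atiyah → 𝒬.Adjoint, ContMDiffAt IA ID ∞ r x.1 ∧
      ∃ U ∈ 𝓝 x.1, ∀ y : 𝒬.Adjoint, y.1 ∈ U → r y.1 = y := by
  set k := 𝒬.index (𝒬.anchor x.1).2
  have hx : x ∈ (𝒬.adjointChart k).source := 𝒬.mem_adjointChart_source_index x
  have hmem (y : 𝒬.Adjoint) (hy : y ∈ (𝒬.adjointChart k).source) :
      y.1 ∈ (𝒬.atiyahTriv k k).source := ⟨by rw [𝒬.mem_adjoint_iff.1 y.2]; exact hy, hy⟩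
  have h1 := (hm.isSmoothTriv_atiyahTriv k k).isSmoothChart.contMDiffAt (hmem x hx)
  have h2 : ContMDiff ((IB.prod IB).prod IG) (IB.prod IG) ∞
      (Prod.map Prod.snd id : (B × B) × G → B × G) := contMDiff_snd.prodMap contMDiff_id
  have h3 : ContMDiffAt (IB.prod IG) ID ∞ (𝒬.adjointChart k).symm (𝒬.adjointChart k x) :=
    (hd k).contMDiffAt_symm ((𝒬.adjointChart k).map_source hx)
  exact ⟨fun a => (𝒬.adjointChart k).symm (Prod.map Prod.snd id (𝒬.atiyahTriv k k a)),
    h3.comp x.1 (h2.contMDiffAt.comp x.1 h1), _,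
    (𝒬.atiyahTriv k k).open_source.mem_nhds (hmem x hx),
    fun y hy => (𝒬.adjointChart k).left_inv hy.2⟩

/-- Composing with the local retraction recovers `f`. Thus smoothness into the adjoint bundle is
smoothness into the Atiyah bundle, and its structure maps need no separate computation. -/
theorem contMDiffWithinAt_of_adjoint_val {f : X → 𝒬.Adjoint} {s : Set X} {x : X}
    (hf : ContMDiffWithinAt IX IA ∞ (fun y => (f y).1) s x) : ContMDiffWithinAt IX ID ∞ f s x := by
  obtain ⟨r, hr, U, hU, hrU⟩ := hm.exists_adjoint_retraction hd (f x)
  refine (ContMDiffAt.comp_contMDiffWithinAt (f := fun y => (f y).1) x hr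
    hf).congr_of_eventuallyEq ?_ ?_
  · filter_upwards [hf.continuousWithinAt.preimage_mem_nhdsWithin hU] with y hy
    exact (hrU _ hy).symm
  · exact (hrU _ (mem_of_mem_nhds hU)).symm

theorem isEmbeddingMfd_adjoint_val :
    IsEmbeddingMfd ID IA (Subtype.val : 𝒬.Adjoint → 𝒬.Atiyah) where
  contMDiff := hm.contMDiff_adjoint_val hd
  isEmbedding := Topology.IsEmbedding.subtypeVal
  injective_mfderiv x := by
    obtain ⟨r, hr, U, hU, hrU⟩ := hm.exists_adjoint_retraction hd x
    refine injective_mfderiv_of_leftInverse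
      ((hm.contMDiff_adjoint_val hd x).mdifferentiableAt (by simp))
      (hr.mdifferentiableAt (by simp)) ?_
    filter_upwards [continuous_subtype_val.continuousAt.preimage_mem_nhds hU] with y hy
    exact hrU y hy

/-- Smoothness restricts from the Atiyah bundle, but submersivity does not; it is read in the
adjoint charts, where the map is `(σ, g) ↦ (σ, s(g))`. -/
theorem isSurjSubmersion_adjoint_src :
    IsSurjSubmersion ID IS (fun x : 𝒬.Adjoint => 𝒬.atiyahSrc x.1) := by
  have key (k : ι) : ∀ x ∈ (𝒬.adjointChart k).source,
      𝒬.atiyahSrc x.1 ∈ (𝒬.shadowTriv k).source ∧ 𝒬.shadowTriv k (𝒬.atiyahSrc x.1) =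
        Prod.map id 𝒢.src (𝒬.adjointChart k x) := by
    intro x hx
    obtain ⟨σ, g, rfl⟩ := 𝒬.exists_adjointArrow_of_mem_source hx
    rw [adjointChart_adjointArrow, adjointArrow, atiyahSrc_arrow, shadowTriv_mk]
    exact ⟨σ.2, rfl⟩
  have hf : ContMDiff (IB.prod IG) (IB.prod IM) ∞ (Prod.map (id : B → B) 𝒢.src) :=
    contMDiff_id.prodMap 𝒢.submersion_src.contMDiff
  refine ⟨hm.isSurjSubmersion_atiyahSrc.contMDiff.comp (hm.contMDiff_adjoint_val hd),
    fun z => ?_, fun x => ?_⟩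
  · obtain ⟨i, σ, m, rfl⟩ := z.exists_rep
    exact ⟨𝒬.adjointArrow i σ (𝒢.one m), by rw [adjointArrow, atiyahSrc_arrow, 𝒢.src_one]⟩
  · exact (hd _).surjective_mfderiv_of_comp
      (hm.isSmoothTriv_shadowTriv _).isSmoothChart (𝒬.mem_adjointChart_source_index x) (hf _)
      (surjective_mfderiv_prodMap mdifferentiableAt_id
        (𝒢.submersion_src.contMDiff.mdifferentiableAt (by simp))
        (by rw [mfderiv_id]; exact Function.surjective_id)
        (𝒢.submersion_src.surjective_mfderiv _))
      (fun w hw => (key _ w hw).1) (fun w hw => (key _ w hw).2)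

theorem isSurjSubmersion_adjoint_tgt :
    IsSurjSubmersion ID IS (fun x : 𝒬.Adjoint => 𝒬.atiyahTgt x.1) := by
  have key (k : ι) : ∀ x ∈ (𝒬.adjointChart k).source,
      𝒬.atiyahTgt x.1 ∈ (𝒬.shadowTriv k).source ∧ 𝒬.shadowTriv k (𝒬.atiyahTgt x.1) =
        Prod.map id 𝒢.tgt (𝒬.adjointChart k x) := by
    intro x hx
    obtain ⟨σ, g, rfl⟩ := 𝒬.exists_adjointArrow_of_mem_source hx
    rw [adjointChart_adjointArrow, adjointArrow, atiyahTgt_arrow, shadowTriv_mk]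
    exact ⟨σ.2, rfl⟩
  have hf : ContMDiff (IB.prod IG) (IB.prod IM) ∞ (Prod.map (id : B → B) 𝒢.tgt) :=
    contMDiff_id.prodMap 𝒢.submersion_tgt.contMDiff
  refine ⟨hm.isSurjSubmersion_atiyahTgt.contMDiff.comp (hm.contMDiff_adjoint_val hd),
    fun z => ?_, fun x => ?_⟩
  · obtain ⟨i, σ, m, rfl⟩ := z.exists_rep
    exact ⟨𝒬.adjointArrow i σ (𝒢.one m), by rw [adjointArrow, atiyahTgt_arrow, 𝒢.tgt_one]⟩
  · exact (hd _).surjective_mfderiv_of_comp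
      (hm.isSmoothTriv_shadowTriv _).isSmoothChart (𝒬.mem_adjointChart_source_index x) (hf _)
      (surjective_mfderiv_prodMap mdifferentiableAt_id
        (𝒢.submersion_tgt.contMDiff.mdifferentiableAt (by simp))
        (by rw [mfderiv_id]; exact Function.surjective_id)
        (𝒢.submersion_tgt.surjective_mfderiv _))
      (fun w hw => (key _ w hw).1) (fun w hw => (key _ w hw).2)

end IsModelled

open Classical in
/-- The multiplication of the adjoint groupoid, extended arbitrarily to non-composable pairs. -/
noncomputable def adjointMul (x y : 𝒬.Adjoint) : 𝒬.Adjoint :=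
  if h : 𝒬.atiyahSrc x.1 = 𝒬.atiyahTgt y.1 then
    ⟨𝒬.atiyahMul x.1 y.1, 𝒬.mem_adjoint_iff.2 <| by
      have h' := congrArg Clutched.proj h
      rw [proj_atiyahSrc, proj_atiyahTgt] at h'
      rw [𝒬.anchor_atiyahMul h]
      exact (𝒬.mem_adjoint_iff.1 x.2).trans (h'.trans (𝒬.mem_adjoint_iff.1 y.2))⟩
  else x

theorem adjointMul_val {x y : 𝒬.Adjoint} (h : 𝒬.atiyahSrc x.1 = 𝒬.atiyahTgt y.1) :
    (𝒬.adjointMul x y).1 = 𝒬.atiyahMul x.1 y.1 := by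
  simp [adjointMul, h]

namespace IsModelled

variable {𝒬} (hm : 𝒬.IsModelled IS IA)
  (hd : ∀ k, IsSmoothChart ID (IB.prod IG) (𝒬.adjointChart k))
  [SmoothMfd IS 𝒬.Shadow] [SmoothMfd IA 𝒬.Atiyah] [SmoothMfd ID 𝒬.Adjoint]

/-- The adjoint groupoid of a principaloid bundle, over its shadow. -/
noncomputable def adjointGroupoid : LieGroupoid IS 𝒬.Shadow ID 𝒬.Adjoint where
  src x := 𝒬.atiyahSrc x.1
  tgt x := 𝒬.atiyahTgt x.1
  one z := ⟨𝒬.atiyahOne z, 𝒬.mem_adjoint_iff.2 (by rw [anchor_atiyahOne])⟩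
  inv x := ⟨𝒬.atiyahInv x.1, 𝒬.mem_adjoint_iff.2
    (by rw [anchor_atiyahInv]; exact (𝒬.mem_adjoint_iff.1 x.2).symm)⟩
  mul := 𝒬.adjointMul
  src_one := hm.atiyahGroupoid.src_one
  tgt_one := hm.atiyahGroupoid.tgt_one
  src_mul x y h := by rw [𝒬.adjointMul_val h]; exact hm.atiyahGroupoid.src_mul _ _ h
  tgt_mul x y h := by rw [𝒬.adjointMul_val h]; exact hm.atiyahGroupoid.tgt_mul _ _ h
  -- The laws hold because they hold after the injective inclusion into the Atiyah groupoid;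
  -- composability has to be supplied each time to unfold `adjointMul`.
  mul_assoc x y z h h' := Subtype.ext <| by
    rw [adjointMul_val, adjointMul_val _ h, adjointMul_val, adjointMul_val _ h']
    · exact hm.atiyahGroupoid.mul_assoc _ _ _ h h'
    · rw [𝒬.adjointMul_val h']; exact h.trans (hm.atiyahGroupoid.tgt_mul _ _ h').symm
    · rw [𝒬.adjointMul_val h]; exact (hm.atiyahGroupoid.src_mul _ _ h).trans h'
  one_mul x := Subtype.ext <| by
    refine (𝒬.adjointMul_val ?_).trans (hm.atiyahGroupoid.one_mul x.1)
    exact hm.atiyahGroupoid.src_one _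
  mul_one x := Subtype.ext <| by
    refine (𝒬.adjointMul_val ?_).trans (hm.atiyahGroupoid.mul_one x.1)
    exact (hm.atiyahGroupoid.tgt_one _).symm
  src_inv x := hm.atiyahGroupoid.src_inv x.1
  tgt_inv x := hm.atiyahGroupoid.tgt_inv x.1
  mul_inv x := Subtype.ext <| by
    refine (𝒬.adjointMul_val ?_).trans (hm.atiyahGroupoid.mul_inv x.1)
    exact (hm.atiyahGroupoid.tgt_inv x.1).symm
  inv_mul x := Subtype.ext <| by
    refine (𝒬.adjointMul_val ?_).trans (hm.atiyahGroupoid.inv_mul x.1)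
    exact hm.atiyahGroupoid.src_inv x.1
  submersion_src := hm.isSurjSubmersion_adjoint_src hd
  submersion_tgt := hm.isSurjSubmersion_adjoint_tgt hd
  contMDiff_one z := hm.contMDiffWithinAt_of_adjoint_val hd (hm.contMDiff_atiyahOne z)
  contMDiff_inv x := hm.contMDiffWithinAt_of_adjoint_val hd
    ((hm.contMDiff_atiyahInv.comp (hm.contMDiff_adjoint_val hd)) x)
  contMDiffOn_mul x hx := hm.contMDiffWithinAt_of_adjoint_val hd <| by
    have hv := hm.contMDiff_adjoint_val hd
    exact (hm.contMDiffOn_atiyahMul.comp (hv.prodMap hv).contMDiffOn fun _ h => h).congr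
      (fun y hy => 𝒬.adjointMul_val hy) x hx

/-- The projection of the Atiyah groupoid to the pair groupoid of the base. -/
noncomputable def anchorHom : hm.atiyahGroupoid.Hom (LieGroupoid.pair IB B) where
  obj := Clutched.proj
  arr := 𝒬.anchor
  src_arr a := (𝒬.proj_atiyahSrc a).symm
  tgt_arr a := (𝒬.proj_atiyahTgt a).symm
  arr_one := 𝒬.anchor_atiyahOne
  arr_mul _ _ h := 𝒬.anchor_atiyahMul h
  contMDiff_obj := hm.isSurjSubmersion_proj.contMDiff
  contMDiff_arr := hm.isSurjSubmersion_anchor.contMDiff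

/-- The inclusion of the adjoint groupoid into the Atiyah groupoid. -/
noncomputable def inclusionHom : (hm.adjointGroupoid hd).Hom hm.atiyahGroupoid where
  obj := id
  arr := Subtype.val
  src_arr _ := rfl
  tgt_arr _ := rfl
  arr_one _ := rfl
  arr_mul _ _ h := 𝒬.adjointMul_val h
  contMDiff_obj := contMDiff_id
  contMDiff_arr := hm.contMDiff_adjoint_val hd

theorem isShortExact : IsShortExact (hm.inclusionHom hd) hm.anchorHom where
  mono_obj :=
    { contMDiff := contMDiff_id
      isEmbedding := Topology.IsEmbedding.id
      injective_mfderiv := fun x => by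
        change Function.Injective (mfderiv IS IS id x)
        rw [mfderiv_id]
        exact Function.injective_id }
  mono_arr := hm.isEmbeddingMfd_adjoint_val hd
  epi_obj := hm.isSurjSubmersion_proj
  epi_arr := hm.isSurjSubmersion_anchor
  -- The adjoint bundle is by definition the preimage of the unit bisection.
  range_arr := Subtype.range_val

end IsModelled

/-- Any two points of the base lie in an open set that carries a locally constant choice of
trivialisation indices. -/
theorem exists_locallyConstant_index (𝒬 : PrincipaloidBundle 𝒢 IB B IP P ι) (σ₁ σ₂ : B) :
    ∃ (V : Set B) (u : B → ι), IsOpen V ∧ σ₁ ∈ V ∧ σ₂ ∈ V ∧ (∀ σ ∈ V, σ ∈ 𝒬.cover (u σ)) ∧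
      ∀ σ ∈ V, ∀ᶠ τ in 𝓝 σ, u τ = u σ := by
  classical
  by_cases h : σ₁ = σ₂
  · exact ⟨𝒬.cover (𝒬.index σ₁), fun _ => 𝒬.index σ₁, 𝒬.isOpen_cover _, 𝒬.index_mem _,
      h ▸ 𝒬.index_mem _, fun _ h => h, fun _ _ => Filter.Eventually.of_forall fun _ => rfl⟩
  · have := hB.toT2Space
    obtain ⟨U₁, U₂, ho₁, ho₂, h₁, h₂, hd⟩ := t2_separation h
    -- A disjoint union of two small neighbourhoods, with the index constant on each; no single
    -- member of the cover need contain both points.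
    refine ⟨(U₁ ∩ 𝒬.cover (𝒬.index σ₁)) ∪ (U₂ ∩ 𝒬.cover (𝒬.index σ₂)),
      fun σ => if σ ∈ U₁ then 𝒬.index σ₁ else 𝒬.index σ₂,
      (ho₁.inter (𝒬.isOpen_cover _)).union (ho₂.inter (𝒬.isOpen_cover _)),
      .inl ⟨h₁, 𝒬.index_mem _⟩, .inr ⟨h₂, 𝒬.index_mem _⟩, ?_, ?_⟩
    · rintro σ (⟨hσ, hσ'⟩ | ⟨hσ, hσ'⟩)
      · simpa only [if_pos hσ] using hσ'
      · simpa only [if_neg (hd.notMem_of_mem_right hσ)] using hσ'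
    · rintro σ (⟨hσ, -⟩ | ⟨hσ, -⟩)
      · filter_upwards [ho₁.mem_nhds hσ] with τ hτ
        rw [if_pos hσ, if_pos hτ]
      · filter_upwards [ho₂.mem_nhds hσ] with τ hτ
        rw [if_neg (hd.notMem_of_mem_right hσ), if_neg (hd.notMem_of_mem_right hτ)]

/-- An arrow over `(σ₁, σ₂)` is read with the indices `u σ₁` and `u σ₂`. As the index depends only
on the base point, composable arrows automatically share the middle one, and the trivialisation
turns every structure map into that of the product groupoid. -/
theorem IsModelled.isFibreBundleObject {𝒬 : PrincipaloidBundle 𝒢 IB B IP P ι}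
    [ChartedSpace HS 𝒬.Shadow] [ChartedSpace HA 𝒬.Atiyah]
    [SmoothMfd IS 𝒬.Shadow] [SmoothMfd IA 𝒬.Atiyah] (hm : 𝒬.IsModelled IS IA) :
    IsFibreBundleObject hm.anchorHom 𝒢 := by
  rintro ⟨τ₁, τ₂⟩
  obtain ⟨V, u, hVo, h₁, h₂, hV, hu⟩ := 𝒬.exists_locallyConstant_index τ₁ τ₂
  set W : Set (B × B) := {b | b.2 ∈ V ∧ b.1 ∈ V}
  have hWo : IsOpen W := (hVo.preimage continuous_snd).inter (hVo.preimage continuous_fst)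
  have hW : ∀ b ∈ W, b ∈ (𝒬.atiyahTriv (u b.1) (u b.2)).baseSet :=
    fun b hb => ⟨hV _ hb.2, hV _ hb.1⟩
  have huW : ∀ b ∈ W, ∀ᶠ c in 𝓝 b, (u c.1, u c.2) = (u b.1, u b.2) := by
    intro b hb
    filter_upwards [continuousAt_fst.eventually (hu _ hb.2),
      continuousAt_snd.eventually (hu _ hb.1)] with c h1 h2
    rw [h1, h2]
  let θ := trivializationOfIndex 𝒬.shadowTriv u V Clutched.continuous_proj hVo hV hu
  let Θ := trivializationOfIndex (fun i : ι × ι => 𝒬.atiyahTriv i.1 i.2)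
    (fun b => (u b.1, u b.2)) W 𝒬.continuous_anchor hWo hW huW
  have hθ : ∀ σ (hσ : σ ∈ V) m, θ (Clutched.mk (u σ) ⟨σ, hV σ hσ⟩ m) = (σ, m) :=
    fun σ hσ m => 𝒬.shadowTriv_mk _ _ m
  have hΘ : ∀ σ₁ σ₂ (hσ₁ : σ₁ ∈ V) (hσ₂ : σ₂ ∈ V) g,
      Θ (𝒬.arrow (u σ₁) (u σ₂) ⟨σ₁, hV _ hσ₁⟩ g ⟨σ₂, hV _ hσ₂⟩) = ((σ₁, σ₂), g) := by
    intro σ₁ σ₂ hσ₁ hσ₂ g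
    change 𝒬.atiyahTriv (u (𝒬.anchor _).1) (u (𝒬.anchor _).2) _ = _
    rw [anchor_arrow]
    exact 𝒬.atiyahTriv_arrow _ _ _ _ _
  have hrep : ∀ a ∈ Θ.source, ∃ σ₁ σ₂, ∃ (hσ₁ : σ₁ ∈ V) (hσ₂ : σ₂ ∈ V), ∃ g,
      a = 𝒬.arrow (u σ₁) (u σ₂) ⟨σ₁, hV _ hσ₁⟩ g ⟨σ₂, hV _ hσ₂⟩ := fun a ha =>
    ⟨_, _, ha.2, ha.1, _, 𝒬.eq_arrow (hV _ ha.2) (hV _ ha.1)⟩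
  have src : ∀ a ∈ Θ.source, θ (𝒬.atiyahSrc a) = ((𝒬.anchor a).2, 𝒢.src (Θ a).2) := by
    intro a ha
    obtain ⟨σ₁, σ₂, hσ₁, hσ₂, g, rfl⟩ := hrep a ha
    rw [hΘ _ _ hσ₁ hσ₂, atiyahSrc_arrow, anchor_arrow, hθ _ hσ₂]
  have tgt : ∀ a ∈ Θ.source, θ (𝒬.atiyahTgt a) = ((𝒬.anchor a).1, 𝒢.tgt (Θ a).2) := by
    intro a ha
    obtain ⟨σ₁, σ₂, hσ₁, hσ₂, g, rfl⟩ := hrep a ha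
    rw [hΘ _ _ hσ₁ hσ₂, atiyahTgt_arrow, anchor_arrow, hθ _ hσ₁]
  have one : ∀ z ∈ θ.source, Θ (𝒬.atiyahOne z) = ((z.proj, z.proj), 𝒢.one (θ z).2) := by
    intro z hz
    obtain ⟨σ, hσ, m, rfl⟩ : ∃ σ, ∃ hσ : σ ∈ V, ∃ m,
        z = Clutched.mk (u σ) ⟨σ, hV σ hσ⟩ m :=
      ⟨_, hz, _, 𝒬.smoothClutching_shadow.exists_eq_mk (hV _ hz)⟩
    rw [hθ _ hσ, atiyahOne_mk, hΘ _ _ hσ hσ, Clutched.proj_mk]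
  have inv : ∀ a ∈ Θ.source,
      Θ (𝒬.atiyahInv a) = (((𝒬.anchor a).2, (𝒬.anchor a).1), 𝒢.inv (Θ a).2) := by
    intro a ha
    obtain ⟨σ₁, σ₂, hσ₁, hσ₂, g, rfl⟩ := hrep a ha
    rw [hΘ _ _ hσ₁ hσ₂, atiyahInv_arrow, hΘ _ _ hσ₂ hσ₁, anchor_arrow]
  have mul : ∀ a ∈ Θ.source, ∀ b ∈ Θ.source, 𝒬.atiyahSrc a = 𝒬.atiyahTgt b →
      Θ (𝒬.atiyahMul a b) =
        (((𝒬.anchor a).1, (𝒬.anchor b).2), 𝒢.mul (Θ a).2 (Θ b).2) := by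
    intro a ha b hb hab
    obtain ⟨σ₁, σ₂, hσ₁, hσ₂, g, rfl⟩ := hrep a ha
    obtain ⟨σ₂', σ₃, hσ₂', hσ₃, h, rfl⟩ := hrep b hb
    rw [atiyahSrc_arrow, atiyahTgt_arrow] at hab
    obtain rfl : σ₂ = σ₂' := congrArg Clutched.proj hab
    have hgh := (𝒬.shadow_mk_injective hab).2
    rw [hΘ _ _ hσ₁ hσ₂, hΘ _ _ hσ₂ hσ₃, 𝒬.atiyahMul_arrow _ _ _ _ _ _ hgh, hΘ _ _ hσ₁ hσ₃,
      anchor_arrow, anchor_arrow]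
  -- The pair `(τ₁, τ₂)` is an arrow from `τ₂` to `τ₁`, whence `h₂` comes before `h₁`.
  exact ⟨V, hVo, h₂, h₁, θ, Θ, rfl,
    isSmoothTriv_trivializationOfIndex hm.isSmoothTriv_shadowTriv _ _ _ _, rfl,
    isSmoothTriv_trivializationOfIndex (fun i : ι × ι => hm.isSmoothTriv_atiyahTriv i.1 i.2) _ _ _ _,
    src, tgt, one, inv, mul⟩

/-- The comparison map from the bundle glued by conjugation to the adjoint bundle. -/
noncomputable def adjointComparison (𝒬 : PrincipaloidBundle 𝒢 IB B IP P ι) : 𝒬.AdjointModel → 𝒬.Adjoint :=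
  Quot.lift (fun x => 𝒬.adjointArrow x.1 x.2.1 x.2.2) <| by
    rintro ⟨i, ⟨σ, hi⟩, g⟩ ⟨j, ⟨τ, hj⟩, h⟩ ⟨h1, h2⟩
    dsimp only at h1 h2
    subst h1 h2
    refine Subtype.ext ((𝒬.arrow_eq_arrow hi hj hi hj g).trans ?_)
    rw [← left_right, ← conj_eq]
    rfl

@[simp]
theorem adjointComparison_mk (𝒬 : PrincipaloidBundle 𝒢 IB B IP P ι) (k : ι) (σ : 𝒬.cover k)
    (g : G) : 𝒬.adjointComparison (Clutched.mk k σ g) = 𝒬.adjointArrow k σ g := rfl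

/-- Two classes with the same image lie over the same base point; moved to a common index, they are
distinguished by the adjoint chart. -/
theorem adjointComparison_bijective (𝒬 : PrincipaloidBundle 𝒢 IB B IP P ι) :
    Function.Bijective 𝒬.adjointComparison := by
  constructor
  · intro z w hzw
    obtain ⟨i, σ, g, rfl⟩ := z.exists_rep
    obtain ⟨j, τ, h, rfl⟩ := w.exists_rep
    rw [adjointComparison_mk, adjointComparison_mk] at hzw
    have h1 := congrArg (fun x : 𝒬.Adjoint => (𝒬.anchor x.1).1) hzw
    simp only [adjointArrow, anchor_arrow] at h1
    obtain ⟨σ, hi⟩ := σ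
    obtain ⟨τ, hj⟩ := τ
    dsimp only at h1
    subst h1
    have h3 := congrArg 𝒬.adjointComparison (Clutched.mk_eq_mk_of_mem hi hj h)
    have h2 := congrArg (𝒬.adjointChart i) (hzw.trans h3)
    rw [adjointComparison_mk, adjointChart_adjointArrow, adjointChart_adjointArrow] at h2
    obtain rfl : g = _ := (Prod.ext_iff.1 h2).2
    exact (Clutched.mk_eq_mk_of_mem hi hj h).symm
  · intro x
    exact ⟨Clutched.mk _ ⟨_, 𝒬.index_mem _⟩ _, (𝒬.eq_adjointArrow (𝒬.index_mem _)).symm⟩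

/-- In the charts over `O k` the comparison map and its inverse are both the identity of `O k × G`.
-/
theorem exists_adjointModel_diffeomorph {EC : Type*} [NormedAddCommGroup EC] [NormedSpace ℝ EC]
    {HC : Type*} [TopologicalSpace HC] {IC : ModelWithCorners ℝ EC HC}
    (𝒬 : PrincipaloidBundle 𝒢 IB B IP P ι)
    [ChartedSpace HC 𝒬.AdjointModel] [ChartedSpace HD 𝒬.Adjoint]
    (hc : Clutched.IsModelled IB IG IC 𝒬.cover fun k l σ (g : G) => (𝒬.trans k l σ).conj g)
    (hd : ∀ k, IsSmoothChart ID (IB.prod IG) (𝒬.adjointChart k)) :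
    ∃ κ : Diffeomorph IC ID 𝒬.AdjointModel 𝒬.Adjoint ∞, ∀ k (σ : 𝒬.cover k) (g : G),
      κ (Clutched.mk k σ g) = 𝒬.adjointArrow k σ g := by
  have ht (k : ι) := (𝒬.smoothClutching_adjointModel.isSmoothTriv hc k).isSmoothChart
  let f := Equiv.ofBijective _ 𝒬.adjointComparison_bijective
  have hf : ∀ k (σ : 𝒬.cover k) (g : G), f (Clutched.mk k σ g) = 𝒬.adjointArrow k σ g :=
    fun _ _ _ => rfl
  have key (k : ι) : ∀ z ∈ (𝒬.smoothClutching_adjointModel.trivialization k).source,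
      f z ∈ (𝒬.adjointChart k).source ∧ 𝒬.adjointChart k (f z) =
        id (𝒬.smoothClutching_adjointModel.trivialization k z) := by
    intro z hz
    rw [𝒬.smoothClutching_adjointModel.exists_eq_mk hz, hf, adjointChart_adjointArrow,
      SmoothClutching.trivialization_mk]
    exact ⟨𝒬.adjointArrow_mem_source _ _ _, rfl⟩
  have key' (k : ι) : ∀ x ∈ (𝒬.adjointChart k).source,
      f.symm x ∈ (𝒬.smoothClutching_adjointModel.trivialization k).source ∧
        𝒬.smoothClutching_adjointModel.trivialization k (f.symm x) = id (𝒬.adjointChart k x) := by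
    intro x hx
    obtain ⟨σ, g, rfl⟩ := 𝒬.exists_adjointArrow_of_mem_source hx
    rw [← hf, f.symm_apply_apply, hf, adjointChart_adjointArrow, SmoothClutching.trivialization_mk]
    exact ⟨σ.2, rfl⟩
  exact ⟨⟨f, fun z => (ht _).contMDiffAt_of_comp (hd _) (𝒬.index_mem z.proj) contMDiffAt_id
      (fun w hw => (key _ w hw).1) (fun w hw => (key _ w hw).2),
    fun x => (hd _).contMDiffAt_of_comp (ht _) (𝒬.mem_adjointChart_source_index x) contMDiffAt_id
      (fun w hw => (key' _ w hw).1) (fun w hw => (key' _ w hw).2)⟩, hf⟩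

end PrincipaloidBundle

end Bundle

end Principaloid

/-! ### Assembly of the main theorem. -/

open Principaloid in
theorem mainTheorem8 {EM EG EB EP : Type*}
    [NormedAddCommGroup EM] [NormedSpace ℝ EM] [NormedAddCommGroup EG] [NormedSpace ℝ EG]
    [NormedAddCommGroup EB] [NormedSpace ℝ EB] [NormedAddCommGroup EP] [NormedSpace ℝ EP]
    {M G B P ι : Type*}
    [TopologicalSpace M] [ChartedSpace EM M] [SmoothMfd 𝓘(ℝ, EM) M]
    [TopologicalSpace G] [ChartedSpace EG G] [SmoothMfd 𝓘(ℝ, EG) G]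
    [TopologicalSpace B] [ChartedSpace EB B] [SmoothMfd 𝓘(ℝ, EB) B]
    [TopologicalSpace P] [ChartedSpace EP P] [SmoothMfd 𝓘(ℝ, EP) P]
    (𝒢 : LieGroupoid 𝓘(ℝ, EM) M 𝓘(ℝ, EG) G)
    (𝒬 : PrincipaloidBundle 𝒢 𝓘(ℝ, EB) B 𝓘(ℝ, EP) P ι) :
    -- smooth structures on the shadow, the Atiyah bundle, the adjoint bundle and its glued model
    ∃ (_ : ChartedSpace (ModelProd EB EM) 𝒬.Shadow)
      (_ : SmoothMfd (𝓘(ℝ, EB).prod 𝓘(ℝ, EM)) 𝒬.Shadow)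
      (_ : ChartedSpace (ModelProd EB EP) 𝒬.Atiyah)
      (_ : SmoothMfd (𝓘(ℝ, EB).prod 𝓘(ℝ, EP)) 𝒬.Atiyah)
      (_ : ChartedSpace (ModelProd EB EG) 𝒬.Adjoint)
      (_ : SmoothMfd (𝓘(ℝ, EB).prod 𝓘(ℝ, EG)) 𝒬.Adjoint)
      (_ : ChartedSpace (ModelProd EB EG) 𝒬.AdjointModel)
      (_ : SmoothMfd (𝓘(ℝ, EB).prod 𝓘(ℝ, EG)) 𝒬.AdjointModel)
      (𝒜 : LieGroupoid (𝓘(ℝ, EB).prod 𝓘(ℝ, EM)) 𝒬.Shadow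
        (𝓘(ℝ, EB).prod 𝓘(ℝ, EP)) 𝒬.Atiyah)
      (𝒦 : LieGroupoid (𝓘(ℝ, EB).prod 𝓘(ℝ, EM)) 𝒬.Shadow
        (𝓘(ℝ, EB).prod 𝓘(ℝ, EG)) 𝒬.Adjoint)
      (p : 𝒜.Hom (LieGroupoid.pair 𝓘(ℝ, EB) B))
      (j : 𝒦.Hom 𝒜)
      (κ : Diffeomorph (𝓘(ℝ, EB).prod 𝓘(ℝ, EG)) (𝓘(ℝ, EB).prod 𝓘(ℝ, EG))
        𝒬.AdjointModel 𝒬.Adjoint ∞),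
      -- these are the smooth structures of the clutching models
      Clutched.IsModelled 𝓘(ℝ, EB) 𝓘(ℝ, EM) (𝓘(ℝ, EB).prod 𝓘(ℝ, EM)) 𝒬.cover
        (fun k l σ (m : M) => (𝒬.trans k l σ).shadow m) ∧
      Clutched.IsModelled 𝓘(ℝ, EB) 𝓘(ℝ, EP) (𝓘(ℝ, EB).prod 𝓘(ℝ, EP)) 𝒬.cover
        (fun k l σ (q : P) => 𝒬.rightAct q (𝒬.trans k l σ).symm) ∧
      Clutched.IsModelled 𝓘(ℝ, EB) 𝓘(ℝ, EG) (𝓘(ℝ, EB).prod 𝓘(ℝ, EG)) 𝒬.cover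
        (fun k l σ (g : G) => (𝒬.trans k l σ).conj g) ∧
      -- the structure maps of the Atiyah groupoid are modelled on those of `𝒢`
      (∀ k l (σ₁ : 𝒬.cover k) (g : G) (σ₂ : 𝒬.cover l),
        𝒜.src (𝒬.arrow k l σ₁ g σ₂) = Clutched.mk l σ₂ (𝒢.src g) ∧
        𝒜.tgt (𝒬.arrow k l σ₁ g σ₂) = Clutched.mk k σ₁ (𝒢.tgt g) ∧
        𝒜.inv (𝒬.arrow k l σ₁ g σ₂) = 𝒬.arrow l k σ₂ (𝒢.inv g) σ₁) ∧
      (∀ k (σ : 𝒬.cover k) (m : M),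
        𝒜.one (Clutched.mk k σ m) = 𝒬.arrow k k σ (𝒢.one m) σ) ∧
      (∀ k l l' n (σ₁ : 𝒬.cover k) (σ₂ : B) (h₂ : σ₂ ∈ 𝒬.cover l) (h₂' : σ₂ ∈ 𝒬.cover l')
        (σ₃ : 𝒬.cover n) (g h : G), 𝒢.src g = 𝒢.tgt ((𝒬.trans l l' σ₂).left h) →
        𝒜.mul (𝒬.arrow k l σ₁ g ⟨σ₂, h₂⟩) (𝒬.arrow l' n ⟨σ₂, h₂'⟩ h σ₃) =
          𝒬.arrow k n σ₁ (𝒢.mul g ((𝒬.trans l l' σ₂).left h)) σ₃) ∧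
      -- over `O k × O l`, the Atiyah bundle is trivialised by the coordinates `(σ₁, g, σ₂)`
      (∀ k l, ∃ Θ : Bundle.Trivialization G 𝒬.anchor,
        Θ.baseSet = 𝒬.cover k ×ˢ 𝒬.cover l ∧
        IsSmoothTriv (𝓘(ℝ, EB).prod 𝓘(ℝ, EB)) 𝓘(ℝ, EG) (𝓘(ℝ, EB).prod 𝓘(ℝ, EP)) Θ ∧
        ∀ (σ₁ : 𝒬.cover k) (g : G) (σ₂ : 𝒬.cover l),
          Θ (𝒬.arrow k l σ₁ g σ₂) = (((σ₁ : B), (σ₂ : B)), g)) ∧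
      -- the short exact sequence of Lie groupoids
      p.obj = Clutched.proj ∧ p.arr = 𝒬.anchor ∧ j.obj = id ∧ j.arr = Subtype.val ∧
      IsShortExact j p ∧
      -- the fibre-bundle object over the pair groupoid, with fibre `𝒢`
      IsFibreBundleObject p 𝒢 ∧
      -- the adjoint bundle is glued by conjugation
      (∀ k (σ : 𝒬.cover k) (g : G),
        (κ (Clutched.mk k σ g) : 𝒬.Atiyah) = 𝒬.arrow k k σ g σ) := by
  obtain ⟨cS, mS, hS⟩ := 𝒬.smoothClutching_shadow.exists_isModelled
  obtain ⟨cA, mA, hA⟩ := 𝒬.smoothClutching_atiyah.exists_isModelled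
  obtain ⟨cC, mC, hC⟩ := 𝒬.smoothClutching_adjointModel.exists_isModelled
  -- The adjoint bundle inherits these two properties as a subspace of the Atiyah bundle.
  have := mA.toT2Space
  have := mA.toSecondCountableTopology
  obtain ⟨cD, mD, hD⟩ := 𝒬.exists_adjoint_smoothMfd
  have hm : 𝒬.IsModelled (𝓘(ℝ, EB).prod 𝓘(ℝ, EM)) (𝓘(ℝ, EB).prod 𝓘(ℝ, EP)) := ⟨hS, hA⟩
  obtain ⟨κ, hκ⟩ := 𝒬.exists_adjointModel_diffeomorph hC hD
  refine ⟨cS, mS, cA, mA, cD, mD, cC, mC, hm.atiyahGroupoid, hm.adjointGroupoid hD, hm.anchorHom,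
    hm.inclusionHom hD, κ, hS, hA, hC, ?_, 𝒬.atiyahOne_mk, ?_, ?_, rfl, rfl, rfl, rfl,
    hm.isShortExact hD, hm.isFibreBundleObject, ?_⟩
  · exact fun k l σ₁ g σ₂ => ⟨𝒬.atiyahSrc_arrow k l σ₁ σ₂ g, 𝒬.atiyahTgt_arrow k l σ₁ σ₂ g,
      𝒬.atiyahInv_arrow k l σ₁ σ₂ g⟩
  · intro k l l' n σ₁ σ₂ h₂ h₂' σ₃ g h hgh
    -- Rewriting the second factor with index `l` at `σ₂` produces exactly the left multiplication
    -- in the stated formula.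
    rw [𝒬.arrow_change_left h₂' h₂]
    exact 𝒬.atiyahMul_arrow k l n σ₁ ⟨σ₂, h₂⟩ σ₃ hgh
  · exact fun k l => ⟨𝒬.atiyahTriv k l, rfl, hm.isSmoothTriv_atiyahTriv k l,
      𝒬.atiyahTriv_arrow k l⟩
  · exact fun k σ g => congrArg Subtype.val (hκ k σ g)
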